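/- Let $n\ge 0$ be an integer and $\lambda\in\mathbb R$. Put $e(t)=e^{2\pi i t}$, $\bar e(t)=e^{-2\pi i t}$, $\eta_\lambda(r)=\frac{e^{2\lambda r}-1}{2\lambda}$ for $\lambda\neq 0$, $\eta_0(r)=r$, and let $\beta$ be the usual inner product on $\mathbb R^n$. Let $\mathcal H=L^2(\mathbb R^n\times\mathbb R^n\times\mathbb R)$ (variables $(x,y,r)$, Lebesgue measure), and let $U_A$ be the unitary operator on $\mathcal H\otimes\mathcal H$ given by $$U_A\xi(x,y,r,x',y',r')=(e^{-\lambda r'})^n\,\bar e\bigl[\eta_\lambda(r')\beta(e^{-\lambda r'}x,\,y'-e^{-\lambda r'}y)\bigr]\,\xi(e^{-\lambda r'}x,e^{-\lambda r'}y,r+r',x'-e^{-\lambda r'}x,y'-e^{-\lambda r'}y,r').$$ Let $\hat A\subseteq\mathcal B(\mathcal H)$ be the $C^*$-algebra generated by the operators $(\mathrm{id}\otimes\omega)(U_A)$, $\omega\in\mathcal B(\mathcal H)_*$, and let $\hat\Delta(b)=U_A^*(1\otimes b)U_A$ for $b\in\hat A$. Let $\hat{\mathcal A}$ be the space of Schwartz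 functions in $(x,y,r)$ with compact support in $r$, and for $f\in\hat{\mathcal A}$ let $\rho_f\in\mathcal B(\mathcal H)$ be the operator $$(\rho_f\zeta)(x,y,r)=\int (e^{\lambda\tilde r})^n f(x,y,\tilde r)\,\zeta(e^{\lambda\tilde r}x,e^{\lambda\tilde r}y,r-\tilde r)\,d\tilde r .$$ Then: 1. $\rho_f\in\hat A$ for $f\in\hat{\mathcal A}$, and $\hat\Delta(b)\in M(\hat A\otimes\hat A)$ for $b\in\hat A$ (spatial tensor product). 2. For $f\in\hat{\mathcal A}$ the function $\hat S(f)(x,y,r)=\bar e[\eta_\lambda(r)\beta(x,y)]\,f(-e^{\lambda r}x,-e^{\lambda r}y,-r)$ belongs to $\hat{\mathcal A}$, and there is a unique $*$-anti-automorphism $\hat S$ of $\hat A$ with $\hat S(\rho_f)=\rho_{\hat S(f)}$ for all $f\in\hat{\mathcal A}$. 3. A $*$-anti-automorphism $\hat S$ of $\hat A$ has the property in 2 if and only if $\hat S(b)=Jb^*J$ for all $b\in\hat A$, where $J$ is the anti-unitary operator $J\xi(x,y,r)=\bar e[\eta_\lambda(r)\beta(x,y)]\,\overline{\xi(-x,-y,r)}$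 on $\mathcal H$. 4. For all $b\in\hat A$: $\hat S(\hat S(b)^*)^*=b$; $(\hat S\otimes\hat S)(\hat\Delta b)=\chi\bigl(\hat\Delta(\hat S(b))\bigr)$; and $\hat S^2(b)=b$. Here $\chi$ is the flip, and $\hat S\otimes\hat S$ is the $*$-anti-automorphism of $M(\hat A\otimes\hat A)$ sending $b\otimes c$ to $\hat S(b)\otimes\hat S(c)$ for $b,c\in\hat A$, which exists and is unique. -/

import Mathlib

namespace QHeis

open MeasureTheory
open scoped ENNReal InnerProductSpace ComplexConjugate TensorProduct SchwartzMap

noncomputable section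

/-- The Hilbert space of complex square-integrable functions. -/
abbrev L2 (α : Type*) [MeasureSpace α] := Lp ℂ 2 (volume : Measure α)

section WeightedComposition

variable {α : Type*} [MeasureSpace α]

theorem wcomp_eLpNorm (Φ : α → α) (w : α → ℂ)
    (h : ∀ g : α → ℝ≥0∞, Measurable g → ∫⁻ p, ‖w p‖ₑ ^ 2 * g (Φ p) = ∫⁻ p, g p) (ξ : L2 α) :
    eLpNorm (fun p => w p * ξ (Φ p)) 2 volume = eLpNorm ξ 2 volume := by
  have hξ := (Lp.stronglyMeasurable ξ).measurable
  rw [eLpNorm_eq_lintegral_rpow_enorm_toReal (by simp) (by simp),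
    eLpNorm_eq_lintegral_rpow_enorm_toReal (by simp) (by simp)]
  congr 1
  simp only [ENNReal.toReal_ofNat, ENNReal.rpow_two, enorm_mul, mul_pow]
  exact h (fun q => ‖ξ q‖ₑ ^ 2) (by fun_prop)

theorem wcomp_memLp (Φ : α → α) (w : α → ℂ) (hΦ : Measurable Φ) (hw : Measurable w)
    (h : ∀ g : α → ℝ≥0∞, Measurable g → ∫⁻ p, ‖w p‖ₑ ^ 2 * g (Φ p) = ∫⁻ p, g p) (ξ : L2 α) :
    MemLp (fun p => w p * ξ (Φ p)) 2 volume :=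
  ⟨(hw.mul ((Lp.stronglyMeasurable ξ).measurable.comp hΦ)).aestronglyMeasurable, by
      rw [wcomp_eLpNorm Φ w h]; exact Lp.eLpNorm_lt_top ξ⟩

theorem wcomp_ae (Φ : α → α) (w : α → ℂ) (hΦ : Measurable Φ) (hw0 : ∀ p, w p ≠ 0)
    (hw : Measurable w)
    (h : ∀ g : α → ℝ≥0∞, Measurable g → ∫⁻ p, ‖w p‖ₑ ^ 2 * g (Φ p) = ∫⁻ p, g p)
    {P : α → Prop} (hP : ∀ᵐ q, P q) : ∀ᵐ p, P (Φ p) := by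
  have hq : Measure.QuasiMeasurePreserving Φ (volume : Measure α) volume := by
    refine ⟨hΦ, ?_⟩
    refine Measure.AbsolutelyContinuous.mk fun s hs h0 => ?_
    rw [Measure.map_apply hΦ hs]
    have h1 := h (s.indicator 1) (measurable_one.indicator hs)
    rw [lintegral_indicator_one hs, h0, lintegral_eq_zero_iff
      (by exact (hw.enorm.pow_const 2).mul ((measurable_one.indicator hs).comp hΦ))] at h1
    rw [← compl_mem_ae_iff]
    filter_upwards [h1] with p hp hps
    simp only [Set.mem_preimage] at hps
    simp [hps, hw0 p] at hp
  exact hq.ae hP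

/-- The isometry `ξ ↦ w · (ξ ∘ Φ)` of `L²`. -/
def wcomp (Φ : α → α) (w : α → ℂ) (hΦ : Measurable Φ) (hw0 : ∀ p, w p ≠ 0) (hw : Measurable w)
    (h : ∀ g : α → ℝ≥0∞, Measurable g → ∫⁻ p, ‖w p‖ₑ ^ 2 * g (Φ p) = ∫⁻ p, g p) :
    L2 α →ₗᵢ[ℂ] L2 α where
  toFun ξ := (wcomp_memLp Φ w hΦ hw h ξ).toLp _
  map_add' ξ η := by
    ext1
    filter_upwards [(wcomp_memLp Φ w hΦ hw h (ξ + η)).coeFn_toLp,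
      Lp.coeFn_add ((wcomp_memLp Φ w hΦ hw h ξ).toLp _) ((wcomp_memLp Φ w hΦ hw h η).toLp _),
      (wcomp_memLp Φ w hΦ hw h ξ).coeFn_toLp,
      (wcomp_memLp Φ w hΦ hw h η).coeFn_toLp,
      wcomp_ae Φ w hΦ hw0 hw h (Lp.coeFn_add ξ η)] with p h1 h2 h3 h4 h5
    rw [h1, h2, Pi.add_apply, h3, h4, h5, Pi.add_apply, mul_add]
  map_smul' c ξ := by
    ext1
    filter_upwards [(wcomp_memLp Φ w hΦ hw h (c • ξ)).coeFn_toLp,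
      Lp.coeFn_smul c ((wcomp_memLp Φ w hΦ hw h ξ).toLp _),
      (wcomp_memLp Φ w hΦ hw h ξ).coeFn_toLp,
      wcomp_ae Φ w hΦ hw0 hw h (Lp.coeFn_smul c ξ)] with p h1 h2 h3 h4
    rw [h1, RingHom.id_apply, h2, Pi.smul_apply, h3, h4, Pi.smul_apply, smul_eq_mul, smul_eq_mul]
    ring
  norm_map' ξ := by
    simp only [LinearMap.coe_mk, AddHom.coe_mk]
    rw [Lp.norm_toLp, wcomp_eLpNorm Φ w h, Lp.norm_def]

theorem wcomp_apply (Φ : α → α) (w : α → ℂ) (hΦ : Measurable Φ) (hw0 : ∀ p, w p ≠ 0)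
    (hw : Measurable w)
    (h : ∀ g : α → ℝ≥0∞, Measurable g → ∫⁻ p, ‖w p‖ₑ ^ 2 * g (Φ p) = ∫⁻ p, g p) (ξ : L2 α) :
    ∀ᵐ p, wcomp Φ w hΦ hw0 hw h ξ p = w p * ξ (Φ p) :=
  (wcomp_memLp Φ w hΦ hw h ξ).coeFn_toLp

theorem wcomp_inv {Φ Ψ : α → α} {v w : α → ℂ} (hΦ : Measurable Φ) (hw0 : ∀ p, w p ≠ 0)
    (hw : Measurable w)
    (h : ∀ g : α → ℝ≥0∞, Measurable g → ∫⁻ p, ‖w p‖ₑ ^ 2 * g (Φ p) = ∫⁻ p, g p)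
    (hΨ : Measurable Ψ) (hv0 : ∀ p, v p ≠ 0) (hv : Measurable v)
    (h' : ∀ g : α → ℝ≥0∞, Measurable g → ∫⁻ p, ‖v p‖ₑ ^ 2 * g (Ψ p) = ∫⁻ p, g p)
    (hi : ∀ p, Ψ (Φ p) = p) (hwv : ∀ p, w p * v (Φ p) = 1) (ξ : L2 α) :
    wcomp Φ w hΦ hw0 hw h (wcomp Ψ v hΨ hv0 hv h' ξ) = ξ := by
  ext1
  filter_upwards [wcomp_apply Φ w hΦ hw0 hw h (wcomp Ψ v hΨ hv0 hv h' ξ),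
    wcomp_ae Φ w hΦ hw0 hw h (wcomp_apply Ψ v hΨ hv0 hv h' ξ)] with p h1 h2
  rw [h1, h2, hi, ← mul_assoc, hwv, one_mul]

theorem wcomp_inv_meas {Φ Ψ : α → α} {v w : α → ℂ} (hw : Measurable w)
    (h : ∀ g : α → ℝ≥0∞, Measurable g → ∫⁻ p, ‖w p‖ₑ ^ 2 * g (Φ p) = ∫⁻ p, g p)
    (hΨ : Measurable Ψ) (hv : Measurable v)
    (hi : ∀ p, Ψ (Φ p) = p) (hwv : ∀ p, w p * v (Φ p) = 1) (g : α → ℝ≥0∞) (hg : Measurable g) :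
    ∫⁻ p, ‖v p‖ₑ ^ 2 * g (Ψ p) = ∫⁻ p, g p := by
  refine (h (fun p => ‖v p‖ₑ ^ 2 * g (Ψ p))
    ((hv.enorm.pow_const 2).mul (hg.comp hΨ))).symm.trans ?_
  congr 1 with p
  rw [hi, ← mul_assoc, ← mul_pow, ← enorm_mul, hwv]
  simp

/-- The unitary operator `ξ ↦ w · (ξ ∘ Φ)` of `L²`, with inverse `ξ ↦ v · (ξ ∘ Ψ)`. -/
def wcompEquiv (Φ Ψ : α → α) (w v : α → ℂ) (hΦ : Measurable Φ) (hw : Measurable w)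
    (hΨ : Measurable Ψ) (hv : Measurable v)
    (h : ∀ g : α → ℝ≥0∞, Measurable g → ∫⁻ p, ‖w p‖ₑ ^ 2 * g (Φ p) = ∫⁻ p, g p)
    (hi : ∀ p, Ψ (Φ p) = p) (hi' : ∀ p, Φ (Ψ p) = p) (hwv : ∀ p, w p * v (Φ p) = 1) :
    L2 α ≃ₗᵢ[ℂ] L2 α :=
  have hw0 : ∀ p, w p ≠ 0 := fun p => left_ne_zero_of_mul_eq_one (hwv p)
  have hvw : ∀ p, v p * w (Ψ p) = 1 := fun p => by have := hwv (Ψ p); rwa [hi', mul_comm] at this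
  have hv0 : ∀ p, v p ≠ 0 := fun p => left_ne_zero_of_mul_eq_one (hvw p)
  have h' := wcomp_inv_meas hw h hΨ hv hi hwv
  { wcomp Φ w hΦ hw0 hw h with
    invFun := wcomp Ψ v hΨ hv0 hv h'
    left_inv := wcomp_inv hΨ hv0 hv h' hΦ hw0 hw h hi' hvw
    right_inv := wcomp_inv hΦ hw0 hw h hΨ hv0 hv h' hi hwv }

theorem wcompEquiv_apply (Φ Ψ : α → α) (w v : α → ℂ) (hΦ : Measurable Φ) (hw : Measurable w)
    (hΨ : Measurable Ψ) (hv : Measurable v)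
    (h : ∀ g : α → ℝ≥0∞, Measurable g → ∫⁻ p, ‖w p‖ₑ ^ 2 * g (Φ p) = ∫⁻ p, g p)
    (hi : ∀ p, Ψ (Φ p) = p) (hi' : ∀ p, Φ (Ψ p) = p) (hwv : ∀ p, w p * v (Φ p) = 1) (ξ : L2 α) :
    ∀ᵐ p, wcompEquiv Φ Ψ w v hΦ hw hΨ hv h hi hi' hwv ξ p = w p * ξ (Φ p) :=
  wcomp_apply Φ w hΦ (fun p => left_ne_zero_of_mul_eq_one (hwv p)) hw h ξ

/-- Complex conjugation on `L²`. -/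
def conjL2 : L2 α ≃ₗᵢ⋆[ℂ] L2 α where
  toFun ξ := star ξ
  invFun ξ := star ξ
  left_inv := star_star
  right_inv := star_star
  map_add' ξ η := by
    ext1
    filter_upwards [Lp.coeFn_star (ξ + η), Lp.coeFn_star ξ, Lp.coeFn_star η, Lp.coeFn_add ξ η,
      Lp.coeFn_add (star ξ) (star η)] with p h1 h2 h3 h4 h5
    rw [h1, h5]
    simp only [Pi.star_apply, Pi.add_apply, h2, h3, h4, star_add]
  map_smul' c ξ := by
    ext1
    filter_upwards [Lp.coeFn_star (c • ξ), Lp.coeFn_star ξ, Lp.coeFn_smul c ξ,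
      Lp.coeFn_smul (starRingEnd ℂ c) (star ξ)] with p h1 h2 h4 h5
    rw [h1, h5]
    simp [h2, h4]
  norm_map' ξ := by
    simp only [LinearEquiv.coe_mk, LinearMap.coe_mk, AddHom.coe_mk]
    rw [Lp.norm_def, Lp.norm_def, eLpNorm_congr_ae (Lp.coeFn_star ξ)]
    congr 1
    exact eLpNorm_congr_norm_ae (by simp)

end WeightedComposition

section Tensor

variable {α : Type*} [MeasureSpace α] [SigmaFinite (volume : Measure α)]

theorem tmul_eLpNorm (ξ η : L2 α) :
    eLpNorm (fun p : α × α => ξ p.1 * η p.2) 2 volume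
      = eLpNorm ξ 2 volume * eLpNorm η 2 volume := by
  have hξ := (Lp.stronglyMeasurable ξ).measurable
  have hη := (Lp.stronglyMeasurable η).measurable
  rw [eLpNorm_eq_lintegral_rpow_enorm_toReal (by simp) (by simp),
    eLpNorm_eq_lintegral_rpow_enorm_toReal (by simp) (by simp),
    eLpNorm_eq_lintegral_rpow_enorm_toReal (by simp) (by simp),
    ← ENNReal.mul_rpow_of_nonneg _ _ (by simp)]
  congr 1
  simp only [ENNReal.toReal_ofNat, ENNReal.rpow_two, enorm_mul, mul_pow]
  rw [Measure.volume_eq_prod, lintegral_prod_mul (f := fun p => ‖ξ p‖ₑ ^ 2)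
    (g := fun p => ‖η p‖ₑ ^ 2)] <;> fun_prop

theorem tmul_memLp (ξ η : L2 α) : MemLp (fun p : α × α => ξ p.1 * η p.2) 2 volume := by
  refine ⟨?_, ?_⟩
  · exact (((Lp.stronglyMeasurable ξ).measurable.comp measurable_fst).mul
      ((Lp.stronglyMeasurable η).measurable.comp measurable_snd)).aestronglyMeasurable
  · rw [tmul_eLpNorm]
    exact ENNReal.mul_lt_top (Lp.eLpNorm_lt_top ξ) (Lp.eLpNorm_lt_top η)

theorem ae_fst {P : α → Prop} (h : ∀ᵐ p, P p) : ∀ᵐ p : α × α, P p.1 :=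
  Measure.quasiMeasurePreserving_fst.ae h

theorem ae_snd {P : α → Prop} (h : ∀ᵐ p, P p) : ∀ᵐ p : α × α, P p.2 :=
  Measure.quasiMeasurePreserving_snd.ae h

/-- The elementary tensor `ξ ⊗ η`, the function `(p, q) ↦ ξ(p) η(q)` of
`L²(α × α) = L²(α) ⊗ L²(α)`, as a bounded bilinear map. -/
def tmul : L2 α →L[ℂ] L2 α →L[ℂ] L2 (α × α) :=
  LinearMap.mkContinuous₂ (LinearMap.mk₂ ℂ (fun ξ η => (tmul_memLp ξ η).toLp _)
    (fun ξ ξ' η => by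
      ext1
      filter_upwards [(tmul_memLp (ξ + ξ') η).coeFn_toLp, (tmul_memLp ξ η).coeFn_toLp,
        (tmul_memLp ξ' η).coeFn_toLp, Lp.coeFn_add ((tmul_memLp ξ η).toLp _)
          ((tmul_memLp ξ' η).toLp _), ae_fst (Lp.coeFn_add ξ ξ')] with p h1 h2 h3 h4 h5
      rw [h1, h4, Pi.add_apply, h2, h3, h5, Pi.add_apply, add_mul])
    (fun c ξ η => by
      ext1
      filter_upwards [(tmul_memLp (c • ξ) η).coeFn_toLp, (tmul_memLp ξ η).coeFn_toLp,
        Lp.coeFn_smul c ((tmul_memLp ξ η).toLp _), ae_fst (Lp.coeFn_smul c ξ)] with p h1 h2 h4 h5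
      rw [h1, h4, Pi.smul_apply, h2, h5, Pi.smul_apply, smul_eq_mul, smul_eq_mul, mul_assoc])
    (fun ξ η η' => by
      ext1
      filter_upwards [(tmul_memLp ξ (η + η')).coeFn_toLp, (tmul_memLp ξ η).coeFn_toLp,
        (tmul_memLp ξ η').coeFn_toLp, Lp.coeFn_add ((tmul_memLp ξ η).toLp _)
          ((tmul_memLp ξ η').toLp _), ae_snd (Lp.coeFn_add η η')] with p h1 h2 h3 h4 h5
      rw [h1, h4, Pi.add_apply, h2, h3, h5, Pi.add_apply, mul_add])
    (fun c ξ η => by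
      ext1
      filter_upwards [(tmul_memLp ξ (c • η)).coeFn_toLp, (tmul_memLp ξ η).coeFn_toLp,
        Lp.coeFn_smul c ((tmul_memLp ξ η).toLp _), ae_snd (Lp.coeFn_smul c η)] with p h1 h2 h4 h5
      rw [h1, h4, Pi.smul_apply, h2, h5, Pi.smul_apply, smul_eq_mul, smul_eq_mul]
      ring)) 1
    (fun ξ η => by
      rw [LinearMap.mk₂_apply, Lp.norm_toLp, tmul_eLpNorm, ENNReal.toReal_mul, one_mul,
        Lp.norm_def, Lp.norm_def])

theorem tmul_apply (ξ η : L2 α) : ∀ᵐ p : α × α, tmul ξ η p = ξ p.1 * η p.2 :=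
  (tmul_memLp ξ η).coeFn_toLp

theorem inner_tmul_tmul (ξ η ξ' η' : L2 α) :
    ⟪tmul ξ η, tmul ξ' η'⟫_ℂ = ⟪ξ, ξ'⟫_ℂ * ⟪η, η'⟫_ℂ := by
  rw [L2.inner_def, L2.inner_def, L2.inner_def, ← integral_prod_mul]
  refine integral_congr_ae ?_
  filter_upwards [tmul_apply ξ η, tmul_apply ξ' η'] with p h1 h2
  rw [h1, h2]
  simp only [RCLike.inner_apply, map_mul]
  ring

/-- The isometric embedding of the algebraic tensor product. -/
def tensorEmb : (L2 α ⊗[ℂ] L2 α) →ₗᵢ[ℂ] L2 (α × α) :=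
  LinearMap.isometryOfInner (TensorProduct.lift (tmul (α := α)).toLinearMap₁₂) (by
    intro x y
    induction x using TensorProduct.induction_on with
    | zero => simp
    | add x x' hx hx' => rw [map_add, inner_add_left, inner_add_left, hx, hx']
    | tmul ξ η =>
      induction y using TensorProduct.induction_on with
      | zero => simp
      | add y y' hy hy' => rw [map_add, inner_add_right, inner_add_right, hy, hy']
      | tmul ξ' η' => simpa using inner_tmul_tmul ξ η ξ' η')

theorem tensorEmb_tmul (ξ η : L2 α) : tensorEmb (ξ ⊗ₜ[ℂ] η) = tmul ξ η := by
  simp [tensorEmb]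

theorem eq_zero_of_rect (F : L2 (α × α))
    (hF : ∀ s t : Set α, MeasurableSet s → MeasurableSet t → volume s < ∞ → volume t < ∞ →
      ∫ p in s ×ˢ t, F p = 0) : F = 0 := by
  have key : ∀ n : ℕ, ∀ A : Set (α × α), MeasurableSet A →
      ∫ p in A, F p ∂(volume.restrict (spanningSets (volume : Measure α) n ×ˢ
        spanningSets (volume : Measure α) n)) = 0 := by
    intro n
    set S := spanningSets (volume : Measure α) n with hS
    have hSm : MeasurableSet S := measurableSet_spanningSets _ _
    have hSf : volume S < ∞ := measure_spanningSets_lt_top _ _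
    have hSS : (volume : Measure (α × α)) (S ×ˢ S) < ∞ := by
      rw [Measure.volume_eq_prod, Measure.prod_prod]; exact ENNReal.mul_lt_top hSf hSf
    have : IsFiniteMeasure ((volume : Measure (α × α)).restrict (S ×ˢ S)) :=
      ⟨by simpa using hSS⟩
    have hint : Integrable F (volume.restrict (S ×ˢ S)) :=
      ((Lp.memLp F).restrict _).integrable (by norm_num)
    refine MeasurableSpace.induction_on_inter generateFrom_prod.symm isPiSystem_prod ?_ ?_ ?_ ?_
    · simp
    · rintro _ ⟨s, hs, t, ht, rfl⟩
      rw [Measure.restrict_restrict (hs.prod ht), Set.prod_inter_prod]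
      exact hF _ _ (hs.inter hSm) (ht.inter hSm)
        ((measure_mono Set.inter_subset_right).trans_lt hSf)
        ((measure_mono Set.inter_subset_right).trans_lt hSf)
    · intro A hA h
      have h1 := integral_add_compl hA hint
      rw [h, zero_add] at h1
      rw [h1]
      exact hF S S hSm hSm hSf hSf
    · intro A hd hA h
      rw [integral_iUnion hA hd hint.integrableOn]
      simp [h]
  have h0 : ∀ n : ℕ, ∀ᵐ p ∂(volume.restrict (spanningSets (volume : Measure α) n ×ˢ
        spanningSets (volume : Measure α) n)), F p = 0 := by
    intro n
    have hSS : (volume : Measure (α × α)) (spanningSets (volume : Measure α) n ×ˢ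
        spanningSets (volume : Measure α) n) < ∞ := by
      rw [Measure.volume_eq_prod, Measure.prod_prod]
      exact ENNReal.mul_lt_top (measure_spanningSets_lt_top _ _) (measure_spanningSets_lt_top _ _)
    have : IsFiniteMeasure ((volume : Measure (α × α)).restrict
        (spanningSets (volume : Measure α) n ×ˢ spanningSets (volume : Measure α) n)) :=
      ⟨by simpa using hSS⟩
    exact (((Lp.memLp F).restrict _).integrable (by norm_num)).ae_eq_zero_of_forall_setIntegral_eq_zero
      fun s hs _ => key n s hs
  have h1 : ∀ᵐ p : α × α, F p = 0 := by
    have h2 : ∀ᵐ p ∂((volume : Measure (α × α)).restrict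
        (⋃ n, spanningSets (volume : Measure α) n ×ˢ spanningSets (volume : Measure α) n)),
        F p = 0 := by
      rw [ae_restrict_iUnion_iff]; exact h0
    have h3 : (⋃ n, spanningSets (volume : Measure α) n ×ˢ spanningSets (volume : Measure α) n)
        = Set.univ := by
      rw [Set.eq_univ_iff_forall]
      rintro ⟨a, b⟩
      have ha : a ∈ ⋃ n, spanningSets (volume : Measure α) n := by
        rw [iUnion_spanningSets]; trivial
      have hb : b ∈ ⋃ n, spanningSets (volume : Measure α) n := by
        rw [iUnion_spanningSets]; trivial
      obtain ⟨i, hi⟩ := Set.mem_iUnion.1 ha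
      obtain ⟨j, hj⟩ := Set.mem_iUnion.1 hb
      exact Set.mem_iUnion.2 ⟨max i j, monotone_spanningSets _ (le_max_left i j) hi,
        monotone_spanningSets _ (le_max_right i j) hj⟩
    rwa [h3, Measure.restrict_univ] at h2
  ext1
  filter_upwards [h1, Lp.coeFn_zero ℂ 2 (volume : Measure (α × α))] with p hp h0
  rw [hp, h0, Pi.zero_apply]

theorem tensorEmb_denseRange : DenseRange (tensorEmb (α := α)) := by
  have h : (LinearMap.range (tensorEmb (α := α)).toLinearMap).topologicalClosure = ⊤ := by
    rw [Submodule.topologicalClosure_eq_top_iff, Submodule.eq_bot_iff]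
    intro F hF
    refine eq_zero_of_rect F fun s t hs ht hsf htf => ?_
    have h1 := (Submodule.mem_orthogonal _ _).1 hF _
      ⟨indicatorConstLp 2 hs hsf.ne (1 : ℂ) ⊗ₜ[ℂ] indicatorConstLp 2 ht htf.ne (1 : ℂ), rfl⟩
    simp only [LinearIsometry.coe_toLinearMap, tensorEmb_tmul] at h1
    have hst : (volume : Measure (α × α)) (s ×ˢ t) ≠ ∞ := by
      rw [Measure.volume_eq_prod, Measure.prod_prod]; exact (ENNReal.mul_lt_top hsf htf).ne
    rw [← L2.inner_indicatorConstLp_one (hs.prod ht) hst F, ← h1]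
    congr 1
    ext1
    filter_upwards [tmul_apply (indicatorConstLp 2 hs hsf.ne (1 : ℂ))
        (indicatorConstLp 2 ht htf.ne (1 : ℂ)),
      ae_fst (indicatorConstLp_coeFn (p := 2) (hs := hs) (hμs := hsf.ne) (c := (1 : ℂ))),
      ae_snd (indicatorConstLp_coeFn (p := 2) (hs := ht) (hμs := htf.ne) (c := (1 : ℂ))),
      indicatorConstLp_coeFn (p := 2) (hs := hs.prod ht) (hμs := hst) (c := (1 : ℂ))]
      with p h1 h2 h3 h4
    rw [h1, h2, h3, h4]
    by_cases ha : p.1 ∈ s <;> by_cases hb : p.2 ∈ t <;> simp [Set.indicator, ha, hb]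
  have h2 := (Submodule.dense_iff_topologicalClosure_eq_top).2 h
  exact h2

/-- The operator `b ⊗ c` on `L²(α × α)`: the bounded extension of the algebraic tensor product of
`b` and `c`. -/
def tensorOp (b c : L2 α →L[ℂ] L2 α) : L2 (α × α) →L[ℂ] L2 (α × α) :=
  ((tensorEmb (α := α)).toContinuousLinearMap ∘L TensorProduct.mapL b c).extend
    (tensorEmb (α := α)).toContinuousLinearMap

theorem tensorOp_tmul (b c : L2 α →L[ℂ] L2 α) (ξ η : L2 α) :
    tensorOp b c (tmul ξ η) = tmul (b ξ) (c η) := by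
  have := ContinuousLinearMap.extend_eq
    ((tensorEmb (α := α)).toContinuousLinearMap ∘L TensorProduct.mapL b c)
    (e := (tensorEmb (α := α)).toContinuousLinearMap) tensorEmb_denseRange
    (tensorEmb (α := α)).isometry.isUniformInducing (ξ ⊗ₜ[ℂ] η)
  simp only [ContinuousLinearMap.comp_apply, LinearIsometry.coe_toContinuousLinearMap,
    TensorProduct.mapL_tmul, tensorEmb_tmul] at this
  exact this

/-- The flip `Σ` of `L²(α) ⊗ L²(α)`, `(Σ F)(p, q) = F(q, p)`. -/
def flipU : L2 (α × α) ≃ₗᵢ[ℂ] L2 (α × α) :=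
  wcompEquiv Prod.swap Prod.swap 1 1 measurable_swap measurable_one measurable_swap measurable_one
    (fun g hg => by
      simp only [Pi.one_apply, enorm_one, one_pow, one_mul]
      exact (Measure.measurePreserving_swap (μ := (volume : Measure α))
        (ν := (volume : Measure α))).lintegral_comp hg)
    (by simp) (by simp) (by simp)

/-- The functional `ω_{ξ,η}(T) = ⟨Tξ, η⟩`, the inner product being linear in `Tξ` and
conjugate linear in `η`. -/
def vecFunctional (ξ η : L2 α) : StrongDual ℂ (L2 α →L[ℂ] L2 α) :=
  (innerSL ℂ η) ∘L (ContinuousLinearMap.apply ℂ (L2 α) ξ)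

/-- The predual of the bounded operators: the norm closed linear span of the functionals
`ω_{ξ,η}`. -/
def predual (α : Type*) [MeasureSpace α] :
    Submodule ℂ (StrongDual ℂ (L2 α →L[ℂ] L2 α)) :=
  (Submodule.span ℂ {ω | ∃ ξ η : L2 α, ω = vecFunctional ξ η}).topologicalClosure

/-- The slice `(ω_{ζ,θ} ⊗ id)(T)`: `⟨(ω_{ζ,θ} ⊗ id)(T) ξ, η⟩ = ⟨T(ζ ⊗ ξ), θ ⊗ η⟩`. -/
def vecSlice (T : L2 (α × α) →L[ℂ] L2 (α × α)) (ζ θ : L2 α) : L2 α →L[ℂ] L2 α :=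
  (tmul θ).adjoint ∘L T ∘L tmul ζ

theorem vecSlice_add_right (T : L2 (α × α) →L[ℂ] L2 (α × α)) (ζ θ θ' : L2 α) :
    vecSlice T ζ (θ + θ') = vecSlice T ζ θ + vecSlice T ζ θ' := by
  unfold vecSlice
  rw [map_add, map_add, ContinuousLinearMap.add_comp]

theorem vecSlice_smul_right (T : L2 (α × α) →L[ℂ] L2 (α × α)) (c : ℂ) (ζ θ : L2 α) :
    vecSlice T ζ (c • θ) = starRingEnd ℂ c • vecSlice T ζ θ := by
  unfold vecSlice
  rw [map_smul, map_smulₛₗ, ContinuousLinearMap.smul_comp]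

theorem vecSlice_add_left (T : L2 (α × α) →L[ℂ] L2 (α × α)) (ζ ζ' θ : L2 α) :
    vecSlice T (ζ + ζ') θ = vecSlice T ζ θ + vecSlice T ζ' θ := by
  unfold vecSlice
  rw [map_add, ContinuousLinearMap.comp_add, ContinuousLinearMap.comp_add]

theorem vecSlice_smul_left (T : L2 (α × α) →L[ℂ] L2 (α × α)) (c : ℂ) (ζ θ : L2 α) :
    vecSlice T (c • ζ) θ = c • vecSlice T ζ θ := by
  unfold vecSlice
  rw [map_smul, ContinuousLinearMap.comp_smul, ContinuousLinearMap.comp_smul]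

theorem norm_vecSlice_le (T : L2 (α × α) →L[ℂ] L2 (α × α)) (ζ θ : L2 α) :
    ‖vecSlice T ζ θ‖ ≤ ‖T‖ * ‖θ‖ * ‖ζ‖ := by
  have h : ∀ ζ : L2 α, ‖tmul ζ‖ ≤ ‖ζ‖ := fun ζ => by
    refine ((tmul (α := α)).le_opNorm ζ).trans ?_
    refine (mul_le_mul_of_nonneg_right ?_ (norm_nonneg _)).trans_eq (one_mul _)
    exact LinearMap.mkContinuous₂_norm_le _ zero_le_one _
  calc ‖vecSlice T ζ θ‖ ≤ ‖(tmul θ).adjoint‖ * (‖T‖ * ‖tmul ζ‖) :=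
        (ContinuousLinearMap.opNorm_comp_le _ _).trans
          (mul_le_mul_of_nonneg_left (ContinuousLinearMap.opNorm_comp_le _ _) (norm_nonneg _))
    _ ≤ ‖θ‖ * (‖T‖ * ‖ζ‖) := by
        rw [LinearIsometryEquiv.norm_map]
        gcongr <;> exact h _
    _ = _ := by ring

/-- The bounded sesquilinear form `(θ, ζ) ↦ ω((ω_{ζ,θ} ⊗ id)(T))`. -/
def sliceForm (ω : StrongDual ℂ (L2 α →L[ℂ] L2 α)) (T : L2 (α × α) →L[ℂ] L2 (α × α)) :
    L2 α →L⋆[ℂ] L2 α →L[ℂ] ℂ :=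
  LinearMap.mkContinuous₂ (LinearMap.mk₂'ₛₗ (starRingEnd ℂ) (RingHom.id ℂ)
    (fun θ ζ => ω (vecSlice T ζ θ))
    (fun θ θ' ζ => by rw [vecSlice_add_right, map_add])
    (fun c θ ζ => by rw [vecSlice_smul_right, map_smul])
    (fun θ ζ ζ' => by rw [vecSlice_add_left, map_add])
    (fun c θ ζ => by rw [vecSlice_smul_left, map_smul, RingHom.id_apply]))
    (‖ω‖ * ‖T‖) (fun θ ζ => by
      rw [LinearMap.mk₂'ₛₗ_apply]
      refine (ω.le_opNorm _).trans ((mul_le_mul_of_nonneg_left (norm_vecSlice_le T ζ θ)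
        (norm_nonneg _)).trans_eq (by ring)))

/-- The right slice `(id ⊗ ω)(T)`, the operator with
`⟨(id ⊗ ω)(T) ζ, θ⟩ = ω((ω_{ζ,θ} ⊗ id)(T))`. -/
def rightSlice (ω : StrongDual ℂ (L2 α →L[ℂ] L2 α)) (T : L2 (α × α) →L[ℂ] L2 (α × α)) :
    L2 α →L[ℂ] L2 α :=
  (InnerProductSpace.continuousLinearMapOfBilin (sliceForm ω T)).adjoint

theorem inner_rightSlice (ω : StrongDual ℂ (L2 α →L[ℂ] L2 α))
    (T : L2 (α × α) →L[ℂ] L2 (α × α)) (ζ θ : L2 α) :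
    ⟪θ, rightSlice ω T ζ⟫_ℂ = ω (vecSlice T ζ θ) := by
  rw [rightSlice, ContinuousLinearMap.adjoint_inner_right,
    InnerProductSpace.continuousLinearMapOfBilin_apply]
  rfl

theorem rightSlice_vecFunctional (ξ η ζ θ : L2 α) (T : L2 (α × α) →L[ℂ] L2 (α × α)) :
    ⟪θ, rightSlice (vecFunctional ξ η) T ζ⟫_ℂ = ⟪tmul θ η, T (tmul ζ ξ)⟫_ℂ := by
  rw [inner_rightSlice]
  simp [vecFunctional, vecSlice, ContinuousLinearMap.adjoint_inner_right]

end Tensor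

/-- The space `ℝⁿ` of the variables `x` and `y`. -/
abbrev V (n : ℕ) := EuclideanSpace ℝ (Fin n)

/-- The space of the variables `(x, y, r)`, with Lebesgue measure. -/
abbrev X (n : ℕ) := V n × V n × ℝ

/-- The function `η_λ(r) = (e^{2λr} - 1) / (2λ)`, with `η_0(r) = r`. -/
def eta (lam r : ℝ) : ℝ := if lam = 0 then r else (Real.exp (2 * lam * r) - 1) / (2 * lam)

/-- The character `e(t) = e^{2πit}`. -/
def ee (t : ℝ) : ℂ := Complex.exp (2 * Real.pi * t * Complex.I)

/-- The conjugate character `ē(t) = e^{-2πit}`. -/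
def eBar (t : ℝ) : ℂ := Complex.exp (-(2 * Real.pi * t * Complex.I))

theorem eBar_mul_ee (t : ℝ) : eBar t * ee t = 1 := by
  rw [eBar, ee, ← Complex.exp_add, neg_add_cancel, Complex.exp_zero]

theorem enorm_ee (t : ℝ) : ‖ee t‖ₑ = 1 := by
  have : ‖ee t‖ = 1 := by
    rw [ee, show (2 * Real.pi * t * Complex.I : ℂ) = ((2 * Real.pi * t : ℝ) : ℂ) * Complex.I by
      push_cast; ring, Complex.norm_exp_ofReal_mul_I]
  rw [← ofReal_norm, this, ENNReal.ofReal_one]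

theorem enorm_eBar (t : ℝ) : ‖eBar t‖ₑ = 1 := by
  have := congrArg (fun z => ‖z‖ₑ) (eBar_mul_ee t)
  simpa [enorm_mul, enorm_ee] using this

@[fun_prop]
theorem measurable_eta (lam : ℝ) : Measurable (eta lam) := by
  unfold eta
  split_ifs <;> fun_prop

@[fun_prop]
theorem measurable_ee : Measurable ee := by unfold ee; fun_prop

@[fun_prop]
theorem measurable_eBar : Measurable eBar := by unfold eBar; fun_prop

theorem lintegral_scale (n : ℕ) {c : ℝ} (hc : 0 < c) (h : V n → ℝ≥0∞) (hh : Measurable h) :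
    ∫⁻ x, ENNReal.ofReal c ^ n * h (c • x) = ∫⁻ x, h x := by
  rw [lintegral_const_mul _ (by fun_prop)]
  have h1 : ∫⁻ x, h (c • x) = ENNReal.ofReal |(c ^ n)⁻¹| * ∫⁻ x, h x := by
    rw [← lintegral_map (f := h) (g := fun x => c • x) hh (by fun_prop),
      Measure.map_addHaar_smul _ hc.ne', lintegral_smul_measure, finrank_euclideanSpace_fin,
      smul_eq_mul]
  rw [h1, ← mul_assoc, ← ENNReal.ofReal_pow hc.le, ← ENNReal.ofReal_mul (by positivity),
    abs_of_pos (by positivity), mul_inv_cancel₀ (by positivity), ENNReal.ofReal_one, one_mul]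

theorem lintegral_dilate (n : ℕ) {c : ℝ} (hc : 0 < c) (t : ℝ) (g : X n → ℝ≥0∞)
    (hg : Measurable g) :
    ∫⁻ p : X n, (ENNReal.ofReal c ^ n) ^ 2 * g (c • p.1, c • p.2.1, p.2.2 + t) = ∫⁻ p, g p := by
  have hk : Measurable fun q : V n × V n => ∫⁻ r : ℝ, g (q.1, q.2, r) :=
    Measurable.lintegral_prod_right' (f := fun q : (V n × V n) × ℝ => g (q.1.1, q.1.2, q.2))
      (by fun_prop)
  have h1 : ∀ x y : V n, ∫⁻ r : ℝ, (ENNReal.ofReal c ^ n) ^ 2 * g (c • x, c • y, r + t)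
      = ENNReal.ofReal c ^ n * (ENNReal.ofReal c ^ n * ∫⁻ r : ℝ, g (c • x, c • y, r)) := by
    intro x y
    rw [lintegral_const_mul _ (by fun_prop),
      lintegral_add_right_eq_self (fun r => g (c • x, c • y, r)) t]
    ring
  rw [Measure.volume_eq_prod, lintegral_prod _ (by fun_prop), lintegral_prod _ (by fun_prop)]
  have h2 : ∀ x : V n, ∫⁻ q : V n × ℝ, (ENNReal.ofReal c ^ n) ^ 2 * g (c • x, c • q.1, q.2 + t)
      = ENNReal.ofReal c ^ n * ∫⁻ q : V n × ℝ, g (c • x, q) := by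
    intro x
    rw [Measure.volume_eq_prod, lintegral_prod _ (by fun_prop), lintegral_prod _ (by fun_prop)]
    simp only [h1]
    rw [lintegral_const_mul _ (by fun_prop),
      lintegral_scale n hc (fun y => ∫⁻ r : ℝ, g (c • x, y, r)) (by fun_prop)]
  simp only [h2]
  rw [lintegral_scale n hc (fun x => ∫⁻ q : V n × ℝ, g (x, q)) hg.lintegral_prod_right']

/-- The point transformation occurring in the multiplicative unitary. -/
def UMap {n : ℕ} (lam : ℝ) (p : X n × X n) : X n × X n :=
  let x := p.1.1
  let y := p.1.2.1
  let r := p.1.2.2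
  let x' := p.2.1
  let y' := p.2.2.1
  let r' := p.2.2.2
  let c := Real.exp (-(lam * r'))
  ((c • x, c • y, r + r'), (x' - c • x, y' - c • y, r'))

/-- The multiplier occurring in the multiplicative unitary. -/
def UWeight {n : ℕ} (lam : ℝ) (p : X n × X n) : ℂ :=
  let x := p.1.1
  let y := p.1.2.1
  let y' := p.2.2.1
  let r' := p.2.2.2
  let c := Real.exp (-(lam * r'))
  (c : ℂ) ^ n * eBar (eta lam r' * ⟪c • x, y' - c • y⟫_ℝ)

/-- The inverse of `UMap`. -/
def UMapInv {n : ℕ} (lam : ℝ) (p : X n × X n) : X n × X n :=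
  let c := Real.exp (lam * p.2.2.2)
  ((c • p.1.1, c • p.1.2.1, p.1.2.2 - p.2.2.2),
    (p.1.1 + p.2.1, p.1.2.1 + p.2.2.1, p.2.2.2))

/-- The multiplier of the inverse of the multiplicative unitary. -/
def UWeightInv {n : ℕ} (lam : ℝ) (p : X n × X n) : ℂ :=
  (Real.exp (lam * p.2.2.2) : ℂ) ^ n * ee (eta lam p.2.2.2 * ⟪p.1.1, p.2.2.1⟫_ℝ)

theorem measurable_UMap {n : ℕ} (lam : ℝ) : Measurable (UMap (n := n) lam) := by
  unfold UMap; fun_prop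

theorem measurable_UMapInv {n : ℕ} (lam : ℝ) : Measurable (UMapInv (n := n) lam) := by
  unfold UMapInv; fun_prop

theorem measurable_UWeight {n : ℕ} (lam : ℝ) : Measurable (UWeight (n := n) lam) := by
  unfold UWeight; fun_prop

theorem measurable_UWeightInv {n : ℕ} (lam : ℝ) : Measurable (UWeightInv (n := n) lam) := by
  unfold UWeightInv; fun_prop

theorem UMapInv_UMap {n : ℕ} (lam : ℝ) (p : X n × X n) : UMapInv lam (UMap lam p) = p := by
  obtain ⟨⟨x, y, r⟩, x', y', r'⟩ := p
  simp [UMap, UMapInv, smul_smul, ← Real.exp_add]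

theorem UMap_UMapInv {n : ℕ} (lam : ℝ) (p : X n × X n) : UMap lam (UMapInv lam p) = p := by
  obtain ⟨⟨x, y, r⟩, x', y', r'⟩ := p
  simp [UMap, UMapInv, smul_smul, ← Real.exp_add]

theorem UWeight_mul_inv {n : ℕ} (lam : ℝ) (p : X n × X n) :
    UWeight lam p * UWeightInv lam (UMap lam p) = 1 := by
  obtain ⟨⟨x, y, r⟩, x', y', r'⟩ := p
  simp only [UWeight, UWeightInv, UMap]
  rw [mul_mul_mul_comm, eBar_mul_ee, mul_one, ← mul_pow, ← Complex.ofReal_mul, ← Real.exp_add]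
  simp

theorem UWeight_enorm {n : ℕ} (lam : ℝ) (p : X n × X n) :
    ‖UWeight lam p‖ₑ = ENNReal.ofReal (Real.exp (-(lam * p.2.2.2))) ^ n := by
  simp only [UWeight, enorm_mul, enorm_pow, enorm_eBar, mul_one]
  rw [← ofReal_norm, Complex.norm_real, Real.norm_of_nonneg (Real.exp_pos _).le]

theorem lintegral_UMap {n : ℕ} (lam : ℝ) (g : X n × X n → ℝ≥0∞) (hg : Measurable g) :
    ∫⁻ p : X n × X n, ‖UWeight lam p‖ₑ ^ 2 * g (UMap lam p) = ∫⁻ p, g p := by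
  simp only [UWeight_enorm]
  have hU := measurable_UMap (n := n) lam
  rw [Measure.volume_eq_prod, lintegral_prod_symm _ (by fun_prop)]
  have h1 : ∀ q : X n, ∫⁻ p : X n, (ENNReal.ofReal (Real.exp (-(lam * q.2.2))) ^ n) ^ 2 *
      g (UMap lam (p, q))
      = ∫⁻ p : X n, g (p, (q.1 - p.1, q.2.1 - p.2.1, q.2.2)) := fun q =>
    lintegral_dilate n (Real.exp_pos (-(lam * q.2.2))) q.2.2
      (fun p => g (p, (q.1 - p.1, q.2.1 - p.2.1, q.2.2))) (by fun_prop)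
  simp only [h1]
  rw [lintegral_prod _ hg.aemeasurable, lintegral_lintegral_swap (by fun_prop)]
  congr 1 with p
  have i1 : (volume : Measure (V n × ℝ)).IsAddHaarMeasure :=
    inferInstanceAs ((volume : Measure (V n)).prod (volume : Measure ℝ)).IsAddHaarMeasure
  have i2 : (volume : Measure (X n)).IsAddHaarMeasure :=
    Measure.prod.instIsAddHaarMeasure (volume : Measure (V n)) (volume : Measure (V n × ℝ))
  have h2 := lintegral_sub_right_eq_self (μ := (volume : Measure (X n))) (fun q => g (p, q))
    (p.1, p.2.1, 0)
  rw [← h2]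
  congr 1 with q
  congr 2
  ext <;> simp

/-- The fundamental multiplicative unitary `U_A` on `L²(X × X)`:
`(U_A ξ)(x,y,r,x',y',r') = (e^{-λr'})ⁿ ē[η_λ(r') β(e^{-λr'}x, y' - e^{-λr'}y)]
ξ(e^{-λr'}x, e^{-λr'}y, r + r', x' - e^{-λr'}x, y' - e^{-λr'}y, r')`. -/
def UA (n : ℕ) (lam : ℝ) : L2 (X n × X n) ≃ₗᵢ[ℂ] L2 (X n × X n) :=
  wcompEquiv (UMap lam) (UMapInv lam) (UWeight lam) (UWeightInv lam) (measurable_UMap lam)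
    (measurable_UWeight lam) (measurable_UMapInv lam) (measurable_UWeightInv lam)
    (lintegral_UMap lam) (UMapInv_UMap lam) (UMap_UMapInv lam) (UWeight_mul_inv lam)

theorem UA_apply (n : ℕ) (lam : ℝ) (ξ : L2 (X n × X n)) :
    ∀ᵐ p, UA n lam ξ p = UWeight lam p * ξ (UMap lam p) :=
  wcompEquiv_apply _ _ _ _ _ _ _ _ _ _ _ _ ξ

/-- The unitary factor of `J`: `ξ(x,y,r) ↦ ē[η_λ(r) β(x,y)] ξ(-x,-y,r)`. -/
def JUnitary (n : ℕ) (lam : ℝ) : L2 (X n) ≃ₗᵢ[ℂ] L2 (X n) :=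
  wcompEquiv (fun p => (-p.1, -p.2.1, p.2.2)) (fun p => (-p.1, -p.2.1, p.2.2))
    (fun p => eBar (eta lam p.2.2 * ⟪p.1, p.2.1⟫_ℝ))
    (fun p => ee (eta lam p.2.2 * ⟪p.1, p.2.1⟫_ℝ))
    (by fun_prop) (by fun_prop) (by fun_prop) (by fun_prop)
    (fun g hg => by
      simp only [enorm_eBar, one_pow, one_mul]
      exact ((Measure.measurePreserving_neg (volume : Measure (V n))).prod
        ((Measure.measurePreserving_neg (volume : Measure (V n))).prod
          (MeasurePreserving.id (volume : Measure ℝ)))).lintegral_comp hg)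
    (fun p => by simp) (fun p => by simp) (fun p => by simp [eBar_mul_ee])

theorem JUnitary_apply (n : ℕ) (lam : ℝ) (ξ : L2 (X n)) :
    ∀ᵐ p : X n, JUnitary n lam ξ p
      = eBar (eta lam p.2.2 * ⟪p.1, p.2.1⟫_ℝ) * ξ (-p.1, -p.2.1, p.2.2) := by
  unfold JUnitary
  exact wcompEquiv_apply ..

/-- The anti-unitary operator `(Jξ)(x,y,r) = ē[η_λ(r) β(x,y)] conj(ξ(-x,-y,r))`. -/
def J (n : ℕ) (lam : ℝ) : L2 (X n) ≃ₗᵢ⋆[ℂ] L2 (X n) :=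
  conjL2.trans (JUnitary n lam)

theorem J_apply (n : ℕ) (lam : ℝ) (ξ : L2 (X n)) :
    ∀ᵐ p : X n, J n lam ξ p
      = eBar (eta lam p.2.2 * ⟪p.1, p.2.1⟫_ℝ) * conj (ξ (-p.1, -p.2.1, p.2.2)) := by
  have hq : Measure.QuasiMeasurePreserving (fun p : X n => (-p.1, -p.2.1, p.2.2))
      volume volume :=
    ((Measure.measurePreserving_neg (volume : Measure (V n))).prod
        ((Measure.measurePreserving_neg (volume : Measure (V n))).prod
          (MeasurePreserving.id (volume : Measure ℝ)))).quasiMeasurePreserving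
  have h1 : ∀ᵐ p : X n, J n lam ξ p
      = eBar (eta lam p.2.2 * ⟪p.1, p.2.1⟫_ℝ) * conjL2 ξ (-p.1, -p.2.1, p.2.2) :=
    JUnitary_apply n lam (conjL2 ξ)
  filter_upwards [h1, hq.ae (Lp.coeFn_star ξ)] with p h1 h2
  rw [h1]
  congr 1

/-- Schwartz functions in `(x, y, r)` having compact support in the variable `r`. -/
def FunAlg (n : ℕ) : Set 𝓢(X n, ℂ) :=
  {f | ∃ K : Set ℝ, IsCompact K ∧ ∀ p : X n, p.2.2 ∉ K → f p = 0}

/-- The point transformation `(x, y, r) ↦ (e^{λs}x, e^{λs}y, r - s)`. -/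
def shift {n : ℕ} (lam : ℝ) (p : X n) (s : ℝ) : X n :=
  (Real.exp (lam * s) • p.1, Real.exp (lam * s) • p.2.1, p.2.2 - s)

/-- The integrand `(e^{λs})ⁿ f(x,y,s) ζ(e^{λs}x, e^{λs}y, r - s)`. -/
def rhoIntegrand {n : ℕ} (lam : ℝ) (f : X n → ℂ) (ζ : X n → ℂ) (p : X n) (s : ℝ) : ℂ :=
  (Real.exp (lam * s) : ℂ) ^ n * f (p.1, p.2.1, s) * ζ (shift lam p s)

theorem measurable_shift {n : ℕ} (lam : ℝ) :
    Measurable (fun q : X n × ℝ => shift lam q.1 q.2) := by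
  unfold shift; fun_prop

theorem measurable_rhoIntegrand {n : ℕ} (lam : ℝ) (f : 𝓢(X n, ℂ)) (ζ : X n → ℂ)
    (hζ : Measurable ζ) : Measurable (fun q : X n × ℝ => rhoIntegrand lam f ζ q.1 q.2) := by
  have h1 := measurable_shift (n := n) lam
  have h2 : Measurable f := f.continuous.measurable
  unfold rhoIntegrand
  fun_prop

theorem lintegral_shift {n : ℕ} (lam s : ℝ) (g : X n → ℝ≥0∞) (hg : Measurable g) :
    ∫⁻ p : X n, (ENNReal.ofReal (Real.exp (lam * s)) ^ n) ^ 2 * g (shift lam p s)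
      = ∫⁻ p, g p := by
  simpa [shift, sub_eq_add_neg] using lintegral_dilate n (Real.exp_pos (lam * s)) (-s) g hg

theorem ae_shift {n : ℕ} (lam : ℝ) {P : X n → Prop} (hP : MeasurableSet {p | P p})
    (h : ∀ᵐ p, P p) : ∀ᵐ p : X n, ∀ᵐ s : ℝ, P (shift lam p s) := by
  rw [Measure.ae_ae_comm (p := fun p s => P (shift lam p s)) ((measurable_shift lam) hP)]
  refine Filter.Eventually.of_forall fun s => ?_
  have h1 := lintegral_shift (n := n) lam s ({p | P p}ᶜ.indicator 1)
    (measurable_one.indicator hP.compl)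
  have hm : Measurable fun p : X n => shift lam p s := by unfold shift; fun_prop
  rw [lintegral_indicator_one hP.compl, (mem_ae_iff.1 h : volume {p | P p}ᶜ = 0),
    lintegral_eq_zero_iff (by
      exact measurable_const.mul ((measurable_one.indicator hP.compl).comp hm))] at h1
  filter_upwards [h1] with p hp
  by_contra hn
  have : (shift lam p s) ∈ {p | P p}ᶜ := hn
  simp [this] at hp
  exact absurd hp.1 (Real.exp_pos _).not_ge

theorem rho_bound {n : ℕ} (lam : ℝ) (f : 𝓢(X n, ℂ)) (hf : f ∈ FunAlg n) :
    ∃ C : ℝ≥0∞, C ≠ ∞ ∧ ∀ ζ : X n → ℂ, Measurable ζ →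
      ∫⁻ p, (∫⁻ s, ‖rhoIntegrand lam f ζ p s‖ₑ) ^ 2 ≤ C * ∫⁻ p, ‖ζ p‖ₑ ^ 2 := by
  obtain ⟨K, hK, hfK⟩ := hf
  obtain ⟨M, hM⟩ : ∃ M : ℝ≥0∞, M ≠ ∞ ∧ ∀ p, ‖f p‖ₑ ≤ M :=
    ⟨ENNReal.ofReal (SchwartzMap.seminorm ℝ 0 0 f), ENNReal.ofReal_ne_top, fun p => by
      rw [← ofReal_norm]; exact ENNReal.ofReal_le_ofReal (f.norm_le_seminorm ℝ p)⟩
  have hKm := hK.measurableSet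
  refine ⟨M ^ 2 * volume K * volume K, ENNReal.mul_ne_top (ENNReal.mul_ne_top
    (ENNReal.pow_ne_top hM.1) hK.measure_lt_top.ne) hK.measure_lt_top.ne, fun ζ hζ => ?_⟩
  set h : X n → ℝ → ℝ≥0∞ := fun p s =>
    ENNReal.ofReal (Real.exp (lam * s)) ^ n * ‖ζ (shift lam p s)‖ₑ with hh
  have hs := measurable_shift (n := n) lam
  have hhm : Measurable (fun q : X n × ℝ => h q.1 q.2) := by simp only [hh]; fun_prop
  have h1 : ∀ p, ∫⁻ s, ‖rhoIntegrand lam f ζ p s‖ₑ ≤ M * ∫⁻ s in K, h p s := by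
    intro p
    rw [← lintegral_const_mul M (by fun_prop), ← lintegral_indicator hKm]
    refine lintegral_mono fun s => ?_
    by_cases hsK : s ∈ K
    · rw [Set.indicator_of_mem hsK, rhoIntegrand, enorm_mul, enorm_mul, enorm_pow, hh,
        ← ofReal_norm (Real.exp (lam * s) : ℂ), Complex.norm_real,
        Real.norm_of_nonneg (Real.exp_pos _).le]
      calc _ = ‖f (p.1, p.2.1, s)‖ₑ * (ENNReal.ofReal (Real.exp (lam * s)) ^ n *
            ‖ζ (shift lam p s)‖ₑ) := by ring
        _ ≤ _ := by gcongr; exact hM.2 _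
    · rw [Set.indicator_of_notMem hsK, rhoIntegrand, hfK _ hsK]
      simp
  have h2 : ∀ p, (∫⁻ s in K, h p s) ^ 2 ≤ volume K * ∫⁻ s in K, h p s ^ 2 := by
    intro p
    have := ENNReal.lintegral_mul_le_Lp_mul_Lq (volume.restrict K) Real.HolderConjugate.two_two
      (f := 1) (g := h p) aemeasurable_one (by fun_prop)
    simp only [one_mul, Pi.one_apply, one_pow, lintegral_const, Measure.restrict_apply,
      MeasurableSet.univ, Set.univ_inter, ENNReal.rpow_two] at this
    calc _ ≤ (volume K ^ (1 / 2 : ℝ) * (∫⁻ s in K, h p s ^ 2) ^ (1 / 2 : ℝ)) ^ 2 := by gcongr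
      _ = _ := by
        rw [mul_pow, ← ENNReal.rpow_two, ← ENNReal.rpow_two, ← ENNReal.rpow_mul,
          ← ENNReal.rpow_mul]
        norm_num
  calc ∫⁻ p, (∫⁻ s, ‖rhoIntegrand lam f ζ p s‖ₑ) ^ 2
      ≤ ∫⁻ p, M ^ 2 * volume K * ∫⁻ s in K, h p s ^ 2 := by
        refine lintegral_mono fun p => ?_
        calc _ ≤ (M * ∫⁻ s in K, h p s) ^ 2 := by gcongr; exact h1 p
          _ = M ^ 2 * (∫⁻ s in K, h p s) ^ 2 := mul_pow _ _ _
          _ ≤ M ^ 2 * (volume K * ∫⁻ s in K, h p s ^ 2) := by gcongr; exact h2 p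
          _ = _ := by ring
    _ = M ^ 2 * volume K * ∫⁻ s in K, ∫⁻ p, h p s ^ 2 := by
        rw [lintegral_const_mul _ (by fun_prop), lintegral_lintegral_swap (by fun_prop)]
    _ = M ^ 2 * volume K * ∫⁻ s in K, ∫⁻ p, ‖ζ p‖ₑ ^ 2 := by
        congr 2 with s
        rw [← lintegral_shift lam s _ (hζ.enorm.pow_const 2)]
        simp only [hh, mul_pow]
    _ = _ := by
        rw [lintegral_const]
        simp
        ring

theorem rho_eLpNorm {n : ℕ} (lam : ℝ) (f : 𝓢(X n, ℂ)) (hf : f ∈ FunAlg n) :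
    ∃ C : ℝ≥0∞, C ≠ ∞ ∧ ∀ ζ : L2 (X n),
      eLpNorm (fun p => ∫ s, rhoIntegrand lam f ζ p s) 2 volume ≤ C * eLpNorm ζ 2 volume := by
  obtain ⟨C, hC, h⟩ := rho_bound lam f hf
  refine ⟨C ^ (1 / 2 : ℝ), ENNReal.rpow_ne_top_of_nonneg (by norm_num) hC, fun ζ => ?_⟩
  rw [eLpNorm_eq_lintegral_rpow_enorm_toReal (by simp) (by simp),
    eLpNorm_eq_lintegral_rpow_enorm_toReal (by simp) (by simp),
    ENNReal.toReal_ofNat, ← ENNReal.mul_rpow_of_nonneg _ _ (by norm_num)]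
  refine ENNReal.rpow_le_rpow ?_ (by norm_num)
  simp only [ENNReal.rpow_two]
  refine le_trans (lintegral_mono fun p => ?_) (h ζ (Lp.stronglyMeasurable ζ).measurable)
  gcongr
  exact enorm_integral_le_lintegral_enorm _

theorem rho_memLp {n : ℕ} (lam : ℝ) (f : 𝓢(X n, ℂ)) (hf : f ∈ FunAlg n) (ζ : L2 (X n)) :
    MemLp (fun p => ∫ s, rhoIntegrand lam f ζ p s) 2 volume := by
  obtain ⟨C, hC, h⟩ := rho_eLpNorm lam f hf
  refine ⟨?_, (h ζ).trans_lt (ENNReal.mul_lt_top hC.lt_top (Lp.eLpNorm_lt_top ζ))⟩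
  exact (StronglyMeasurable.integral_prod_right
    (f := fun p s => rhoIntegrand lam f ζ p s) (measurable_rhoIntegrand lam f ζ
      (Lp.stronglyMeasurable ζ).measurable).stronglyMeasurable).aestronglyMeasurable

theorem rho_integrable {n : ℕ} (lam : ℝ) (f : 𝓢(X n, ℂ)) (hf : f ∈ FunAlg n) (ζ : L2 (X n)) :
    ∀ᵐ p, Integrable (rhoIntegrand lam f ζ p) := by
  obtain ⟨C, hC, h⟩ := rho_bound lam f hf
  have hζ := (Lp.stronglyMeasurable ζ).measurable
  have hm := measurable_rhoIntegrand lam f ζ hζ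
  have h1 : ∫⁻ p, ‖ζ p‖ₑ ^ 2 < ∞ := by
    have := Lp.eLpNorm_lt_top ζ
    rw [eLpNorm_lt_top_iff_lintegral_rpow_enorm_lt_top (by simp) (by simp)] at this
    simpa using this
  have h2 := ae_lt_top (μ := (volume : Measure (X n))) (f := fun p =>
    (∫⁻ s, ‖rhoIntegrand lam f ζ p s‖ₑ) ^ 2)
    ((hm.enorm.lintegral_prod_right' (ν := (volume : Measure ℝ))).pow_const 2)
    ((h ζ hζ).trans_lt (ENNReal.mul_lt_top hC.lt_top h1)).ne
  filter_upwards [h2] with p hp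
  refine ⟨(hm.comp measurable_prodMk_left).aestronglyMeasurable, ?_⟩
  exact (ENNReal.pow_lt_top_iff.1 hp).resolve_right (by norm_num)

/-- The linear map underlying `ρ_f`. -/
def rhoLinear {n : ℕ} (lam : ℝ) (f : FunAlg n) : L2 (X n) →ₗ[ℂ] L2 (X n) where
  toFun := fun ζ => (rho_memLp lam f.1 f.2 ζ).toLp _
  map_add' := fun ζ η => by
    have hm : MeasurableSet {p : X n | (ζ + η : L2 (X n)) p = ζ p + η p} :=
      measurableSet_eq_fun (Lp.stronglyMeasurable _).measurable
        ((Lp.stronglyMeasurable _).measurable.add (Lp.stronglyMeasurable _).measurable)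
    ext1
    filter_upwards [(rho_memLp lam f.1 f.2 (ζ + η)).coeFn_toLp,
      (rho_memLp lam f.1 f.2 ζ).coeFn_toLp, (rho_memLp lam f.1 f.2 η).coeFn_toLp,
      Lp.coeFn_add ((rho_memLp lam f.1 f.2 ζ).toLp _) ((rho_memLp lam f.1 f.2 η).toLp _),
      rho_integrable lam f.1 f.2 ζ, rho_integrable lam f.1 f.2 η,
      ae_shift lam hm (Lp.coeFn_add ζ η)] with p h1 h2 h3 h4 h5 h6 h7
    rw [h1, h4, Pi.add_apply, h2, h3, ← integral_add h5 h6]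
    refine integral_congr_ae ?_
    filter_upwards [h7] with s hs
    simp only [rhoIntegrand, hs]
    ring
  map_smul' := fun c ζ => by
    have hm : MeasurableSet {p : X n | (c • ζ : L2 (X n)) p = c • ζ p} :=
      measurableSet_eq_fun (Lp.stronglyMeasurable _).measurable
        ((Lp.stronglyMeasurable _).measurable.const_smul c)
    ext1
    filter_upwards [(rho_memLp lam f.1 f.2 (c • ζ)).coeFn_toLp,
      (rho_memLp lam f.1 f.2 ζ).coeFn_toLp,
      Lp.coeFn_smul c ((rho_memLp lam f.1 f.2 ζ).toLp _),
      ae_shift lam hm (Lp.coeFn_smul c ζ)] with p h1 h2 h4 h7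
    rw [h1, RingHom.id_apply, h4, Pi.smul_apply, h2, ← integral_smul]
    refine integral_congr_ae ?_
    filter_upwards [h7] with s hs
    simp only [rhoIntegrand, hs, smul_eq_mul]
    ring

/-- The bounded operator `ρ_f` of `L²(X)`:
`(ρ_f ζ)(x,y,r) = ∫ (e^{λs})ⁿ f(x,y,s) ζ(e^{λs}x, e^{λs}y, r - s) ds`. -/
def rho {n : ℕ} (lam : ℝ) (f : FunAlg n) : L2 (X n) →L[ℂ] L2 (X n) :=
  (rhoLinear lam f).mkContinuousOfExistsBound (by
    obtain ⟨C, hC, h⟩ := rho_eLpNorm lam f.1 f.2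
    refine ⟨C.toReal, fun ζ => ?_⟩
    have h1 : ‖rhoLinear lam f ζ‖ = _ := Lp.norm_toLp _ (rho_memLp lam f.1 f.2 ζ)
    rw [h1, Lp.norm_def, ← ENNReal.toReal_mul]
    exact ENNReal.toReal_mono (ENNReal.mul_ne_top hC (Lp.eLpNorm_ne_top ζ)) (h ζ))

theorem rho_apply {n : ℕ} (lam : ℝ) (f : FunAlg n) (ζ : L2 (X n)) :
    ∀ᵐ p, rho lam f ζ p = ∫ s, rhoIntegrand lam f.1 ζ p s :=
  (rho_memLp lam f.1 f.2 ζ).coeFn_toLp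

/-- `U_A` as a bounded operator. -/
def UOp (n : ℕ) (lam : ℝ) : L2 (X n × X n) →L[ℂ] L2 (X n × X n) :=
  (UA n lam).toLinearIsometry.toContinuousLinearMap

/-- The `C*`-algebra `Â`, generated by the right slices `(id ⊗ ω)(U_A)`, where `ω` runs through the
predual of the bounded operators on `L²(X)`. -/
def AHat (n : ℕ) (lam : ℝ) : NonUnitalStarSubalgebra ℂ (L2 (X n) →L[ℂ] L2 (X n)) :=
  (NonUnitalStarAlgebra.adjoin ℂ
    {b | ∃ ω ∈ predual (X n), b = rightSlice ω (UOp n lam)}).topologicalClosure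

/-- The comultiplication `Δ̂ b = U_A* (1 ⊗ b) U_A`. -/
def comult (n : ℕ) (lam : ℝ) (b : L2 (X n) →L[ℂ] L2 (X n)) :
    L2 (X n × X n) →L[ℂ] L2 (X n × X n) :=
  star (UOp n lam) * tensorOp 1 b * UOp n lam

/-- The flip `χ(T) = Σ T Σ`. -/
def chi (n : ℕ) (T : L2 (X n × X n) →L[ℂ] L2 (X n × X n)) :
    L2 (X n × X n) →L[ℂ] L2 (X n × X n) :=
  (flipU (α := X n)).toLinearIsometry.toContinuousLinearMap * T *
    (flipU (α := X n)).toLinearIsometry.toContinuousLinearMap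

/-- The spatial tensor product `B ⊗ B`, the `C*`-algebra generated by the operators `b ⊗ c` with
`b` and `c` in `B`. -/
def spatialSquare {n : ℕ} (B : NonUnitalStarSubalgebra ℂ (L2 (X n) →L[ℂ] L2 (X n))) :
    NonUnitalStarSubalgebra ℂ (L2 (X n × X n) →L[ℂ] L2 (X n × X n)) :=
  (NonUnitalStarAlgebra.adjoin ℂ {T | ∃ b ∈ B, ∃ c ∈ B, T = tensorOp b c}).topologicalClosure

/-- The multiplier algebra of `D`, as the algebra of all `T` with `T D ⊆ D` and `D T ⊆ D`. For a
nondegenerate `C*`-algebra `D` of operators on a Hilbert space, this is the usual realization of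
`M(D)` by bounded operators. -/
def multiplierAlg {A : Type*} [Ring A] [StarRing A] [Algebra ℂ A] [StarModule ℂ A]
    (D : NonUnitalStarSubalgebra ℂ A) : StarSubalgebra ℂ A where
  carrier := {T | ∀ a ∈ D, T * a ∈ D ∧ a * T ∈ D}
  mul_mem' {S T} hS hT a ha :=
    ⟨by rw [mul_assoc]; exact (hS _ (hT a ha).1).1,
      by rw [← mul_assoc]; exact (hT _ (hS a ha).2).2⟩
  one_mem' a ha := ⟨by rwa [one_mul], by rwa [mul_one]⟩
  add_mem' {S T} hS hT a ha :=
    ⟨by rw [add_mul]; exact add_mem (hS a ha).1 (hT a ha).1,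
      by rw [mul_add]; exact add_mem (hS a ha).2 (hT a ha).2⟩
  zero_mem' a _ := ⟨by rw [zero_mul]; exact zero_mem D, by rw [mul_zero]; exact zero_mem D⟩
  algebraMap_mem' c a ha :=
    ⟨by rw [← Algebra.smul_def]; exact SMulMemClass.smul_mem c ha,
      by rw [← Algebra.commutes, ← Algebra.smul_def]; exact SMulMemClass.smul_mem c ha⟩
  star_mem' {T} hT a ha :=
    ⟨by simpa using star_mem (hT _ (star_mem ha)).2,
      by simpa using star_mem (hT _ (star_mem ha)).1⟩

/-- The multiplier algebra `M(Â ⊗ Â)`. -/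
abbrev MSquare (n : ℕ) (lam : ℝ) :
    StarSubalgebra ℂ (L2 (X n × X n) →L[ℂ] L2 (X n × X n)) :=
  multiplierAlg (spatialSquare (AHat n lam))

/-- The elementary tensor `b ⊗ c`, for `b` and `c` in `Â`, as an element of `M(Â ⊗ Â)`. -/
def elemTensor {n : ℕ} {lam : ℝ} (b c : AHat n lam) : MSquare n lam :=
  ⟨tensorOp b c, fun _ ha =>
    have h : tensorOp (b : L2 (X n) →L[ℂ] L2 (X n)) c ∈ spatialSquare (AHat n lam) :=
      NonUnitalStarSubalgebra.le_topologicalClosure _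
        (NonUnitalStarAlgebra.subset_adjoin ℂ _ ⟨b, b.2, c, c.2, rfl⟩)
    ⟨mul_mem h ha, mul_mem ha h⟩⟩

/-- The formula `ē[η_λ(r) β(x,y)] f(-e^{λr}x, -e^{λr}y, -r)`. -/
def antipodeFun {n : ℕ} (lam : ℝ) (f : X n → ℂ) (p : X n) : ℂ :=
  eBar (eta lam p.2.2 * ⟪p.1, p.2.1⟫_ℝ) *
    f (-(Real.exp (lam * p.2.2) • p.1), -(Real.exp (lam * p.2.2) • p.2.1), -p.2.2)

/-- The `*`-anti-automorphism `S` of `Â` extends `ρ_f ↦ ρ_g`, where `g` is given by the formula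
`antipodeFun`. -/
def ExtendsAntipode {n : ℕ} {lam : ℝ} (S : AHat n lam ≃⋆ₐ[ℂ] (AHat n lam)ᵐᵒᵖ) : Prop :=
  ∀ f g : FunAlg n, (∀ p, g.1 p = antipodeFun lam f.1 p) →
    ∀ b c : AHat n lam, (b : L2 (X n) →L[ℂ] L2 (X n)) = rho lam f →
      (c : L2 (X n) →L[ℂ] L2 (X n)) = rho lam g → S b = MulOpposite.op c

/-- The `*`-anti-automorphism `SS` of `M(Â ⊗ Â)` is `S ⊗ S`: it sends `b ⊗ c` to `S(b) ⊗ S(c)`. -/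
def IsTensorSquare {n : ℕ} {lam : ℝ} (S : AHat n lam ≃⋆ₐ[ℂ] (AHat n lam)ᵐᵒᵖ)
    (SS : MSquare n lam ≃⋆ₐ[ℂ] (MSquare n lam)ᵐᵒᵖ) : Prop :=
  ∀ b c : AHat n lam, SS (elemTensor b c) = MulOpposite.op (elemTensor (S b).unop (S c).unop)

end

end QHeis

namespace QHeis

open MeasureTheory
open scoped ENNReal InnerProductSpace ComplexConjugate TensorProduct SchwartzMap

noncomputable section

open Filter Topology

/-! ### Weighted composition operators. -/

section IsWC

variable {α : Type*} [MeasureSpace α]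

/-! Everything is expressed through the unitary group `λ_t ζ(x,y,r) = (e^{λt})ⁿ ζ(e^{λt}x, e^{λt}y,
r - t)` (`lamOp`) and multiplication operators `M_φ`. The operator `ρ_f` is the weak integral of
`M_{f(·,·,t)} λ_t` over `t`, so the algebra looks like a crossed product of functions of `(x,y)` by
dilations. Operators are compared through their kernels: if two kernels vanish for `|t| > R`, the
operators differ in norm by at most `2R` times the sup norm of the difference of the kernels
(`IsRho.norm_sub_le`).

The algebra `Â` is the norm closure of the operators with continuous compactly supported kernels
(`AHat_eq_rhoAlg`). Slices of `U_A` by continuous compactly supported vectors have such kernels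
(`isRho_slice`); conversely an approximate identity in `(x,y)` produces slices converging to any
such operator (`IsRho.mem_AHat`). Cutting off and smoothing kernels shows that the `ρ_f` lie in `Â`
and are dense there.

The antipode and the comultiplication both rest on the cocycle identity `η(r) - e^{2λt} η(r-t) =
η(t)` (`eta_sub`). It makes the phases depending on `r` cancel, so that `J M_φ λ_t J` is again of
the form `M_ψ λ_t`, and `U_A* (1 ⊗ M_{F(·,·,t)} λ_t) U_A` is `M_G (λ_t ⊗ λ_t)` with `G = F(x+x',
y+y', t) e(η(t) β(x,y'))`. The first fact gives `J ρ_f* J = ρ_{Ŝ(f)}` and the invariance of `Â`. The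
second writes `Δ̂(A)(b ⊗ c)` as a norm continuous integral with values in `Â ⊗ Â`, hence `Δ̂(A)` is
a multiplier. Expanding `β(x+x', y+y')` compares the two and gives `(J ⊗ J) Δ̂(A) (J ⊗ J) = χ(Δ̂(J A
J))`.

Uniqueness: two anti-automorphisms differ by a `*`-automorphism, which is isometric. On `Â` density
of the `ρ_f` suffices; on `M(Â ⊗ Â)` one uses in addition that a multiplier is determined by its
products with elementary tensors, by nondegeneracy of `Â`. The involutive properties are then
immediate from `J² = 1`. -/

/-- The bounded operator `A` is the weighted composition operator `ξ ↦ w · (ξ ∘ Φ)`. -/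
def IsWC (A : L2 α →L[ℂ] L2 α) (Φ : α → α) (w : α → ℂ) : Prop :=
  Measure.QuasiMeasurePreserving Φ (volume : Measure α) volume ∧
    ∀ ξ : L2 α, ∀ᵐ p, A ξ p = w p * ξ (Φ p)

theorem IsWC.mul {A B : L2 α →L[ℂ] L2 α} {Φ Ψ : α → α} {w v : α → ℂ} (hA : IsWC A Φ w)
    (hB : IsWC B Ψ v) : IsWC (A * B) (fun p => Ψ (Φ p)) (fun p => w p * v (Φ p)) := by
  refine ⟨hB.1.comp hA.1, fun ξ => ?_⟩
  filter_upwards [hA.2 (B ξ), hA.1.ae (hB.2 ξ)] with p h1 h2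
  rw [mul_apply_eq_comp, h1, h2, mul_assoc]

/-- With `IsWC.mul` this reduces operator identities, such as the formulas for `J A J` and `Δ̂`, to
pointwise identities between point maps and weights. -/
theorem IsWC.eq {A B : L2 α →L[ℂ] L2 α} {Φ Ψ : α → α} {w v : α → ℂ} (hA : IsWC A Φ w)
    (hB : IsWC B Ψ v) (hΦ : ∀ p, Φ p = Ψ p) (hw : ∀ p, w p = v p) : A = B := by
  ext1 ξ
  ext1
  filter_upwards [hA.2 ξ, hB.2 ξ] with p h1 h2
  rw [h1, h2, hΦ, hw]

theorem isWC_one : IsWC (1 : L2 α →L[ℂ] L2 α) id 1 :=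
  ⟨Measure.QuasiMeasurePreserving.id _, fun ξ => by simp⟩

theorem quasiMeasurePreserving_of_weight {Φ : α → α} {w : α → ℂ} (hΦ : Measurable Φ)
    (hw0 : ∀ p, w p ≠ 0) (hw : Measurable w)
    (h : ∀ g : α → ℝ≥0∞, Measurable g → ∫⁻ p, ‖w p‖ₑ ^ 2 * g (Φ p) = ∫⁻ p, g p) :
    Measure.QuasiMeasurePreserving Φ (volume : Measure α) volume := by
  refine ⟨hΦ, Measure.AbsolutelyContinuous.mk fun s hs h0 => ?_⟩
  rw [Measure.map_apply hΦ hs]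
  have := wcomp_ae Φ w hΦ hw0 hw h (P := fun p => p ∉ s) (measure_eq_zero_iff_ae_notMem.1 h0)
  exact measure_eq_zero_iff_ae_notMem.2 this

theorem isWC_wcompEquiv (Φ Ψ : α → α) (w v : α → ℂ) (hΦ : Measurable Φ) (hw : Measurable w)
    (hΨ : Measurable Ψ) (hv : Measurable v)
    (h : ∀ g : α → ℝ≥0∞, Measurable g → ∫⁻ p, ‖w p‖ₑ ^ 2 * g (Φ p) = ∫⁻ p, g p)
    (hi : ∀ p, Ψ (Φ p) = p) (hi' : ∀ p, Φ (Ψ p) = p) (hwv : ∀ p, w p * v (Φ p) = 1) :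
    IsWC (wcompEquiv Φ Ψ w v hΦ hw hΨ hv h hi hi' hwv).toLinearIsometry.toContinuousLinearMap
      Φ w :=
  ⟨quasiMeasurePreserving_of_weight hΦ (fun p => left_ne_zero_of_mul_eq_one (hwv p)) hw h,
    wcompEquiv_apply Φ Ψ w v hΦ hw hΨ hv h hi hi' hwv⟩

theorem isWC_wcompEquiv_symm (Φ Ψ : α → α) (w v : α → ℂ) (hΦ : Measurable Φ) (hw : Measurable w)
    (hΨ : Measurable Ψ) (hv : Measurable v)
    (h : ∀ g : α → ℝ≥0∞, Measurable g → ∫⁻ p, ‖w p‖ₑ ^ 2 * g (Φ p) = ∫⁻ p, g p)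
    (hi : ∀ p, Ψ (Φ p) = p) (hi' : ∀ p, Φ (Ψ p) = p) (hwv : ∀ p, w p * v (Φ p) = 1) :
    IsWC (wcompEquiv Φ Ψ w v hΦ hw hΨ hv h hi hi' hwv).symm.toLinearIsometry.toContinuousLinearMap
      Ψ v := by
  have hvw : ∀ p, v p * w (Ψ p) = 1 := fun p => by have := hwv (Ψ p); rwa [hi', mul_comm] at this
  have hv0 : ∀ p, v p ≠ 0 := fun p => left_ne_zero_of_mul_eq_one (hvw p)
  have h' := wcomp_inv_meas hw h hΨ hv hi hwv
  exact ⟨quasiMeasurePreserving_of_weight hΨ hv0 hv h', wcomp_apply Ψ v hΨ hv0 hv h'⟩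

/-- For a bounded operator, being a weighted composition operator is a closed condition. -/
theorem isClosed_wc (A : L2 α →L[ℂ] L2 α) {Φ : α → α} (w : α → ℂ)
    (hΦ : Measure.QuasiMeasurePreserving Φ (volume : Measure α) volume) :
    IsClosed {ξ : L2 α | ∀ᵐ p, A ξ p = w p * ξ (Φ p)} := by
  refine isClosed_of_closure_subset fun ξ hξ => ?_
  obtain ⟨u, hu, hlim⟩ := mem_closure_iff_seq_limit.1 hξ
  -- Convergence in `L²` yields almost everywhere convergence only along a subsequence; a second
  -- extraction handles the images under `A`.
  have h1 := (tendstoInMeasure_of_tendsto_Lp hlim).exists_seq_tendsto_ae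
  obtain ⟨ns, hns, h1⟩ := h1
  have h2 := (tendstoInMeasure_of_tendsto_Lp (((A.continuous.tendsto ξ).comp hlim).comp
    hns.tendsto_atTop)).exists_seq_tendsto_ae
  obtain ⟨ms, hms, h2⟩ := h2
  have h3 : ∀ᵐ p, ∀ i, A (u i) p = w p * u i (Φ p) := ae_all_iff.2 hu
  filter_upwards [h2, hΦ.ae h1, h3] with p h2 h1 h3
  refine tendsto_nhds_unique h2 ?_
  have h4 : Tendsto (fun i => w p * u (ns (ms i)) (Φ p)) atTop (𝓝 (w p * ξ (Φ p))) :=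
    (h1.comp hms.tendsto_atTop).const_mul _
  refine h4.congr fun i => ?_
  simp only [Function.comp_apply, h3]

end IsWC

/-! ### Operators on `L²(α × α)` determined by elementary tensors. -/

section TensorWC

variable {α : Type*} [MeasureSpace α] [SigmaFinite (volume : Measure α)]

/-- A closed subspace containing all elementary tensors is everything. -/
theorem tmul_induction {P : L2 (α × α) → Prop} (h0 : P 0) (ht : ∀ ξ η, P (tmul ξ η))
    (ha : ∀ F G, P F → P G → P (F + G)) (hc : IsClosed {F | P F}) (F : L2 (α × α)) : P F := by
  refine tensorEmb_denseRange.induction_on (p := P) F hc fun x => ?_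
  induction x using TensorProduct.induction_on with
  | zero => simpa using h0
  | tmul ξ η => rw [tensorEmb_tmul]; exact ht ξ η
  | add x y hx hy => rw [map_add]; exact ha _ _ hx hy

theorem ext_tmul {E : Type*} [NormedAddCommGroup E] [NormedSpace ℂ E]
    {σ : ℂ →+* ℂ} {A B : L2 (α × α) →SL[σ] E} (h : ∀ ξ η, A (tmul ξ η) = B (tmul ξ η)) :
    A = B := by
  ext1 F
  refine tmul_induction (P := fun F => A F = B F) (by simp) h
    (fun F G hF hG => by simp only [map_add, hF, hG]) (isClosed_eq A.continuous B.continuous) F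

theorem tensorOp_mul (a b c d : L2 α →L[ℂ] L2 α) :
    tensorOp a b * tensorOp c d = tensorOp (a * c) (b * d) :=
  ext_tmul fun ξ η => by simp [tensorOp_tmul]

theorem inner_ext_tmul {F G : L2 (α × α)} (h : ∀ ξ η, ⟪tmul ξ η, F⟫_ℂ = ⟪tmul ξ η, G⟫_ℂ) :
    F = G := by
  refine ext_inner_left ℂ fun v => ?_
  refine tmul_induction (P := fun v => ⟪v, F⟫_ℂ = ⟪v, G⟫_ℂ) (by simp) h
    (fun F G hF hG => by simp only [inner_add_left, hF, hG])
    (isClosed_eq (by fun_prop) (by fun_prop)) v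

theorem star_tensorOp (a b : L2 α →L[ℂ] L2 α) :
    star (tensorOp a b) = tensorOp (star a) (star b) :=
  ext_tmul fun ξ η => inner_ext_tmul fun ξ' η' => by
    rw [ContinuousLinearMap.star_eq_adjoint, ContinuousLinearMap.adjoint_inner_right,
      tensorOp_tmul, tensorOp_tmul, inner_tmul_tmul, inner_tmul_tmul,
      ContinuousLinearMap.star_eq_adjoint, ContinuousLinearMap.star_eq_adjoint,
      ContinuousLinearMap.adjoint_inner_right, ContinuousLinearMap.adjoint_inner_right]

theorem norm_tensorOp_le (a b : L2 α →L[ℂ] L2 α) : ‖tensorOp a b‖ ≤ ‖a‖ * ‖b‖ := by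
  have h := ContinuousLinearMap.opNorm_extend_le
    ((tensorEmb (α := α)).toContinuousLinearMap ∘L TensorProduct.mapL a b)
    (e := (tensorEmb (α := α)).toContinuousLinearMap) (N := 1) tensorEmb_denseRange
    (fun x => by simp)
  refine h.trans ?_
  rw [NNReal.coe_one, one_mul]
  refine ContinuousLinearMap.opNorm_le_bound _ (by positivity) fun x => ?_
  have : ‖((tensorEmb (α := α)).toContinuousLinearMap ∘L TensorProduct.mapL a b) x‖
      = ‖TensorProduct.mapL a b x‖ := (tensorEmb (α := α)).norm_map _
  rw [this]
  exact (ContinuousLinearMap.le_opNorm _ _).trans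
    (mul_le_mul_of_nonneg_right (TensorProduct.norm_mapL_le a b) (norm_nonneg _))

/-- `b ⊗ c` as a bounded bilinear function of `b` and `c`. -/
def tensorOpL : (L2 α →L[ℂ] L2 α) →L[ℂ] (L2 α →L[ℂ] L2 α) →L[ℂ]
    (L2 (α × α) →L[ℂ] L2 (α × α)) :=
  LinearMap.mkContinuous₂ (LinearMap.mk₂ ℂ tensorOp
    (fun a a' b => ext_tmul fun ξ η => by simp [tensorOp_tmul])
    (fun c a b => ext_tmul fun ξ η => by simp [tensorOp_tmul])
    (fun a b b' => ext_tmul fun ξ η => by simp [tensorOp_tmul])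
    (fun c a b => ext_tmul fun ξ η => by simp [tensorOp_tmul])) 1
    (fun a b => by simpa using norm_tensorOp_le a b)

theorem tensorOpL_apply (a b : L2 α →L[ℂ] L2 α) : tensorOpL a b = tensorOp a b := rfl

/-- The operator is only defined by extension from elementary tensors. There the formula is clear,
and the set of vectors satisfying it is closed under sums and limits. -/
theorem IsWC.tensor {A B : L2 α →L[ℂ] L2 α} {Φ Ψ : α → α} {w v : α → ℂ} (hA : IsWC A Φ w)
    (hB : IsWC B Ψ v) :
    IsWC (tensorOp A B) (fun p => (Φ p.1, Ψ p.2)) (fun p => w p.1 * v p.2) := by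
  have hq : Measure.QuasiMeasurePreserving (fun p : α × α => (Φ p.1, Ψ p.2)) volume volume :=
    MeasureTheory.QuasiMeasurePreserving.prodMap hA.1 hB.1
  refine ⟨hq, fun F => ?_⟩
  refine tmul_induction (P := fun F => ∀ᵐ p, tensorOp A B F p = w p.1 * v p.2 * F (Φ p.1, Ψ p.2))
    ?_ (fun ξ η => ?_) (fun F G hF hG => ?_) (isClosed_wc (tensorOp A B) _ hq) F
  · rw [map_zero]
    filter_upwards [hq.ae (Lp.coeFn_zero ℂ 2 (volume : Measure (α × α))),
      Lp.coeFn_zero ℂ 2 (volume : Measure (α × α))] with p h1 h2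
    rw [h1, h2]
    simp
  · filter_upwards [tmul_apply (A ξ) (B η), hq.ae (tmul_apply ξ η), ae_fst (hA.2 ξ),
      ae_snd (hB.2 η)] with p h1 h2 h3 h4
    rw [tensorOp_tmul, h1, h2, h3, h4]
    ring
  · rw [map_add]
    filter_upwards [hF, hG, Lp.coeFn_add (tensorOp A B F) (tensorOp A B G),
      hq.ae (Lp.coeFn_add F G)] with p h1 h2 h3 h4
    rw [h3, h4, Pi.add_apply, Pi.add_apply, h1, h2]
    ring

end TensorWC

/-! ### Bounded multiplication operators. -/

section MulOp

variable {α : Type*} [MeasureSpace α]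

theorem mulOp_eLpNorm_le {φ : α → ℂ} {C : ℝ} (hC : ∀ p, ‖φ p‖ ≤ C) (ξ : L2 α) :
    eLpNorm (fun p => φ p * ξ p) 2 volume ≤ ENNReal.ofReal C * eLpNorm ξ 2 volume := by
  refine eLpNorm_le_mul_eLpNorm_of_ae_le_mul (ae_of_all _ fun p => ?_) 2
  rw [norm_mul]
  exact mul_le_mul_of_nonneg_right (hC p) (norm_nonneg _)

/-- Bounded measurable functions. -/
def BM {β : Type*} [MeasurableSpace β] (F : β → ℂ) : Prop :=
  Measurable F ∧ ∃ C : ℝ, ∀ p, ‖F p‖ ≤ C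

theorem BM.comp {β γ : Type*} [MeasurableSpace β] [MeasurableSpace γ] {F : β → ℂ} (h : BM F)
    {π : γ → β} (hπ : Measurable π) : BM fun p => F (π p) :=
  ⟨h.1.comp hπ, h.2.imp fun _ hC _ => hC _⟩

theorem BM.conj {β : Type*} [MeasurableSpace β] {F : β → ℂ} (h : BM F) :
    BM fun p => conj (F p) :=
  ⟨Complex.continuous_conj.measurable.comp h.1, h.2.imp fun _ hC p => by simpa using hC p⟩

theorem BM.add {β : Type*} [MeasurableSpace β] {F G : β → ℂ} (h : BM F) (h' : BM G) :
    BM fun p => F p + G p := by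
  obtain ⟨hF, C, hC⟩ := h
  obtain ⟨hG, D, hD⟩ := h'
  exact ⟨hF.add hG, C + D, fun p => (norm_add_le _ _).trans (add_le_add (hC p) (hD p))⟩

theorem BM.sub {β : Type*} [MeasurableSpace β] {F G : β → ℂ} (h : BM F) (h' : BM G) :
    BM fun p => F p - G p := by
  obtain ⟨hF, C, hC⟩ := h
  obtain ⟨hG, D, hD⟩ := h'
  exact ⟨hF.sub hG, C + D, fun p => (norm_sub_le _ _).trans (add_le_add (hC p) (hD p))⟩

theorem BM.mul {β : Type*} [MeasurableSpace β] {F G : β → ℂ} (h : BM F) (h' : BM G) :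
    BM fun p => F p * G p := by
  obtain ⟨hF, C, hC⟩ := h
  obtain ⟨hG, D, hD⟩ := h'
  refine ⟨hF.mul hG, C * D, fun p => ?_⟩
  rw [norm_mul]
  exact mul_le_mul (hC p) (hD p) (norm_nonneg _) ((norm_nonneg _).trans (hC p))

theorem bm_const {β : Type*} [MeasurableSpace β] (c : ℂ) : BM fun _ : β => c :=
  ⟨measurable_const, ‖c‖, fun _ => le_rfl⟩

theorem mulOp_memLp {φ : α → ℂ} (h : BM φ) (ξ : L2 α) :
    MemLp (fun p => φ p * ξ p) 2 volume := by
  obtain ⟨hm, C, hC⟩ := h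
  exact ⟨(hm.mul (Lp.stronglyMeasurable ξ).measurable).aestronglyMeasurable,
    (mulOp_eLpNorm_le hC ξ).trans_lt
      (ENNReal.mul_lt_top ENNReal.ofReal_lt_top (Lp.eLpNorm_lt_top ξ))⟩

open Classical in
/-- The operator of multiplication by a bounded measurable function `φ` (zero for any other
function `φ`). -/
def mulOp (φ : α → ℂ) : L2 α →L[ℂ] L2 α :=
  if h : BM φ then
    LinearMap.mkContinuousOfExistsBound
      { toFun := fun ξ => (mulOp_memLp h ξ).toLp _
        map_add' := fun ξ η => by
          ext1
          filter_upwards [(mulOp_memLp h (ξ + η)).coeFn_toLp, (mulOp_memLp h ξ).coeFn_toLp,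
            (mulOp_memLp h η).coeFn_toLp, Lp.coeFn_add ξ η, Lp.coeFn_add
              ((mulOp_memLp h ξ).toLp _) ((mulOp_memLp h η).toLp _)] with p h1 h2 h3 h4 h5
          rw [h1, h5, Pi.add_apply, h2, h3, h4, Pi.add_apply, mul_add]
        map_smul' := fun c ξ => by
          ext1
          filter_upwards [(mulOp_memLp h (c • ξ)).coeFn_toLp, (mulOp_memLp h ξ).coeFn_toLp,
            Lp.coeFn_smul c ξ, Lp.coeFn_smul c ((mulOp_memLp h ξ).toLp _)] with p h1 h2 h3 h4
          rw [h1, RingHom.id_apply, h4, Pi.smul_apply, h2, h3, Pi.smul_apply, smul_eq_mul,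
            smul_eq_mul]
          ring }
      (by
        obtain ⟨hm, C, hC⟩ := id h
        refine ⟨(ENNReal.ofReal C).toReal, fun ξ => ?_⟩
        simp only [LinearMap.coe_mk, AddHom.coe_mk]
        rw [Lp.norm_toLp, Lp.norm_def, ← ENNReal.toReal_mul]
        exact ENNReal.toReal_mono (ENNReal.mul_ne_top ENNReal.ofReal_ne_top
          (Lp.eLpNorm_ne_top ξ)) (mulOp_eLpNorm_le hC ξ))
  else 0

theorem mulOp_apply {φ : α → ℂ} (h : BM φ) (ξ : L2 α) :
    ∀ᵐ p, mulOp φ ξ p = φ p * ξ p := by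
  rw [mulOp, dif_pos h]
  exact (mulOp_memLp h ξ).coeFn_toLp

theorem isWC_mulOp {φ : α → ℂ} (h : BM φ) : IsWC (mulOp φ) id φ :=
  ⟨Measure.QuasiMeasurePreserving.id _, mulOp_apply h⟩

theorem norm_mulOp_le {φ : α → ℂ} {C : ℝ} (hC : ∀ p, ‖φ p‖ ≤ C) (h0 : 0 ≤ C) :
    ‖mulOp φ‖ ≤ C := by
  by_cases h : BM φ
  · refine ContinuousLinearMap.opNorm_le_bound _ h0 fun ξ => ?_
    have h1 : eLpNorm (mulOp φ ξ) 2 volume ≤ ENNReal.ofReal C * eLpNorm ξ 2 volume :=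
      (eLpNorm_congr_ae (mulOp_apply h ξ)).trans_le (mulOp_eLpNorm_le hC ξ)
    have h2 := ENNReal.toReal_mono (ENNReal.mul_ne_top ENNReal.ofReal_ne_top
      (Lp.eLpNorm_ne_top ξ)) h1
    rwa [ENNReal.toReal_mul, ENNReal.toReal_ofReal h0, ← Lp.norm_def, ← Lp.norm_def] at h2
  · rw [mulOp, dif_neg h, norm_zero]
    exact h0

theorem mulOp_zero : mulOp (fun _ : α => (0 : ℂ)) = 0 :=
  norm_eq_zero.1 (le_antisymm (norm_mulOp_le (by simp) le_rfl) (norm_nonneg _))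

theorem mulOp_sub {φ ψ : α → ℂ} (hφ : BM φ) (hψ : BM ψ) :
    mulOp φ - mulOp ψ = mulOp (fun p => φ p - ψ p) := by
  ext1 ξ
  ext1
  filter_upwards [mulOp_apply hφ ξ, mulOp_apply hψ ξ, mulOp_apply (hφ.sub hψ) ξ,
    Lp.coeFn_sub (mulOp φ ξ) (mulOp ψ ξ)] with p h1 h2 h3 h4
  rw [sub_apply, h4, Pi.sub_apply, h1, h2, h3, sub_mul]

theorem mulOp_add {φ ψ : α → ℂ} (hφ : BM φ) (hψ : BM ψ) :
    mulOp φ + mulOp ψ = mulOp (fun p => φ p + ψ p) := by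
  have h := mulOp_sub (hφ.add hψ) hψ
  simp only [add_sub_cancel_right] at h
  rw [← h, sub_add_cancel]

theorem mulOp_mul {φ ψ : α → ℂ} (hφ : BM φ) (hψ : BM ψ) :
    mulOp φ * mulOp ψ = mulOp (fun p => φ p * ψ p) :=
  ((isWC_mulOp hφ).mul (isWC_mulOp hψ)).eq (isWC_mulOp (hφ.mul hψ)) (fun _ => rfl) (fun _ => rfl)

theorem star_mulOp {φ : α → ℂ} (hφ : BM φ) : star (mulOp φ) = mulOp (fun p => conj (φ p)) := by
  ext1 ξ
  refine ext_inner_left ℂ fun η => ?_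
  rw [ContinuousLinearMap.star_eq_adjoint, ContinuousLinearMap.adjoint_inner_right,
    L2.inner_def, L2.inner_def]
  refine integral_congr_ae ?_
  filter_upwards [mulOp_apply hφ η, mulOp_apply hφ.conj ξ] with p h1 h2
  rw [h1, h2]
  simp only [RCLike.inner_apply, map_mul]
  ring

end MulOp

/-! ### Conjugation by an antiunitary involution. -/

section ConjBy

variable {H : Type*} [NormedAddCommGroup H] [InnerProductSpace ℂ H]

/-- Polarization: the four norms are preserved by `K`, and `K (i z) = -i K z` permutes them as
exchanging the two arguments does. -/
theorem inner_map_antiunitary (K : H ≃ₗᵢ⋆[ℂ] H) (x y : H) : ⟪K x, K y⟫_ℂ = ⟪y, x⟫_ℂ := by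
  rw [inner_eq_sum_norm_sq_div_four (K x) (K y), inner_eq_sum_norm_sq_div_four y x]
  have h1 : ‖K x + K y‖ = ‖y + x‖ := by rw [← map_add, K.norm_map, add_comm]
  have h2 : ‖K x - K y‖ = ‖y - x‖ := by rw [← map_sub, K.norm_map, norm_sub_rev]
  have h3 : ‖K x - (RCLike.I : ℂ) • K y‖ = ‖y - (RCLike.I : ℂ) • x‖ := by
    have : K x - (RCLike.I : ℂ) • K y = K ((RCLike.I : ℂ) • (y - (RCLike.I : ℂ) • x)) := by
      simp [smul_smul, sub_eq_add_neg, add_comm, map_smulₛₗ]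
    rw [this, K.norm_map, norm_smul]
    simp
  have h4 : ‖K x + (RCLike.I : ℂ) • K y‖ = ‖y + (RCLike.I : ℂ) • x‖ := by
    have : K x + (RCLike.I : ℂ) • K y = K (-((RCLike.I : ℂ) • (y + (RCLike.I : ℂ) • x))) := by
      simp [smul_add, smul_smul, map_smulₛₗ]
    rw [this, K.norm_map, norm_neg, norm_smul]
    simp
  rw [h1, h2, h3, h4]

/-- The bounded operator `K b K`, for an antiunitary operator `K`. -/
def conjBy (K : H ≃ₗᵢ⋆[ℂ] H) (b : H →L[ℂ] H) : H →L[ℂ] H :=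
  (K.toContinuousLinearEquiv : H →SL[starRingEnd ℂ] H).comp
    (b.comp (K.toContinuousLinearEquiv : H →SL[starRingEnd ℂ] H))

variable (K : H ≃ₗᵢ⋆[ℂ] H)

@[simp]
theorem conjBy_apply (b : H →L[ℂ] H) (ξ : H) : conjBy K b ξ = K (b (K ξ)) := rfl

theorem conjBy_add (b c : H →L[ℂ] H) : conjBy K (b + c) = conjBy K b + conjBy K c := by
  ext1 ξ; simp

theorem conjBy_smul (z : ℂ) (b : H →L[ℂ] H) : conjBy K (z • b) = conj z • conjBy K b := by
  ext1 ξ; simp [map_smulₛₗ]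

theorem conjBy_sub (b c : H →L[ℂ] H) : conjBy K (b - c) = conjBy K b - conjBy K c := by
  ext1 ξ; simp

theorem norm_conjBy_le (b : H →L[ℂ] H) : ‖conjBy K b‖ ≤ ‖b‖ := by
  refine ContinuousLinearMap.opNorm_le_bound _ (norm_nonneg _) fun ξ => ?_
  rw [conjBy_apply, K.norm_map]
  exact (b.le_opNorm _).trans_eq (by rw [K.norm_map])

theorem continuous_conjBy : Continuous (conjBy K) := by
  refine (LipschitzWith.of_dist_le_mul (K := 1) fun b c => ?_).continuous
  rw [dist_eq_norm, dist_eq_norm, ← conjBy_sub, NNReal.coe_one, one_mul]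
  exact norm_conjBy_le K _

variable {K}

theorem conjBy_mul (hK : ∀ ξ, K (K ξ) = ξ) (b c : H →L[ℂ] H) : conjBy K (b * c) = conjBy K b *
    conjBy K c := by
  ext1 ξ; simp [hK]

theorem conjBy_conjBy (hK : ∀ ξ, K (K ξ) = ξ) (b : H →L[ℂ] H) : conjBy K (conjBy K b) = b := by
  ext1 ξ; simp [hK]

theorem star_conjBy [CompleteSpace H] (hK : ∀ ξ, K (K ξ) = ξ) (b : H →L[ℂ] H) :
    star (conjBy K b) = conjBy K (star b) := by
  ext1 ζ
  refine ext_inner_left ℂ fun θ => ?_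
  rw [ContinuousLinearMap.star_eq_adjoint, ContinuousLinearMap.adjoint_inner_right, conjBy_apply,
    conjBy_apply, ContinuousLinearMap.star_eq_adjoint]
  nth_rw 1 [← hK ζ]
  nth_rw 2 [← hK θ]
  rw [inner_map_antiunitary, inner_map_antiunitary, ContinuousLinearMap.adjoint_inner_left]

end ConjBy

/-! ### Weak integrals of operator valued functions. -/

section WInt

variable {H : Type*} [NormedAddCommGroup H] [InnerProductSpace ℂ H]

/-- The function `t ↦ ⟨W_t ζ, θ⟩` is integrable, with integral `⟨A ζ, θ⟩`. -/
def WIntAt (W : ℝ → H →L[ℂ] H) (A : H →L[ℂ] H) (θ ζ : H) : Prop :=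
  Integrable (fun t => ⟪θ, W t ζ⟫_ℂ) ∧ ⟪θ, A ζ⟫_ℂ = ∫ t, ⟪θ, W t ζ⟫_ℂ

/-- The operator `A` is the weak integral of the operator valued function `W`. -/
def WInt (W : ℝ → H →L[ℂ] H) (A : H →L[ℂ] H) : Prop := ∀ θ ζ, WIntAt W A θ ζ

theorem WInt.congr {W V : ℝ → H →L[ℂ] H} {A : H →L[ℂ] H} (h : WInt W A) (e : ∀ t, W t = V t) :
    WInt V A := by
  rwa [show V = W from (funext e).symm]

theorem WInt.unique {W : ℝ → H →L[ℂ] H} {A B : H →L[ℂ] H} (hA : WInt W A) (hB : WInt W B) :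
    A = B := by
  ext1 ζ
  exact ext_inner_left ℂ fun θ => by rw [(hA θ ζ).2, (hB θ ζ).2]

theorem WInt.add {W V : ℝ → H →L[ℂ] H} {A B : H →L[ℂ] H} (hA : WInt W A) (hB : WInt V B) :
    WInt (fun t => W t + V t) (A + B) := fun θ ζ => by
  have h1 := hA θ ζ
  have h2 := hB θ ζ
  constructor
  · simp only [add_apply, inner_add_right]
    exact h1.1.add h2.1
  · simp only [add_apply, inner_add_right]
    rw [h1.2, h2.2, integral_add h1.1 h2.1]

theorem WInt.sub {W V : ℝ → H →L[ℂ] H} {A B : H →L[ℂ] H} (hA : WInt W A) (hB : WInt V B) :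
    WInt (fun t => W t - V t) (A - B) := fun θ ζ => by
  have h1 := hA θ ζ
  have h2 := hB θ ζ
  constructor
  · simp only [sub_apply, inner_sub_right]
    exact h1.1.sub h2.1
  · simp only [sub_apply, inner_sub_right]
    rw [h1.2, h2.2, integral_sub h1.1 h2.1]

theorem WInt.mul_right {W : ℝ → H →L[ℂ] H} {A : H →L[ℂ] H} (hA : WInt W A) (C : H →L[ℂ] H) :
    WInt (fun t => W t * C) (A * C) := fun θ ζ => hA θ (C ζ)

theorem WInt.comp_neg {W : ℝ → H →L[ℂ] H} {A : H →L[ℂ] H} (hA : WInt W A) :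
    WInt (fun t => W (-t)) A := fun θ ζ =>
  ⟨(hA θ ζ).1.comp_neg, by
    rw [(hA θ ζ).2, integral_neg_eq_self (fun t => ⟪θ, W t ζ⟫_ℂ)]⟩

theorem WInt.comp_sub_right {W : ℝ → H →L[ℂ] H} {A : H →L[ℂ] H} (hA : WInt W A) (s : ℝ) :
    WInt (fun t => W (t - s)) A := fun θ ζ =>
  ⟨(hA θ ζ).1.comp_sub_right s, by
    rw [(hA θ ζ).2, integral_sub_right_eq_self (fun t => ⟪θ, W t ζ⟫_ℂ)]⟩

theorem WIntAt.add_right {W : ℝ → H →L[ℂ] H} {A : H →L[ℂ] H} {θ ζ ζ' : H}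
    (h : WIntAt W A θ ζ) (h' : WIntAt W A θ ζ') : WIntAt W A θ (ζ + ζ') := by
  unfold WIntAt
  simp only [map_add, inner_add_right]
  exact ⟨h.1.add h'.1, by rw [integral_add h.1 h'.1, h.2, h'.2]⟩

theorem WInt.norm_le {W : ℝ → H →L[ℂ] H} {A : H →L[ℂ] H} (hA : WInt W A) {g : ℝ → ℝ}
    (hg : Integrable g) (h : ∀ t, ‖W t‖ ≤ g t) : ‖A‖ ≤ ∫ t, g t := by
  have h0 : 0 ≤ ∫ t, g t := integral_nonneg fun t => (norm_nonneg _).trans (h t)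
  refine ContinuousLinearMap.opNorm_le_bound _ h0 fun ζ => ?_
  have key : ∀ θ, ‖⟪θ, A ζ⟫_ℂ‖ ≤ (∫ t, g t) * ‖ζ‖ * ‖θ‖ := fun θ => ?_
  · by_cases hz : A ζ = 0
    · rw [hz, norm_zero]; positivity
    -- Testing against `θ = A ζ` turns the bound on matrix coefficients into one on `‖A ζ‖`.
    have h1 := key (A ζ)
    rw [inner_self_eq_norm_sq_to_K, norm_pow, RCLike.norm_ofReal, abs_norm, sq] at h1
    exact le_of_mul_le_mul_right h1 (norm_pos_iff.2 hz)
  calc ‖⟪θ, A ζ⟫_ℂ‖ = ‖∫ t, ⟪θ, W t ζ⟫_ℂ‖ := by rw [(hA θ ζ).2]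
    _ ≤ ∫ t, g t * (‖ζ‖ * ‖θ‖) := by
      refine norm_integral_le_of_norm_le (hg.mul_const _) (ae_of_all _ fun t => ?_)
      refine (norm_inner_le_norm _ _).trans ?_
      have h1 := ((W t).le_opNorm ζ).trans (mul_le_mul_of_nonneg_right (h t) (norm_nonneg ζ))
      calc ‖θ‖ * ‖W t ζ‖ ≤ ‖θ‖ * (g t * ‖ζ‖) := by gcongr
        _ = _ := by ring
    _ = _ := by rw [integral_mul_const, mul_assoc]

theorem WInt.norm_le_of_bounded {W : ℝ → H →L[ℂ] H} {A : H →L[ℂ] H} (hA : WInt W A) {R ε : ℝ}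
    (hR : 0 ≤ R) (h : ∀ t, ‖W t‖ ≤ ε) (h0 : ∀ t, R < |t| → W t = 0) :
    ‖A‖ ≤ 2 * R * ε := by
  have hi : Integrable ((Set.Icc (-R) R).indicator fun _ => ε) :=
    (integrable_indicator_iff measurableSet_Icc).2 (integrableOn_const (by simp))
  refine (hA.norm_le hi fun t => ?_).trans_eq ?_
  · by_cases ht : t ∈ Set.Icc (-R) R
    · rw [Set.indicator_of_mem ht]; exact h t
    · rw [Set.indicator_of_notMem ht, h0 t (by
        rw [lt_abs]; rw [Set.mem_Icc, not_and_or] at ht; grind), norm_zero]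
  · rw [integral_indicator measurableSet_Icc, setIntegral_const]
    simp [Measure.real, hR]
    left; ring

theorem WIntAt.star [CompleteSpace H] {W : ℝ → H →L[ℂ] H} {A : H →L[ℂ] H} {θ ζ : H} (h : WIntAt W A
    θ ζ) :
    WIntAt (fun t => star (W t)) (star A) ζ θ := by
  have e : ∀ B : H →L[ℂ] H, ⟪ζ, (Star.star B) θ⟫_ℂ = conj ⟪θ, B ζ⟫_ℂ := fun B => by
    rw [ContinuousLinearMap.star_eq_adjoint, ContinuousLinearMap.adjoint_inner_right,
      inner_conj_symm]
  constructor
  · simp only [e]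
    exact (ContinuousLinearMap.integrable_comp (Complex.conjCLE : ℂ →L[ℝ] ℂ) h.1)
  · simp only [e]
    rw [h.2, integral_conj]

theorem WInt.star [CompleteSpace H] {W : ℝ → H →L[ℂ] H} {A : H →L[ℂ] H} (hA : WInt W A) :
    WInt (fun t => star (W t)) (star A) := fun θ ζ => (hA ζ θ).star

theorem WInt.mul_left [CompleteSpace H] {W : ℝ → H →L[ℂ] H} {A : H →L[ℂ] H} (C : H →L[ℂ] H) (hA :
    WInt W A) :
    WInt (fun t => C * W t) (C * A) := fun θ ζ => by
  have e : ∀ B : H →L[ℂ] H, ⟪θ, (C * B) ζ⟫_ℂ = ⟪Star.star C θ, B ζ⟫_ℂ := fun B => by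
    rw [ContinuousLinearMap.star_eq_adjoint, ContinuousLinearMap.adjoint_inner_left,
      mul_apply_eq_comp]
  unfold WIntAt
  simp only [e]
  exact hA _ ζ

theorem WInt.conjBy {W : ℝ → H →L[ℂ] H} {A : H →L[ℂ] H} {K : H ≃ₗᵢ⋆[ℂ] H}
    (hK : ∀ ξ, K (K ξ) = ξ) (hA : WInt W A) :
    WInt (fun t => QHeis.conjBy K (W t)) (QHeis.conjBy K A) := fun θ ζ => by
  have e : ∀ B : H →L[ℂ] H, ⟪θ, QHeis.conjBy K B ζ⟫_ℂ = conj ⟪K θ, B (K ζ)⟫_ℂ := fun B => by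
    nth_rw 1 [← hK θ]
    rw [conjBy_apply, inner_map_antiunitary, inner_conj_symm]
  unfold WIntAt
  simp only [e]
  refine ⟨ContinuousLinearMap.integrable_comp (Complex.conjCLE : ℂ →L[ℝ] ℂ) (hA _ _).1, ?_⟩
  rw [(hA _ _).2, integral_conj]

/-- Dominated convergence: the integrands along a convergent sequence of vectors are bounded by a
constant multiple of `g`. Measurability in `t` is inherited by the limit, so none has to be assumed
of `W`. -/
theorem isClosed_wIntAt {W : ℝ → H →L[ℂ] H} (A : H →L[ℂ] H) {g : ℝ → ℝ}
    (hg : Integrable g) (h : ∀ t, ‖W t‖ ≤ g t) (θ : H) : IsClosed {ζ | WIntAt W A θ ζ} := by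
  refine isClosed_of_closure_subset fun ζ hζ => ?_
  obtain ⟨u, hu, hlim⟩ := mem_closure_iff_seq_limit.1 hζ
  have hp : ∀ t, Tendsto (fun i => ⟪θ, W t (u i)⟫_ℂ) atTop (𝓝 ⟪θ, W t ζ⟫_ℂ) := fun t =>
    ((continuous_const.inner (W t).continuous).tendsto ζ).comp hlim
  have hb : ∀ t ξ, ‖⟪θ, W t ξ⟫_ℂ‖ ≤ g t * (‖θ‖ * ‖ξ‖) := fun t ξ => by
    refine (norm_inner_le_norm _ _).trans ?_
    have h1 := ((W t).le_opNorm ξ).trans (mul_le_mul_of_nonneg_right (h t) (norm_nonneg ξ))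
    calc ‖θ‖ * ‖W t ξ‖ ≤ ‖θ‖ * (g t * ‖ξ‖) := by gcongr
      _ = _ := by ring
  have hm : AEStronglyMeasurable (fun t => ⟪θ, W t ζ⟫_ℂ) volume :=
    aestronglyMeasurable_of_tendsto_ae atTop (fun i => (hu i).1.1) (ae_of_all _ hp)
  obtain ⟨M, hM⟩ := hlim.norm.bddAbove_range
  have hM' : ∀ i, ‖u i‖ ≤ M := fun i => hM ⟨i, rfl⟩
  refine ⟨(hg.mul_const (‖θ‖ * ‖ζ‖)).mono' hm (ae_of_all _ fun t => hb t ζ), ?_⟩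
  have h1 := tendsto_integral_of_dominated_convergence (fun t => g t * (‖θ‖ * M))
    (fun i => (hu i).1.1) (hg.mul_const _) (fun i => ae_of_all _ fun t => (hb t (u i)).trans (by
      have := hM' i
      have := (norm_nonneg _).trans (h t)
      gcongr)) (ae_of_all _ hp)
  have h2 : Tendsto (fun i => ⟪θ, A (u i)⟫_ℂ) atTop (𝓝 ⟪θ, A ζ⟫_ℂ) :=
    ((continuous_const.inner A.continuous).tendsto ζ).comp hlim
  exact tendsto_nhds_unique h2 (h1.congr fun i => (hu i).2.symm)

/-- A weak integral of a norm continuous, compactly supported function with values in a closed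
subspace belongs to that subspace. -/
theorem WInt.mem_of_continuous [CompleteSpace H] {W : ℝ → H →L[ℂ] H} {A : H →L[ℂ] H}
    (hA : WInt W A) (hc : Continuous W) {R : ℝ} (h0 : ∀ t, R < |t| → W t = 0)
    {S : Submodule ℂ (H →L[ℂ] H)} (hS : IsClosed (S : Set (H →L[ℂ] H))) (h : ∀ t, W t ∈ S) :
    A ∈ S := by
  have : CompleteSpace S := hS.completeSpace_coe
  have hsupp : HasCompactSupport W := HasCompactSupport.intro (isCompact_Icc (a := -R) (b := R))
    fun t ht => h0 t (by rw [lt_abs]; rw [Set.mem_Icc, not_and_or] at ht; grind)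
  have hi : Integrable W := hc.integrable_of_hasCompactSupport hsupp
  -- The Bochner integral is taken inside the complete space `S`, so its value lies in `S` by
  -- construction.
  let V : ℝ → S := fun t => ⟨W t, h t⟩
  have hVc : Continuous V := hc.subtype_mk h
  have hVs : HasCompactSupport V := HasCompactSupport.intro
    (isCompact_Icc (a := -R) (b := R)) fun t ht => Subtype.ext (h0 t (by
      rw [lt_abs]; rw [Set.mem_Icc, not_and_or] at ht; grind))
  have hVi : Integrable V := hVc.integrable_of_hasCompactSupport hVs
  have h1 : ((∫ t, V t : S) : H →L[ℂ] H) = ∫ t, W t :=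
    (S.subtypeL.integral_comp_comm hVi).symm
  have h2 : A = ∫ t, W t := by
    ext1 ζ
    refine ext_inner_left ℂ fun θ => ?_
    rw [(hA θ ζ).2]
    exact ((innerSL ℂ θ) ∘L (ContinuousLinearMap.apply ℂ H ζ)).integral_comp_comm hi
  rw [h2, ← h1]
  exact Subtype.mem _

end WInt

/-! ### Weak integrals on a tensor product. -/

section WIntTensor

variable {α : Type*} [MeasureSpace α] [SigmaFinite (volume : Measure α)]

/-- Density of elementary tensors is used in one argument at a time; passing to adjoints exchanges
the two arguments, so `isClosed_wIntAt` serves for both. -/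
theorem wInt_of_tmul {W : ℝ → L2 (α × α) →L[ℂ] L2 (α × α)} {A : L2 (α × α) →L[ℂ] L2 (α × α)}
    {g : ℝ → ℝ} (hg : Integrable g) (hW : ∀ t, ‖W t‖ ≤ g t)
    (h : ∀ ξ η ξ' η', WIntAt W A (tmul ξ η) (tmul ξ' η')) : WInt W A := by
  have h1 : ∀ ξ η ζ, WIntAt W A (tmul ξ η) ζ := fun ξ η =>
    tmul_induction (by simp [WIntAt]) (h ξ η) (fun F G hF hG => hF.add_right hG)
      (isClosed_wIntAt A hg hW _)
  have h2 : ∀ ζ θ, WIntAt (fun t => star (W t)) (star A) ζ θ := fun ζ =>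
    tmul_induction (by simp [WIntAt]) (fun ξ η => (h1 ξ η ζ).star)
      (fun F G hF hG => hF.add_right hG)
      (isClosed_wIntAt (star A) hg (fun t => by rw [norm_star]; exact hW t) _)
  intro θ ζ
  simpa using (h2 ζ θ).star

theorem WInt.tensor_one {W : ℝ → L2 α →L[ℂ] L2 α} {A : L2 α →L[ℂ] L2 α} (hA : WInt W A)
    {g : ℝ → ℝ} (hg : Integrable g) (hW : ∀ t, ‖W t‖ ≤ g t) :
    WInt (fun t => tensorOp 1 (W t)) (tensorOp 1 A) := by
  refine wInt_of_tmul hg (fun t => ?_) fun ξ η ξ' η' => ?_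
  · refine (norm_tensorOp_le _ _).trans ((mul_le_of_le_one_left (norm_nonneg _) ?_).trans (hW t))
    exact ContinuousLinearMap.norm_id_le
  · unfold WIntAt
    simp only [tensorOp_tmul, inner_tmul_tmul]
    exact ⟨(hA η η').1.const_mul _, by rw [(hA η η').2, integral_const_mul]⟩

end WIntTensor

/-! ### The unitary group `λ_t`. -/

section LamOp

variable {n : ℕ} (lam : ℝ)

theorem enorm_exp_pow (t : ℝ) :
    ‖(Real.exp (lam * t) : ℂ) ^ n‖ₑ = ENNReal.ofReal (Real.exp (lam * t)) ^ n := by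
  rw [enorm_pow, ← ofReal_norm, Complex.norm_real, Real.norm_of_nonneg (Real.exp_pos _).le]

theorem shift_shift (p : X n) (s t : ℝ) : shift lam (shift lam p s) t = shift lam p (s + t) := by
  simp only [shift, smul_smul, ← Real.exp_add, sub_sub]
  rw [show lam * t + lam * s = lam * (s + t) by ring]

theorem shift_zero (p : X n) : shift lam p 0 = p := by simp [shift]

/-- The unitary operator `(λ_t ζ)(x,y,r) = (e^{λt})ⁿ ζ(e^{λt}x, e^{λt}y, r - t)`. -/
def lamU (n : ℕ) (lam t : ℝ) : L2 (X n) ≃ₗᵢ[ℂ] L2 (X n) :=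
  wcompEquiv (fun p => shift lam p t) (fun p => shift lam p (-t))
    (fun _ => (Real.exp (lam * t) : ℂ) ^ n) (fun _ => (Real.exp (lam * (-t)) : ℂ) ^ n)
    (by unfold shift; fun_prop) measurable_const (by unfold shift; fun_prop) measurable_const
    (fun g hg => by
      simp only [enorm_exp_pow]
      exact lintegral_shift lam t g hg)
    (fun p => by rw [shift_shift, add_neg_cancel, shift_zero])
    (fun p => by rw [shift_shift, neg_add_cancel, shift_zero])
    (fun p => by
      rw [← mul_pow, ← Complex.ofReal_mul, ← Real.exp_add]; simp)

/-- `λ_t` as a bounded operator. -/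
def lamOp (n : ℕ) (lam t : ℝ) : L2 (X n) →L[ℂ] L2 (X n) :=
  (lamU n lam t).toLinearIsometry.toContinuousLinearMap

theorem isWC_lamOp (t : ℝ) : IsWC (lamOp n lam t) (fun p => shift lam p t)
    (fun _ => (Real.exp (lam * t) : ℂ) ^ n) := isWC_wcompEquiv ..

theorem norm_lamOp_le (t : ℝ) : ‖lamOp n lam t‖ ≤ 1 :=
  LinearIsometry.norm_toContinuousLinearMap_le _

theorem lamOp_mul_lamOp (s t : ℝ) : lamOp n lam s * lamOp n lam t = lamOp n lam (s + t) := by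
  refine ((isWC_lamOp lam s).mul (isWC_lamOp lam t)).eq (isWC_lamOp lam (s + t))
    (fun p => shift_shift lam p s t) fun p => ?_
  rw [← mul_pow, ← Complex.ofReal_mul, ← Real.exp_add, mul_add]

theorem lamOp_zero : lamOp n lam 0 = 1 :=
  (isWC_lamOp lam 0).eq isWC_one (shift_zero lam) (by simp)

theorem star_eq_symm {H : Type*} [NormedAddCommGroup H] [InnerProductSpace ℂ H] [CompleteSpace H]
    (U : H ≃ₗᵢ[ℂ] H) : star U.toLinearIsometry.toContinuousLinearMap
      = U.symm.toLinearIsometry.toContinuousLinearMap := by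
  ext1 ζ
  refine ext_inner_left ℂ fun θ => ?_
  rw [ContinuousLinearMap.star_eq_adjoint, ContinuousLinearMap.adjoint_inner_right]
  change ⟪U θ, ζ⟫_ℂ = ⟪θ, U.symm ζ⟫_ℂ
  rw [← U.inner_map_map θ, U.apply_symm_apply]

theorem star_lamOp (t : ℝ) : star (lamOp n lam t) = lamOp n lam (-t) := by
  have h : star (lamOp n lam t) * lamOp n lam t = 1 := by
    rw [lamOp, star_eq_symm]
    ext1 ζ
    exact (lamU n lam t).symm_apply_apply ζ
  calc star (lamOp n lam t) = star (lamOp n lam t) * (lamOp n lam t * lamOp n lam (-t)) := by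
        rw [lamOp_mul_lamOp, add_neg_cancel, lamOp_zero, mul_one]
    _ = _ := by rw [← mul_assoc, h, one_mul]

theorem measurable_shift_left (s : ℝ) : Measurable fun p : X n => shift lam p s := by
  unfold shift; fun_prop

/-- The covariance relation of the crossed product: it lets every multiplication operator be moved
to the left of the group. -/
theorem lamOp_mul_mulOp (s : ℝ) {φ : X n → ℂ} (h : BM φ) :
    lamOp n lam s * mulOp φ = mulOp (fun p => φ (shift lam p s)) * lamOp n lam s :=
  ((isWC_lamOp lam s).mul (isWC_mulOp h)).eq
    ((isWC_mulOp (h.comp (measurable_shift_left lam s))).mul (isWC_lamOp lam s))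
    (fun _ => rfl) fun _ => mul_comm _ _

end LamOp

/-! ### Continuous functions with bounded support. -/

section Kernels

/-- Continuous functions with bounded support. -/
structure CC {E : Type*} [NormedAddCommGroup E] (F : E → ℂ) : Prop where
  cont : Continuous F
  supp : ∃ R : ℝ, ∀ p, F p ≠ 0 → ‖p‖ ≤ R

variable {E : Type*} [NormedAddCommGroup E]

theorem CC.hasCompactSupport [ProperSpace E] {F : E → ℂ} (h : CC F) : HasCompactSupport F := by
  obtain ⟨R, hR⟩ := h.supp
  refine HasCompactSupport.intro (isCompact_closedBall (0 : E) R) fun p hp => ?_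
  by_contra hn
  exact hp (mem_closedBall_zero_iff.2 (hR p hn))

theorem CC.bound [ProperSpace E] {F : E → ℂ} (h : CC F) : ∃ C : ℝ, ∀ p, ‖F p‖ ≤ C :=
  h.hasCompactSupport.exists_bound_of_continuous h.cont

theorem CC.of_hasCompactSupport {F : E → ℂ} (h : Continuous F) (hs : HasCompactSupport F) :
    CC F := by
  obtain ⟨R, hR⟩ := hs.isBounded.exists_norm_le
  exact ⟨h, R, fun p hp => hR p (subset_tsupport F hp)⟩

theorem CC.add {F G : E → ℂ} (hF : CC F) (hG : CC G) : CC (fun p => F p + G p) := by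
  obtain ⟨R, hR⟩ := hF.supp
  obtain ⟨S, hS⟩ := hG.supp
  refine ⟨hF.cont.add hG.cont, max R S, fun p hp => ?_⟩
  by_cases h : F p = 0
  · exact (hS p (by simpa [h] using hp)).trans (le_max_right _ _)
  · exact (hR p h).trans (le_max_left _ _)

theorem CC.mul_left {F G : E → ℂ} (hF : CC F) (hG : Continuous G) : CC (fun p => G p * F p) := by
  obtain ⟨R, hR⟩ := hF.supp
  exact ⟨hG.mul hF.cont, R, fun p hp => hR p (right_ne_zero_of_mul hp)⟩

/-- Compactness of a ball in `Y` makes continuity in `t` uniform over it, and outside this ball all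
the sections vanish. This is the source of norm continuity for families of multiplication operators.
-/
theorem CC.eventually {T Y : Type*} [NormedAddCommGroup T] [NormedAddCommGroup Y] [ProperSpace Y]
    {G : T × Y → ℂ} (h : CC G) (t₀ : T) {ε : ℝ} (hε : 0 < ε) :
    ∀ᶠ t in 𝓝 t₀, ∀ y, ‖G (t, y) - G (t₀, y)‖ ≤ ε := by
  obtain ⟨R, hR⟩ := h.supp
  have h1 : ∀ᶠ t in 𝓝 t₀, ∀ y ∈ Metric.closedBall (0 : Y) R, ‖G (t, y) - G (t₀, y)‖ < ε := by
    refine (isCompact_closedBall (0 : Y) R).eventually_forall_of_forall_eventually fun y _ => ?_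
    have hc : Continuous fun z : T × Y => ‖G (z.1, z.2) - G (t₀, z.2)‖ := by
      have := h.cont
      fun_prop
    refine (hc.tendsto (t₀, y)).eventually_lt_const ?_
    simpa using hε
  filter_upwards [h1] with t ht y
  by_cases hy : y ∈ Metric.closedBall (0 : Y) R
  · exact (ht y hy).le
  · have h2 : ∀ s, G (s, y) = 0 := fun s => by
      by_contra hn
      exact hy (mem_closedBall_zero_iff.2 ((le_max_right _ _).trans (hR (s, y) hn)))
    simp [h2, hε.le]

theorem CC.continuous_mulOp {α T Y : Type*} [MeasureSpace α] [NormedAddCommGroup T]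
    [NormedAddCommGroup Y] [ProperSpace T] [ProperSpace Y] [MeasurableSpace Y] [BorelSpace Y]
    {G : T × Y → ℂ} (h : CC G) {π : α → Y} (hπ : Measurable π) :
    Continuous fun t => mulOp fun p => G (t, π p) := by
  rw [continuous_iff_continuousAt]
  intro t₀
  rw [ContinuousAt, Metric.tendsto_nhds]
  intro ε hε
  have hm : ∀ t, BM fun p => G (t, π p) := fun t =>
    ⟨(h.cont.comp (by fun_prop : Continuous fun y => (t, y))).measurable.comp hπ,
      h.bound.imp fun _ hC _ => hC _⟩
  filter_upwards [h.eventually t₀ (half_pos hε)] with t ht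
  rw [dist_eq_norm, mulOp_sub (hm t) (hm t₀)]
  exact (norm_mulOp_le (fun p => ht (π p)) (half_pos hε).le).trans_lt (half_lt_self hε)

theorem CC.bm [ProperSpace E] [MeasurableSpace E] [BorelSpace E] {F : E → ℂ} (h : CC F) : BM F :=
  ⟨h.cont.measurable, h.bound⟩

end Kernels

/-! ### Operators given by kernels. -/

section IsRho

variable {n : ℕ} {lam : ℝ}

/-- The operator `A` is given by the kernel `F`: it is the weak integral of the operators
`M_{F(·,t)} λ_t`. -/
def IsRho (lam : ℝ) (F : X n → ℂ) (A : L2 (X n) →L[ℂ] L2 (X n)) : Prop :=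
  WInt (fun t => mulOp (fun p : X n => F (p.1, p.2.1, t)) * lamOp n lam t) A

theorem BM.section {F : X n → ℂ} (h : BM F) (t : ℝ) : BM (fun p : X n => F (p.1, p.2.1, t)) :=
  h.comp (by fun_prop)

theorem IsRho.congr {F G : X n → ℂ} {A : L2 (X n) →L[ℂ] L2 (X n)} (h : IsRho lam F A)
    (e : ∀ p, F p = G p) : IsRho lam G A := by
  rwa [show G = F from (funext e).symm]

theorem IsRho.add {F G : X n → ℂ} {A B : L2 (X n) →L[ℂ] L2 (X n)} (hA : IsRho lam F A)
    (hB : IsRho lam G B) (hF : BM F) (hG : BM G) : IsRho lam (fun p => F p + G p) (A + B) :=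
  WInt.congr (WInt.add hA hB) fun t => by
    rw [← add_mul, mulOp_add (hF.section t) (hG.section t)]

/-- The main estimate: uniform approximation of kernels with a common support in `r` becomes norm
approximation of operators. Nothing about the size of the support in `(x,y)` enters, because `M_φ`
has norm at most `sup |φ|`. -/
theorem IsRho.norm_sub_le {F G : X n → ℂ} {A B : L2 (X n) →L[ℂ] L2 (X n)} (hA : IsRho lam F A)
    (hB : IsRho lam G B) (hF : BM F) (hG : BM G) {R ε : ℝ} (hR : 0 ≤ R) (hε : 0 ≤ ε)
    (h : ∀ p, ‖F p - G p‖ ≤ ε) (hFR : ∀ p : X n, R < |p.2.2| → F p = 0)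
    (hGR : ∀ p : X n, R < |p.2.2| → G p = 0) : ‖A - B‖ ≤ 2 * R * ε := by
  have h1 : WInt (fun t => mulOp (fun p : X n => F (p.1, p.2.1, t) - G (p.1, p.2.1, t)) *
      lamOp n lam t) (A - B) := WInt.congr (WInt.sub hA hB) fun t => by
    rw [← sub_mul, mulOp_sub (hF.section t) (hG.section t)]
  refine h1.norm_le_of_bounded hR (fun t => ?_) fun t ht => ?_
  · have h2 : ‖mulOp (fun p : X n => F (p.1, p.2.1, t) - G (p.1, p.2.1, t))‖ ≤ ε :=
      norm_mulOp_le (fun p => h (p.1, p.2.1, t)) hε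
    exact (norm_mul_le _ _).trans ((mul_le_mul h2 (norm_lamOp_le lam t)
      (norm_nonneg _) hε).trans_eq (mul_one ε))
  · have : (fun p : X n => F (p.1, p.2.1, t) - G (p.1, p.2.1, t)) = fun _ => 0 := by
      funext p
      rw [hFR (p.1, p.2.1, t) ht, hGR (p.1, p.2.1, t) ht, sub_zero]
    simp only [this, mulOp_zero, zero_mul]

theorem IsRho.smul {F : X n → ℂ} {A : L2 (X n) →L[ℂ] L2 (X n)} (hA : IsRho lam F A)
    (hF : BM F) (c : ℂ) : IsRho lam (fun p => c * F p) (c • A) := by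
  have h1 : c • A = mulOp (fun _ => c) * A := by
    refine ContinuousLinearMap.ext fun ξ => ?_
    ext1
    filter_upwards [mulOp_apply (bm_const c) (A ξ), Lp.coeFn_smul c (A ξ)] with p h1 h2
    rw [mul_apply_eq_comp, h1]
    exact h2
  rw [h1]
  exact WInt.congr (WInt.mul_left _ hA) fun t => by
    rw [← mul_assoc, mulOp_mul (bm_const c) (hF.section t)]

theorem IsRho.mulOp_mul {F : X n → ℂ} {A : L2 (X n) →L[ℂ] L2 (X n)} (hA : IsRho lam F A)
    (hF : BM F) {φ : V n × V n → ℂ} (hφ : BM φ) :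
    IsRho lam (fun p => φ (p.1, p.2.1) * F p) (mulOp (fun p : X n => φ (p.1, p.2.1)) * A) :=
  WInt.congr (WInt.mul_left _ hA) fun t => by
    rw [← mul_assoc, QHeis.mulOp_mul (hφ.comp (π := fun p : X n => (p.1, p.2.1)) (by fun_prop))
      (hF.section t)]

theorem IsRho.lamOp_mul {F : X n → ℂ} {A : L2 (X n) →L[ℂ] L2 (X n)} (hA : IsRho lam F A)
    (hF : BM F) (s : ℝ) : IsRho lam (fun p => F (shift lam p s)) (lamOp n lam s * A) := by
  refine WInt.congr ((WInt.mul_left _ hA).comp_sub_right s) fun t => ?_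
  rw [← mul_assoc, lamOp_mul_mulOp lam s (hF.section _), mul_assoc, lamOp_mul_lamOp,
    add_sub_cancel]
  rfl

/-- The adjoint of `M_φ λ_t` is `λ_{-t}` times multiplication by `conj φ`. After the substitution `t
↦ -t`, covariance moves the multiplication to the left, which dilates its argument. -/
theorem IsRho.star {F : X n → ℂ} {A : L2 (X n) →L[ℂ] L2 (X n)} (hA : IsRho lam F A)
    (hF : BM F) : IsRho lam (fun p => conj (F (Real.exp (lam * p.2.2) • p.1,
      Real.exp (lam * p.2.2) • p.2.1, -p.2.2))) (Star.star A) := by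
  refine WInt.congr (WInt.star hA).comp_neg fun t => ?_
  rw [star_mul, star_lamOp, star_mulOp (hF.section _), neg_neg,
    lamOp_mul_mulOp lam t (hF.section _).conj]
  rfl

theorem FunAlg.bm (f : FunAlg n) : BM f.1 :=
  ⟨f.1.continuous.measurable, _, fun p => f.1.norm_le_seminorm ℝ p⟩

theorem FunAlg.exists_radius (f : FunAlg n) :
    ∃ R : ℝ, 0 ≤ R ∧ ∀ p : X n, R < |p.2.2| → f.1 p = 0 := by
  obtain ⟨K, hK, h⟩ := f.2
  obtain ⟨R, hR⟩ := hK.isBounded.exists_norm_le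
  refine ⟨max R 0, le_max_right _ _, fun p hp => h p fun hpK => ?_⟩
  exact absurd ((hR _ hpK).trans (le_max_left R 0)) (not_le.2 hp)

theorem mul_le_sq_add_sq (a b : ℝ≥0∞) : a * b ≤ a ^ 2 + b ^ 2 := by
  rcases le_total a b with h | h
  · exact (mul_le_mul_left h b).trans (by rw [sq b]; exact le_add_self)
  · exact (mul_le_mul_right h a).trans (by rw [sq a]; exact le_self_add)

theorem lintegral_sq_lt_top {α : Type*} [MeasureSpace α] (ζ : L2 α) : ∫⁻ p, ‖ζ p‖ₑ ^ 2 < ∞ := by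
  have := Lp.eLpNorm_lt_top ζ
  rw [eLpNorm_lt_top_iff_lintegral_rpow_enorm_lt_top (by simp) (by simp)] at this
  simpa using this

/-- Fubini for the matrix coefficients. Joint integrability follows from `rho_bound` and `ab ≤ a² +
b²`. -/
theorem isRho_rho (f : FunAlg n) : IsRho lam f.1 (rho lam f) := by
  intro θ ζ
  have hθ := (Lp.stronglyMeasurable θ).measurable
  have hζ := (Lp.stronglyMeasurable ζ).measurable
  have hm := measurable_rhoIntegrand lam f.1 ζ hζ
  have hGm : Measurable fun q : X n × ℝ => rhoIntegrand lam f.1 ζ q.1 q.2 * conj (θ q.1) :=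
    hm.mul (Complex.continuous_conj.measurable.comp (hθ.comp measurable_fst))
  have hG : Integrable (fun q : X n × ℝ => rhoIntegrand lam f.1 ζ q.1 q.2 * conj (θ q.1))
      ((volume : Measure (X n)).prod (volume : Measure ℝ)) := by
    refine ⟨hGm.aestronglyMeasurable, ?_⟩
    obtain ⟨C, hC, hb⟩ := rho_bound lam f.1 f.2
    rw [HasFiniteIntegral, lintegral_prod _ hGm.enorm.aemeasurable]
    calc _ = ∫⁻ p, (∫⁻ s, ‖rhoIntegrand lam f.1 ζ p s‖ₑ) * ‖θ p‖ₑ := by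
          congr 1 with p
          rw [← lintegral_mul_const _ (by
            exact (hm.comp measurable_prodMk_left).enorm)]
          simp [enorm_mul]
      _ ≤ ∫⁻ p, ((∫⁻ s, ‖rhoIntegrand lam f.1 ζ p s‖ₑ) ^ 2 + ‖θ p‖ₑ ^ 2) :=
          lintegral_mono fun p => mul_le_sq_add_sq _ _
      _ = (∫⁻ p, (∫⁻ s, ‖rhoIntegrand lam f.1 ζ p s‖ₑ) ^ 2) + ∫⁻ p, ‖θ p‖ₑ ^ 2 :=
          lintegral_add_right _ (by fun_prop)
      _ < ∞ := ENNReal.add_lt_top.2 ⟨(hb ζ hζ).trans_lt (ENNReal.mul_lt_top hC.lt_top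
          (lintegral_sq_lt_top ζ)), lintegral_sq_lt_top θ⟩
  have e : ∀ t, ⟪θ, (mulOp (fun p : X n => f.1 (p.1, p.2.1, t)) * lamOp n lam t) ζ⟫_ℂ
      = ∫ p, rhoIntegrand lam f.1 ζ p t * conj (θ p) := fun t => by
    rw [L2.inner_def]
    refine integral_congr_ae ?_
    filter_upwards [((isWC_mulOp ((FunAlg.bm f).section t)).mul
      (isWC_lamOp lam t)).2 ζ] with p hp
    rw [hp, RCLike.inner_apply, rhoIntegrand]
    simp only [id]
    ring
  constructor
  · simp only [e]
    exact hG.integral_prod_right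
  · simp only [e]
    rw [L2.inner_def, ← integral_integral_swap hG]
    refine integral_congr_ae ?_
    filter_upwards [rho_apply lam f ζ] with p hp
    rw [hp, RCLike.inner_apply, integral_mul_const]

end IsRho

/-! ### Slices of `U_A` and their kernels. -/

section Slices

variable {n : ℕ} (lam : ℝ)

instance instIsAddHaarMeasureVolumeProdV (n : ℕ) :
    (volume : Measure (V n × V n)).IsAddHaarMeasure :=
  inferInstanceAs ((volume : Measure (V n)).prod (volume : Measure (V n))).IsAddHaarMeasure

@[fun_prop]
theorem continuous_eta : Continuous (eta lam) := by
  unfold eta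
  split_ifs <;> fun_prop

@[fun_prop]
theorem continuous_eBar : Continuous eBar := by unfold eBar; fun_prop

@[fun_prop]
theorem continuous_ee : Continuous ee := by unfold ee; fun_prop

theorem norm_eBar (t : ℝ) : ‖eBar t‖ = 1 := by
  have := enorm_eBar t
  rwa [← ofReal_norm, ENNReal.ofReal_eq_one] at this

theorem norm_ee (t : ℝ) : ‖ee t‖ = 1 := by
  have := enorm_ee t
  rwa [← ofReal_norm, ENNReal.ofReal_eq_one] at this

variable {lam}

theorem norm_le_of_norm_exp_smul_le {x : V n} {t R S : ℝ} (ht : |t| ≤ R)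
    (hx : ‖Real.exp (lam * t) • x‖ ≤ S) : ‖x‖ ≤ Real.exp (|lam| * R) * S := by
  have h1 : ‖x‖ = Real.exp (-(lam * t)) * ‖Real.exp (lam * t) • x‖ := by
    rw [norm_smul, Real.norm_of_nonneg (Real.exp_pos _).le, ← mul_assoc, ← Real.exp_add]
    simp
  rw [h1]
  have h2 : -(lam * t) ≤ |lam| * R :=
    (neg_le_abs _).trans ((abs_mul lam t).trans_le (by gcongr))
  have := (norm_nonneg _).trans hx
  gcongr

variable (lam)

/-- The integrand of the kernel of the slice of `U_A` by the vector functional of `ξ` and `η`. -/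
def sliceIntegrand (ξ η : X n → ℂ) (p : X n) (q : V n × V n) : ℂ :=
  conj (η (q.1, q.2, -p.2.2)) *
    (eBar (eta lam (-p.2.2) * ⟪Real.exp (lam * p.2.2) • p.1,
      q.2 - Real.exp (lam * p.2.2) • p.2.1⟫_ℝ) *
    ξ (q.1 - Real.exp (lam * p.2.2) • p.1, q.2 - Real.exp (lam * p.2.2) • p.2.1, -p.2.2))

/-- The kernel of the slice of `U_A` by the vector functional of `ξ` and `η`. -/
def sliceKernel (ξ η : X n → ℂ) (p : X n) : ℂ := ∫ q, sliceIntegrand lam ξ η p q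

variable {lam}

/-- The support of `η` confines both `q` and `r`, which reduces the integral to a fixed ball and
gives continuity. The support of `ξ` then confines `e^{λr}x` and `e^{λr}y`, hence `x` and `y`, since
`r` is already bounded. -/
theorem cc_sliceKernel {ξ η : X n → ℂ} (hξ : CC ξ) (hη : CC η) : CC (sliceKernel lam ξ η) := by
  obtain ⟨R, hR⟩ := hη.supp
  obtain ⟨S, hS⟩ := hξ.supp
  have hηc := hη.cont
  have hξc := hξ.cont
  have hsupp : ∀ p q, sliceIntegrand lam ξ η p q ≠ 0 → ‖q‖ ≤ R ∧ |p.2.2| ≤ R ∧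
      ‖q.1 - Real.exp (lam * p.2.2) • p.1‖ ≤ S ∧ ‖q.2 - Real.exp (lam * p.2.2) • p.2.1‖ ≤ S := by
    intro p q h
    unfold sliceIntegrand at h
    have h1 := hR _ (by simpa using left_ne_zero_of_mul h)
    have h2 := hS _ (right_ne_zero_of_mul (right_ne_zero_of_mul h))
    simp only [Prod.norm_def, max_le_iff, Real.norm_eq_abs, abs_neg] at h1 h2 ⊢
    tauto
  constructor
  · have h1 : sliceKernel lam ξ η =
        fun p => ∫ q in Metric.closedBall (0 : V n × V n) R, sliceIntegrand lam ξ η p q := by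
      funext p
      refine (setIntegral_eq_integral_of_forall_compl_eq_zero fun q hq => ?_).symm
      by_contra hn
      exact hq (mem_closedBall_zero_iff.2 (hsupp p q hn).1)
    rw [h1]
    refine continuous_parametric_integral_of_continuous ?_ (isCompact_closedBall _ _)
    unfold Function.uncurry sliceIntegrand
    fun_prop
  · refine ⟨max R (Real.exp (|lam| * R) * (R + S)), fun p hp => ?_⟩
    obtain ⟨q, hq⟩ : ∃ q, sliceIntegrand lam ξ η p q ≠ 0 := by
      by_contra! h
      exact hp (by simp [sliceKernel, h])
    obtain ⟨h1, h2, h3, h4⟩ := hsupp p q hq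
    have key : ∀ u x : V n, ‖u‖ ≤ R → ‖u - Real.exp (lam * p.2.2) • x‖ ≤ S →
        ‖x‖ ≤ Real.exp (|lam| * R) * (R + S) := fun u x hu hx => by
      refine norm_le_of_norm_exp_smul_le h2 ?_
      calc ‖Real.exp (lam * p.2.2) • x‖ = ‖u - (u - Real.exp (lam * p.2.2) • x)‖ := by simp
        _ ≤ _ := (norm_sub_le _ _).trans (add_le_add hu hx)
    simp only [Prod.norm_def, max_le_iff] at h1 ⊢
    exact ⟨(key _ _ h1.1 h3).trans (le_max_right _ _),
      (key _ _ h1.2 h4).trans (le_max_right _ _), h2.trans (le_max_left _ _)⟩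

theorem CC.memLp {F : X n → ℂ} (h : CC F) : MemLp F 2 volume :=
  h.cont.memLp_of_hasCompactSupport h.hasCompactSupport

/-- The element of `L²` given by a continuous function with bounded support. -/
def CC.toL2 {F : X n → ℂ} (h : CC F) : L2 (X n) := h.memLp.toLp F

theorem isWC_UOp : IsWC (UOp n lam) (UMap lam) (UWeight lam) := isWC_wcompEquiv ..

theorem isWC_star_UOp : IsWC (star (UOp n lam)) (UMapInv lam) (UWeightInv lam) := by
  rw [UOp, star_eq_symm]
  exact isWC_wcompEquiv_symm ..

/-- Coordinates are reordered so that `r'` becomes the outer variable, followed by `(x',y')` and by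
the first leg: the order in which Fubini produces the weak integral of a slice. -/
theorem measurePreserving_regroup (n : ℕ) : MeasurePreserving
    (fun z : ℝ × ((V n × V n) × X n) => (z.2.2, (z.2.1.1, z.2.1.2, z.1))) volume volume := by
  have h1 := (volume_preserving_prodAssoc (α₁ := ℝ) (β₁ := V n × V n) (γ₁ := X n)).symm
  have h2 : MeasurePreserving (Prod.map Prod.swap id) (volume : Measure ((ℝ × (V n × V n)) × X n))
      (volume : Measure (((V n × V n) × ℝ) × X n)) :=
    Measure.measurePreserving_swap.prod (MeasurePreserving.id _)
  have h3 : MeasurePreserving (Prod.map MeasurableEquiv.prodAssoc id)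
      (volume : Measure (((V n × V n) × ℝ) × X n)) (volume : Measure (X n × X n)) :=
    (volume_preserving_prodAssoc (α₁ := V n) (β₁ := V n) (γ₁ := ℝ)).prod (MeasurePreserving.id _)
  have h4 : MeasurePreserving Prod.swap (volume : Measure (X n × X n)) volume :=
    Measure.measurePreserving_swap
  exact h4.comp (h3.comp (h2.comp h1))

/-- The integrand, in `(t, (q, p))`, of the matrix coefficients of a slice of `U_A`. -/
def sliceCoeff (lam : ℝ) (ξ η : X n → ℂ) (θ ζ : X n → ℂ) (z : ℝ × ((V n × V n) × X n)) : ℂ :=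
  sliceIntegrand lam ξ η (z.2.2.1, z.2.2.2.1, -z.1) z.2.1 *
    ((Real.exp (lam * (-z.1)) : ℂ) ^ n * ζ (shift lam z.2.2 (-z.1)) * conj (θ z.2.2))

theorem inner_UOp_ae {ξ η : X n → ℂ} (hξ : CC ξ) (hη : CC η) (θ ζ : L2 (X n)) :
    ∀ᵐ P : X n × X n, ⟪tmul θ hη.toL2 P, UOp n lam (tmul ζ hξ.toL2) P⟫_ℂ
      = sliceCoeff lam ξ η θ ζ (P.2.2.2, ((P.2.1, P.2.2.1), P.1)) := by
  filter_upwards [tmul_apply θ hη.toL2, isWC_UOp.2 (tmul ζ hξ.toL2),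
    (isWC_UOp (n := n) (lam := lam)).1.ae (tmul_apply ζ hξ.toL2),
    (isWC_UOp (n := n) (lam := lam)).1.ae (ae_snd hξ.memLp.coeFn_toLp),
    ae_snd hη.memLp.coeFn_toLp] with P h1 h2 h3 h4 h5
  rw [h1, h2, h3, CC.toL2, CC.toL2, h4, h5, RCLike.inner_apply]
  simp only [sliceCoeff, UMap, UWeight, sliceIntegrand, shift, map_mul, mul_neg, neg_neg,
    sub_neg_eq_add]
  ring

theorem integral_eq_of_measurePreserving {α β : Type*} [MeasurableSpace α] [MeasurableSpace β]
    {μ : Measure β} {ν : Measure α} {m : β → α} (hm : MeasurePreserving m μ ν) {G k : α → ℂ}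
    (hG : Integrable G ν) (h : ∀ᵐ P ∂ν, G P = k P) :
    Integrable (fun z => k (m z)) μ ∧ ∫ P, G P ∂ν = ∫ z, k (m z) ∂μ := by
  have hk : Integrable k ν := hG.congr h
  refine ⟨(hm.integrable_comp hk.1).2 hk, ?_⟩
  rw [integral_congr_ae h, ← integral_map hm.aemeasurable (by rw [hm.map_eq]; exact hk.1),
    hm.map_eq]

theorem integral_sliceCoeff {ξ η : X n → ℂ} (hξ : CC ξ) (hη : CC η) (θ ζ : L2 (X n)) :
    Integrable (sliceCoeff lam ξ η θ ζ) ∧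
      ⟪tmul θ hη.toL2, UOp n lam (tmul ζ hξ.toL2)⟫_ℂ = ∫ z, sliceCoeff lam ξ η θ ζ z := by
  rw [L2.inner_def]
  exact integral_eq_of_measurePreserving (measurePreserving_regroup n)
    (k := fun P => sliceCoeff lam ξ η θ ζ (P.2.2.2, ((P.2.1, P.2.2.1), P.1)))
    (L2.integrable_inner (𝕜 := ℂ) (tmul θ hη.toL2) (UOp n lam (tmul ζ hξ.toL2)))
    (inner_UOp_ae hξ hη θ ζ)

theorem integral_sliceCoeff_section {ξ η : X n → ℂ} (hξ : CC ξ) (hη : CC η) (θ ζ : L2 (X n))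
    {t : ℝ} (ht : Integrable fun y => sliceCoeff lam ξ η θ ζ (t, y)) :
    ∫ y, sliceCoeff lam ξ η θ ζ (t, y) =
      ⟪θ, (mulOp (fun p : X n => sliceKernel lam ξ η (p.1, p.2.1, -t)) * lamOp n lam (-t)) ζ⟫_ℂ :=
          by
  have hK : BM (sliceKernel lam ξ η) := (cc_sliceKernel hξ hη).bm
  rw [Measure.volume_eq_prod, integral_prod_symm _ ht, L2.inner_def]
  refine integral_congr_ae ?_
  filter_upwards [((isWC_mulOp (hK.section (-t))).mul (isWC_lamOp lam (-t))).2 ζ] with p hp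
  rw [hp, RCLike.inner_apply]
  simp only [sliceCoeff, id]
  rw [integral_mul_const, sliceKernel]
  ring

/-- For fixed `r'` the operator `U_A` acts on the first leg as `λ_{-r'}` up to a multiplication, so
integrating over `(x',y')` leaves an integral of operators `M λ_{-t}` with `t = r'`. The sign is
removed at the end by `t ↦ -t`. -/
theorem isRho_slice {ξ η : X n → ℂ} (hξ : CC ξ) (hη : CC η) : IsRho lam (sliceKernel lam ξ η)
    (rightSlice (vecFunctional hξ.toL2 hη.toL2) (UOp n lam)) := by
  have h : WInt (fun t => mulOp (fun p : X n => sliceKernel lam ξ η (p.1, p.2.1, -t)) *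
      lamOp n lam (-t)) (rightSlice (vecFunctional hξ.toL2 hη.toL2) (UOp n lam)) := fun θ ζ => by
    obtain ⟨hki, hint⟩ := integral_sliceCoeff (lam := lam) hξ hη θ ζ
    have e : ∀ᵐ t, ∫ y, sliceCoeff lam ξ η θ ζ (t, y) = ⟪θ, (mulOp (fun p : X n =>
        sliceKernel lam ξ η (p.1, p.2.1, -t)) * lamOp n lam (-t)) ζ⟫_ℂ := by
      filter_upwards [hki.prod_right_ae] with t ht using integral_sliceCoeff_section hξ hη θ ζ ht
    refine ⟨hki.integral_prod_left.congr e, ?_⟩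
    rw [rightSlice_vecFunctional, ← integral_congr_ae e, hint, Measure.volume_eq_prod,
      integral_prod _ hki]
  exact WInt.congr h.comp_neg fun t => by simp only [neg_neg]

theorem isClosed_AHat : IsClosed (AHat n lam : Set (L2 (X n) →L[ℂ] L2 (X n))) :=
  NonUnitalStarSubalgebra.isClosed_topologicalClosure _

theorem slice_mem_AHat (ξ η : L2 (X n)) :
    rightSlice (vecFunctional ξ η) (UOp n lam) ∈ AHat n lam :=
  NonUnitalStarSubalgebra.le_topologicalClosure _ (NonUnitalStarAlgebra.subset_adjoin ℂ _
    ⟨_, Submodule.le_topologicalClosure _ (Submodule.subset_span ⟨ξ, η, rfl⟩), rfl⟩)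

theorem CC.exists_radius {F : X n → ℂ} (h : CC F) :
    ∃ R : ℝ, 0 ≤ R ∧ ∀ p : X n, R < |p.2.2| → F p = 0 := by
  obtain ⟨R, hR⟩ := h.supp
  refine ⟨max R 0, le_max_right _ _, fun p hp => ?_⟩
  by_contra hn
  have h1 : |p.2.2| ≤ ‖p‖ := (le_max_right _ _).trans (le_max_right _ _)
  exact absurd (h1.trans ((hR p hn).trans (le_max_left R 0))) (not_le.2 hp)

/-- The kernel `conj F(e^{λr}u, e^{λr}v, -r)` of the adjoint. -/
theorem CC.adjoint {F : X n → ℂ} (h : CC F) : CC (fun p : X n => conj (F (Real.exp (lam * p.2.2) •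
    p.1, Real.exp (lam * p.2.2) • p.2.1, -p.2.2))) := by
  obtain ⟨R, hR⟩ := h.supp
  have hc := h.cont
  refine ⟨by fun_prop, max R (Real.exp (|lam| * R) * R), fun p hp => ?_⟩
  have h1 := hR _ (by simpa using hp)
  simp only [Prod.norm_def, max_le_iff, Real.norm_eq_abs, abs_neg] at h1 ⊢
  exact ⟨(norm_le_of_norm_exp_smul_le h1.2.2 h1.1).trans (le_max_right _ _),
    (norm_le_of_norm_exp_smul_le h1.2.2 h1.2.1).trans (le_max_right _ _),
    h1.2.2.trans (le_max_left _ _)⟩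

theorem exists_cc_one {E : Type*} [NormedAddCommGroup E] [NormedSpace ℝ E] [FiniteDimensional ℝ E]
    {R : ℝ} (hR : 0 ≤ R) : ∃ κ : E → ℂ, CC κ ∧ (∀ p, ‖p‖ ≤ R → κ p = 1) ∧ (∀ p, ‖κ p‖ ≤ 1) := by
  let φ : ContDiffBump (0 : E) := ⟨R + 1, R + 2, by positivity, by linarith⟩
  refine ⟨fun p => (φ p : ℂ), ⟨Complex.continuous_ofReal.comp φ.continuous, R + 2, fun p hp => ?_⟩,
    fun p hp => ?_, fun p => ?_⟩
  · by_contra hn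
    exact hp (by rw [φ.zero_of_le_dist (by simpa using (not_le.1 hn).le), Complex.ofReal_zero])
  · have : φ p = 1 := φ.one_of_mem_closedBall
      (mem_closedBall_zero_iff.2 (hp.trans (by change R ≤ R + 1; linarith)))
    simp only [this, Complex.ofReal_one]
  · rw [Complex.norm_real, Real.norm_of_nonneg φ.nonneg]
    exact φ.le_one

/-- Slicing with `η` the adjoint kernel of `F` and `ξ` a narrow bump in `(x,y)` gives a kernel that
is the average of `H (u, ·)` over small `u`. Since `H (0, ·) = F`, these kernels converge uniformly
to `F` with common support in `r`, so the slices converge to `A` in norm. -/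
theorem IsRho.mem_AHat {F : X n → ℂ} {A : L2 (X n) →L[ℂ] L2 (X n)} (hF : CC F)
    (hA : IsRho lam F A) : A ∈ AHat n lam := by
  obtain ⟨R, hR0, hR⟩ := hF.exists_radius
  obtain ⟨κ, hκ, hκ1, -⟩ := exists_cc_one (E := V n × V n) zero_le_one
  obtain ⟨k, hkc, hk1, -⟩ := exists_cc_one (E := ℝ) hR0
  have hFc := hF.cont
  have hκc := hκ.cont
  have hkc' := hkc.cont
  -- The factor `κ`, equal to one near the origin, does not affect small `u`; it only bounds the
  -- support in `u`, so that `CC.eventually` applies.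
  let H : (V n × V n) × X n → ℂ := fun z => κ z.1 *
    (F (Real.exp (-(lam * z.2.2.2)) • z.1.1 + z.2.1, Real.exp (-(lam * z.2.2.2)) • z.1.2 + z.2.2.1,
      z.2.2.2) * eBar (eta lam (-z.2.2.2) * ⟪Real.exp (lam * z.2.2.2) • z.2.1, z.1.2⟫_ℝ))
  have hH : CC H := by
    obtain ⟨S, hS⟩ := hF.supp
    obtain ⟨T, hT⟩ := hκ.supp
    refine ⟨by fun_prop, max (max S T) (Real.exp (|lam| * S) * T + S), fun z hz => ?_⟩
    have h1 := hT _ (left_ne_zero_of_mul hz)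
    have h2 := hS _ (left_ne_zero_of_mul (right_ne_zero_of_mul hz))
    simp only [Prod.norm_def, max_le_iff, Real.norm_eq_abs] at h1 h2 ⊢
    have key : ∀ u x : V n, ‖u‖ ≤ T → ‖Real.exp (-(lam * z.2.2.2)) • u + x‖ ≤ S →
        ‖x‖ ≤ Real.exp (|lam| * S) * T + S := fun u x hu hx => by
      have h3 : -(lam * z.2.2.2) ≤ |lam| * S :=
        (neg_le_abs _).trans ((abs_mul _ _).trans_le (by gcongr; exact h2.2.2))
      have h4 : ‖Real.exp (-(lam * z.2.2.2)) • u‖ ≤ Real.exp (|lam| * S) * T := by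
        rw [norm_smul, Real.norm_of_nonneg (Real.exp_pos _).le]
        gcongr
      calc ‖x‖ = ‖(Real.exp (-(lam * z.2.2.2)) • u + x) - Real.exp (-(lam * z.2.2.2)) • u‖ := by
            rw [add_sub_cancel_left]
        _ ≤ S + _ := (_root_.norm_sub_le _ _).trans (add_le_add hx h4)
        _ = _ := add_comm _ _
    refine ⟨⟨h1.1.trans ((le_max_right _ _).trans (le_max_left _ _)),
      h1.2.trans ((le_max_right _ _).trans (le_max_left _ _))⟩,
      (key _ _ h1.1 h2.1).trans (le_max_right _ _), (key _ _ h1.2 h2.2.1).trans (le_max_right _ _),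
      h2.2.2.trans ((le_max_left _ _).trans (le_max_left _ _))⟩
  have hH0 : ∀ p, H (0, p) = F p := fun p => by
    simp [H, hκ1 0 (by simp), eBar]
  rw [← SetLike.mem_coe, ← isClosed_AHat.closure_eq, Metric.mem_closure_iff]
  intro ε hε
  obtain ⟨ε', hε', hεε⟩ : ∃ ε' : ℝ, 0 < ε' ∧ 2 * R * ε' < ε := by
    refine ⟨ε / (2 * R + 1), by positivity, ?_⟩
    rw [← mul_div_assoc, div_lt_iff₀ (by positivity)]
    nlinarith
  obtain ⟨d, hd, hdH⟩ := Metric.eventually_nhds_iff.1 (hH.eventually 0 hε')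
  let δ : ContDiffBump (0 : V n × V n) := ⟨min d 1 / 2, min d 1, by positivity,
    half_lt_self (by positivity)⟩
  let ξ : X n → ℂ := fun p => (δ.normed volume (p.1, p.2.1) : ℂ) * k p.2.2
  have hδ0 : ∀ u, δ.normed volume u ≠ 0 → ‖u‖ < min d 1 := fun u hu => by
    have h1 : u ∈ Function.support (δ.normed volume) := hu
    rw [δ.support_normed_eq] at h1
    rw [mem_ball_zero_iff] at h1
    exact h1
  have hδc : Continuous (δ.normed volume) := δ.continuous_normed
  have hξ : CC ξ := by
    obtain ⟨S, hS⟩ := hkc.supp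
    refine ⟨by fun_prop, max 1 S, fun p hp => ?_⟩
    have h1 := (hδ0 (p.1, p.2.1) (by simpa using left_ne_zero_of_mul hp)).le.trans
      (min_le_right _ _)
    have h2 := hS _ (right_ne_zero_of_mul hp)
    simp only [Prod.norm_def, max_le_iff] at h1 ⊢
    exact ⟨h1.1.trans (le_max_left _ _), h1.2.trans (le_max_left _ _), h2.trans (le_max_right _ _)⟩
  let η : X n → ℂ := fun p => conj (F (Real.exp (lam * p.2.2) • p.1,
    Real.exp (lam * p.2.2) • p.2.1, -p.2.2))
  have hη : CC η := hF.adjoint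
  have hker : ∀ p, sliceKernel lam ξ η p = ∫ u, (δ.normed volume u : ℂ) * H (u, p) := fun p => by
    -- With `q = u + e^{λr}(x,y)` the argument of `ξ` becomes `(u,-r)`, and that of `F` becomes a
    -- perturbation of `p` by `e^{-λr}u`.
    rw [sliceKernel, ← integral_add_right_eq_self _ (Real.exp (lam * p.2.2) • (p.1, p.2.1))]
    refine integral_congr_ae (ae_of_all _ fun u => ?_)
    simp only [sliceIntegrand, ξ, η, H, Prod.fst_add, Prod.snd_add, Prod.smul_fst, Prod.smul_snd,
      smul_add, smul_smul, ← Real.exp_add, add_sub_cancel_right, Complex.conj_conj, mul_neg,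
      neg_neg, neg_add_cancel, Real.exp_zero, one_smul]
    by_cases hu : δ.normed volume u = 0
    · simp [hu]
    · have hκu : κ u = 1 := by
        exact hκ1 u ((hδ0 u hu).le.trans (min_le_right _ _))
      by_cases hp : R < |p.2.2|
      · have h0 : ∀ a b, F (a, b, p.2.2) = 0 := fun a b => hR (a, b, p.2.2) hp
        simp [h0]
      · rw [hk1 _ (by simpa using hp), hκu]
        ring
  refine ⟨_, slice_mem_AHat hξ.toL2 hη.toL2, ?_⟩
  rw [dist_eq_norm]
  refine (hA.norm_sub_le (isRho_slice hξ hη) hF.bm (cc_sliceKernel hξ hη).bm hR0 hε'.le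
    (fun p => ?_) hR fun p hp => ?_).trans_lt hεε
  · have h1 : F p = ∫ u, (δ.normed volume u : ℂ) * F p := by
      rw [integral_mul_const, integral_complex_ofReal, δ.integral_normed, Complex.ofReal_one,
          one_mul]
    have hHc := hH.cont
    have i1 : Integrable fun u => (δ.normed volume u : ℂ) * H (u, p) :=
      (by fun_prop : Continuous fun u => (δ.normed volume u : ℂ) * H (u,
          p)).integrable_of_hasCompactSupport
        ((δ.hasCompactSupport_normed.comp_left (g := Complex.ofReal) rfl).mul_right)
    have i2 : Integrable fun u => (δ.normed volume u : ℂ) * F p :=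
        δ.integrable_normed.ofReal.mul_const _
    rw [hker, h1, ← integral_sub i2 i1]
    refine (norm_integral_le_of_norm_le (δ.integrable_normed.mul_const ε') (ae_of_all _ fun u =>
        ?_)).trans_eq
      (by rw [integral_mul_const, δ.integral_normed, one_mul])
    rw [← mul_sub, norm_mul, Complex.norm_real, Real.norm_of_nonneg (δ.nonneg_normed u)]
    by_cases hu : δ.normed volume u = 0
    · simp [hu]
    · refine mul_le_mul_of_nonneg_left ?_ (δ.nonneg_normed u)
      rw [norm_sub_rev, ← hH0 p]
      exact hdH (by simpa using (hδ0 u hu).trans_le (min_le_left _ _)) p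
  · have h0 : ∀ a b, F (a, b, p.2.2) = 0 := fun a b => hR (a, b, p.2.2) hp
    rw [hker]
    simp [H, h0]

end Slices

/-! ### `Â` as a closure of operators with kernels. -/

section AHatStructure

variable {n : ℕ} {lam : ℝ}

theorem opNorm_le_of_inner {H : Type*} [NormedAddCommGroup H] [InnerProductSpace ℂ H]
    (A : H →L[ℂ] H) {C : ℝ} (hC : 0 ≤ C) (h : ∀ θ ζ, ‖⟪θ, A ζ⟫_ℂ‖ ≤ C * ‖ζ‖ * ‖θ‖) :
    ‖A‖ ≤ C := by
  refine ContinuousLinearMap.opNorm_le_bound _ hC fun ζ => ?_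
  by_cases hz : A ζ = 0
  · rw [hz, norm_zero]; positivity
  have h1 := h (A ζ) ζ
  rw [inner_self_eq_norm_sq_to_K, norm_pow, RCLike.norm_ofReal, abs_norm, sq] at h1
  exact le_of_mul_le_mul_right h1 (norm_pos_iff.2 hz)

/-- The right slice of `T` as a bounded linear function of the functional. -/
def rightSliceL {α : Type*} [MeasureSpace α] [SigmaFinite (volume : Measure α)]
    (T : L2 (α × α) →L[ℂ] L2 (α × α)) :
    StrongDual ℂ (L2 α →L[ℂ] L2 α) →L[ℂ] (L2 α →L[ℂ] L2 α) :=
  LinearMap.mkContinuous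
    { toFun := fun ω => rightSlice ω T
      map_add' := fun ω ω' => by
        ext1 ζ
        exact ext_inner_left ℂ fun θ => by
          rw [add_apply, inner_add_right, inner_rightSlice, inner_rightSlice, inner_rightSlice,
            add_apply]
      map_smul' := fun c ω => by
        ext1 ζ
        exact ext_inner_left ℂ fun θ => by
          rw [smul_apply, inner_smul_right, inner_rightSlice, inner_rightSlice,
            RingHom.id_apply, smul_apply, smul_eq_mul] }
    ‖T‖ (fun ω => by
      refine opNorm_le_of_inner _ (by positivity) fun θ ζ => ?_
      simp only [LinearMap.coe_mk, AddHom.coe_mk]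
      rw [inner_rightSlice]
      calc ‖ω (vecSlice T ζ θ)‖ ≤ ‖ω‖ * (‖T‖ * ‖θ‖ * ‖ζ‖) :=
            (ω.le_opNorm _).trans (by gcongr; exact norm_vecSlice_le T ζ θ)
        _ = _ := by ring)

theorem continuous_slice_left {α : Type*} [MeasureSpace α] [SigmaFinite (volume : Measure α)]
    (T : L2 (α × α) →L[ℂ] L2 (α × α)) (η : L2 α) :
    Continuous fun ξ : L2 α => rightSlice (vecFunctional ξ η) T :=
  (rightSliceL T).continuous.comp
    (continuous_const.clm_comp (ContinuousLinearMap.apply ℂ (L2 α)).continuous)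

theorem continuous_slice_right {α : Type*} [MeasureSpace α] [SigmaFinite (volume : Measure α)]
    (T : L2 (α × α) →L[ℂ] L2 (α × α)) (ξ : L2 α) :
    Continuous fun η : L2 α => rightSlice (vecFunctional ξ η) T :=
  (rightSliceL T).continuous.comp ((innerSL ℂ).continuous.clm_comp continuous_const)

theorem CC.dense : Dense {ξ : L2 (X n) | ∃ F, ∃ h : CC F, ξ = h.toL2} := by
  rw [Metric.dense_iff]
  intro ξ ε hε
  obtain ⟨g, hs, hg, hc, hm⟩ := (Lp.memLp ξ).exists_hasCompactSupport_eLpNorm_sub_le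
    (by simp) (ε := ENNReal.ofReal (ε / 2)) (by simpa using hε)
  have hcc : CC g := CC.of_hasCompactSupport hc hs
  refine ⟨hcc.toL2, ?_, g, hcc, rfl⟩
  rw [Metric.mem_ball, dist_comm, Lp.dist_def, eLpNorm_congr_ae
    (show (⇑ξ - ⇑hcc.toL2 : X n → ℂ) =ᵐ[volume] ⇑ξ - g from
      (ae_eq_refl _).sub hcc.memLp.coeFn_toLp)]
  exact (ENNReal.toReal_mono ENNReal.ofReal_ne_top hg).trans_lt (by
    rw [ENNReal.toReal_ofReal (by positivity)]; exact half_lt_self hε)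

theorem isRho_zero : IsRho lam (fun _ : X n => 0) 0 := fun θ ζ => by
  simp only [WIntAt, mulOp_zero, zero_mul, zero_apply, inner_zero_right, integral_zero, and_true]
  exact integrable_zero _ _ _

/-- The space of the operators given by continuous kernels with bounded support. -/
def rhoSub (n : ℕ) (lam : ℝ) : Submodule ℂ (L2 (X n) →L[ℂ] L2 (X n)) where
  carrier := {A | ∃ F, CC F ∧ IsRho lam F A}
  add_mem' := by
    rintro A B ⟨F, hF, hA⟩ ⟨G, hG, hB⟩
    exact ⟨_, hF.add hG, hA.add hB hF.bm hG.bm⟩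
  zero_mem' := ⟨_, ⟨continuous_const, 0, by simp⟩, isRho_zero⟩
  smul_mem' := by
    rintro c A ⟨F, hF, hA⟩
    exact ⟨_, hF.mul_left continuous_const, hA.smul hF.bm c⟩

theorem star_mem_rhoSub {A : L2 (X n) →L[ℂ] L2 (X n)} (hA : A ∈ rhoSub n lam) :
    star A ∈ rhoSub n lam := by
  obtain ⟨F, hF, hA⟩ := hA
  exact ⟨_, hF.adjoint, hA.star hF.bm⟩

/-- The cutoff in the shift parameter is needed for bounded support in `(t, p)` jointly, as
`CC.eventually` requires. -/
theorem CC.comp_shift {F : X n → ℂ} (hF : CC F) {κ : ℝ → ℂ} (hκ : CC κ) :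
    CC (fun z : ℝ × X n => κ z.1 * F (shift lam z.2 z.1)) := by
  obtain ⟨R, hR⟩ := hF.supp
  obtain ⟨S, hS⟩ := hκ.supp
  have hc := hF.cont
  have hc' := hκ.cont
  refine ⟨by unfold shift; fun_prop, max S (max (Real.exp (|lam| * S) * R) (R + S)),
    fun z hz => ?_⟩
  have h1 := hS _ (left_ne_zero_of_mul hz)
  have h2 := hR _ (right_ne_zero_of_mul hz)
  simp only [shift, Prod.norm_def, max_le_iff, Real.norm_eq_abs] at h1 h2 ⊢
  have h3 : |z.2.2.2| ≤ R + S := by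
    calc |z.2.2.2| = |(z.2.2.2 - z.1) + z.1| := by rw [sub_add_cancel]
      _ ≤ _ := (abs_add_le _ _).trans (add_le_add h2.2.2 h1)
  exact ⟨h1.trans (le_max_left _ _),
    (norm_le_of_norm_exp_smul_le h1 h2.1).trans ((le_max_left _ _).trans (le_max_right _ _)),
    (norm_le_of_norm_exp_smul_le h1 h2.2.1).trans ((le_max_left _ _).trans (le_max_right _ _)),
    h3.trans ((le_max_right _ _).trans (le_max_right _ _))⟩

theorem CC.comp_shift_left {F : X n → ℂ} (hF : CC F) (t : ℝ) :
    CC (fun p => F (shift lam p t)) := by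
  obtain ⟨κ, hκ, hκ1, -⟩ := exists_cc_one (E := ℝ) (abs_nonneg t)
  have h := hF.comp_shift (lam := lam) hκ
  obtain ⟨R, hR⟩ := h.supp
  have hc := hF.cont
  refine ⟨by unfold shift; fun_prop, R, fun p hp => ?_⟩
  exact (le_max_right _ _).trans (hR (t, p) (by simpa [hκ1 t le_rfl] using hp))

theorem lamOp_mul_mem_rhoSub {A : L2 (X n) →L[ℂ] L2 (X n)} (hA : A ∈ rhoSub n lam) (t : ℝ) :
    lamOp n lam t * A ∈ rhoSub n lam := by
  obtain ⟨F, hF, hA⟩ := hA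
  exact ⟨_, hF.comp_shift_left t, hA.lamOp_mul hF.bm t⟩

theorem mulOp_mul_mem_rhoSub {A : L2 (X n) →L[ℂ] L2 (X n)} (hA : A ∈ rhoSub n lam)
    {φ : V n × V n → ℂ} (hφ : CC φ) :
    mulOp (fun p : X n => φ (p.1, p.2.1)) * A ∈ rhoSub n lam := by
  obtain ⟨F, hF, hA⟩ := hA
  have hc := hφ.cont
  exact ⟨_, hF.mul_left (by fun_prop), hA.mulOp_mul hF.bm hφ.bm⟩

/-- Norm continuity comes from `A`, not from the group: near `t = 0` the kernel of `λ_t A` is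
uniformly close to that of `A`. The group law and `‖λ_t‖ ≤ 1` carry this to every other `t`. -/
theorem continuous_lamOp_mul {A : L2 (X n) →L[ℂ] L2 (X n)} (hA : A ∈ rhoSub n lam) :
    Continuous fun t => lamOp n lam t * A := by
  obtain ⟨F, hF, hA⟩ := hA
  obtain ⟨R, hR0, hR⟩ := hF.exists_radius
  obtain ⟨κ, hκ, hκ1, -⟩ := exists_cc_one (E := ℝ) zero_le_one
  have key : ∀ ε > 0, ∀ᶠ t in 𝓝 (0 : ℝ), ‖lamOp n lam t * A - A‖ < ε := by
    intro ε hε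
    have hε' : 0 < ε / (2 * (R + 1) + 1) := by positivity
    have h1 := (hF.comp_shift (lam := lam) hκ).eventually 0 hε'
    have h2 : ∀ᶠ t in 𝓝 (0 : ℝ), |t| ≤ 1 := by
      filter_upwards [Metric.closedBall_mem_nhds (0 : ℝ) one_pos] with t ht
      simpa using ht
    filter_upwards [h1, h2] with t ht ht1
    -- Shifting by `|t| ≤ 1` enlarges the support in `r` by at most one, hence the radius `R + 1`.
    refine ((hA.lamOp_mul hF.bm t).norm_sub_le hA (hF.comp_shift_left t).bm hF.bm
      (R := R + 1) (by positivity) hε'.le (fun p => ?_) (fun p hp => hR _ ?_)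
      (fun p hp => hR p (by linarith))).trans_lt ?_
    · simpa [hκ1 t ht1, hκ1 0 (by simp), shift_zero] using ht p
    · have := abs_sub_abs_le_abs_sub p.2.2 t
      simp only [shift]
      linarith
    · rw [← mul_div_assoc, div_lt_iff₀ (by positivity)]
      nlinarith
  rw [continuous_iff_continuousAt]
  intro t₀
  rw [ContinuousAt, Metric.tendsto_nhds]
  intro ε hε
  have h3 : Tendsto (fun t => t - t₀) (𝓝 t₀) (𝓝 0) := by
    have : Continuous fun t : ℝ => t - t₀ := by fun_prop
    simpa using this.tendsto t₀
  filter_upwards [h3.eventually (key ε hε)] with t ht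
  have h4 : lamOp n lam t * A - lamOp n lam t₀ * A
      = lamOp n lam t₀ * (lamOp n lam (t - t₀) * A - A) := by
    rw [mul_sub, ← mul_assoc, lamOp_mul_lamOp, add_sub_cancel]
  rw [dist_eq_norm, h4]
  refine (norm_mul_le _ _).trans_lt (lt_of_le_of_lt ?_ ht)
  exact mul_le_of_le_one_left (norm_nonneg _) (norm_lamOp_le lam t₀)

/-- No twisted convolution is computed: `A B` is the integral of `M_{F(·,·,t)} λ_t B`, a norm
continuous compactly supported function of `t` whose values lie in `rhoSub`. -/
theorem mul_mem_closure_rhoSub {A B : L2 (X n) →L[ℂ] L2 (X n)} (hA : A ∈ rhoSub n lam)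
    (hB : B ∈ rhoSub n lam) : A * B ∈ (rhoSub n lam).topologicalClosure := by
  obtain ⟨F, hF, hA⟩ := hA
  obtain ⟨R, hR0, hR⟩ := hF.exists_radius
  have hc := hF.cont
  have hG : CC fun z : ℝ × (V n × V n) => F (z.2.1, z.2.2, z.1) := by
    obtain ⟨S, hS⟩ := hF.supp
    refine ⟨by fun_prop, S, fun z hz => ?_⟩
    have h1 := hS _ hz
    simp only [Prod.norm_def, max_le_iff] at h1 ⊢
    tauto
  have hcont : Continuous fun t => mulOp (fun p : X n => F (p.1, p.2.1, t)) *
      (lamOp n lam t * B) :=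
    (hG.continuous_mulOp (π := fun p : X n => (p.1, p.2.1)) (by fun_prop)).mul
      (continuous_lamOp_mul hB)
  refine WInt.mem_of_continuous (R := R) (WInt.congr (WInt.mul_right hA B)
    fun t => mul_assoc _ _ _) hcont (fun t ht => ?_)
    (Submodule.isClosed_topologicalClosure _) fun t => ?_
  · have : (fun p : X n => F (p.1, p.2.1, t)) = fun _ => 0 := funext fun p =>
      hR (p.1, p.2.1, t) ht
    simp only [this, mulOp_zero, zero_mul]
  · refine Submodule.le_topologicalClosure _ (mulOp_mul_mem_rhoSub (lamOp_mul_mem_rhoSub hB t)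
      (φ := fun q => F (q.1, q.2, t)) ⟨by fun_prop, ?_⟩)
    obtain ⟨S, hS⟩ := hG.supp
    exact ⟨S, fun q hq => (le_max_right _ _).trans (hS (t, q) hq)⟩

/-- The closure of the space of operators given by continuous kernels with bounded support. -/
def rhoAlg (n : ℕ) (lam : ℝ) : NonUnitalStarSubalgebra ℂ (L2 (X n) →L[ℂ] L2 (X n)) :=
  { (rhoSub n lam).topologicalClosure with
    mul_mem' := fun {A B} hA hB => by
      have h := map_mem_closure₂ (f := fun A B : L2 (X n) →L[ℂ] L2 (X n) => A * B) continuous_mul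
        hA hB (u := (rhoSub n lam).topologicalClosure)
        fun A hA B hB => mul_mem_closure_rhoSub hA hB
      rwa [(Submodule.isClosed_topologicalClosure _).closure_eq] at h
    star_mem' := fun {A} hA =>
      map_mem_closure (f := fun A : L2 (X n) →L[ℂ] L2 (X n) => star A) continuous_star hA
        fun A hA => star_mem_rhoSub hA }

theorem mem_of_dense {Y Z : Type*} [TopologicalSpace Y] [TopologicalSpace Z] {D : Set Y}
    (hD : Dense D) {f : Y → Z} (hf : Continuous f) {S : Set Z} (hS : IsClosed S)
    (h : ∀ y ∈ D, f y ∈ S) (y : Y) : f y ∈ S :=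
  closure_minimal (fun y hy => h y hy : D ⊆ f ⁻¹' S) (hS.preimage hf) (hD y)

theorem slice_mem_closure_rhoSub (ξ η : L2 (X n)) :
    rightSlice (vecFunctional ξ η) (UOp n lam) ∈ (rhoSub n lam).topologicalClosure := by
  have hcl := Submodule.isClosed_topologicalClosure (rhoSub n lam)
  refine mem_of_dense CC.dense (continuous_slice_left _ η) hcl ?_ ξ
  rintro _ ⟨F, hF, rfl⟩
  refine mem_of_dense CC.dense (continuous_slice_right _ _) hcl ?_ η
  rintro _ ⟨G, hG, rfl⟩
  exact Submodule.le_topologicalClosure _ ⟨_, cc_sliceKernel hF hG, isRho_slice hF hG⟩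

/-- Slices depend continuously and linearly on the functional, so vector functionals of continuous
compactly supported vectors suffice for one inclusion; `IsRho.mem_AHat` is the other. -/
theorem AHat_eq_rhoAlg : AHat n lam = rhoAlg n lam := by
  have hcl := Submodule.isClosed_topologicalClosure (rhoSub n lam)
  refine le_antisymm ?_ fun A hA => ?_
  · refine NonUnitalStarSubalgebra.topologicalClosure_minimal _ (NonUnitalStarAlgebra.adjoin_le ?_)
      hcl
    rintro _ ⟨ω, hω, rfl⟩
    have h : ω ∈ ((rhoSub n lam).topologicalClosure.comap
        (rightSliceL (UOp n lam)).toLinearMap) := by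
      refine Submodule.topologicalClosure_minimal _ (Submodule.span_le.2 ?_)
        (hcl.preimage (rightSliceL (UOp n lam)).continuous) hω
      rintro _ ⟨ξ, η, rfl⟩
      exact slice_mem_closure_rhoSub ξ η
    exact h
  · refine closure_minimal ?_ isClosed_AHat hA
    rintro A ⟨F, hF, hA⟩
    exact hA.mem_AHat hF

theorem rhoSub_le_AHat {A : L2 (X n) →L[ℂ] L2 (X n)} (hA : A ∈ rhoSub n lam) :
    A ∈ AHat n lam := by
  obtain ⟨F, hF, hA⟩ := hA
  exact hA.mem_AHat hF

theorem mem_AHat_iff {A : L2 (X n) →L[ℂ] L2 (X n)} :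
    A ∈ AHat n lam ↔ A ∈ closure (rhoSub n lam : Set (L2 (X n) →L[ℂ] L2 (X n))) := by
  rw [AHat_eq_rhoAlg]
  exact Iff.rfl

theorem exists_scaled {R ε : ℝ} (hR : 0 ≤ R) (hε : 0 < ε) :
    ∃ ε' : ℝ, 0 < ε' ∧ 2 * R * ε' < ε := by
  refine ⟨ε / (2 * R + 1), by positivity, ?_⟩
  rw [← mul_div_assoc, div_lt_iff₀ (by positivity)]
  nlinarith

/-- A smooth uniform approximation of the kernel, multiplied by a bump equal to one on the support,
is a Schwartz function with the same control on the support in `r`. -/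
theorem rhoSub_subset_closure_rho {A : L2 (X n) →L[ℂ] L2 (X n)} (hA : A ∈ rhoSub n lam) :
    A ∈ closure (Set.range fun f : FunAlg n => rho lam f) := by
  obtain ⟨F, hF, hA⟩ := hA
  obtain ⟨R, hR⟩ := hF.supp
  have hR' : ∀ p, F p ≠ 0 → ‖p‖ ≤ max R 0 := fun p hp => (hR p hp).trans (le_max_left _ _)
  set S := max R 0 with hS
  have hS0 : 0 ≤ S := le_max_right _ _
  rw [Metric.mem_closure_iff]
  intro ε hε
  obtain ⟨ε', hε', hεε⟩ := exists_scaled (R := S + 2) (by positivity) hε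
  obtain ⟨g, hg, hgF⟩ := (hF.hasCompactSupport.uniformContinuous_of_continuous
    hF.cont).exists_contDiff_dist_le hε'
  let φ : ContDiffBump (0 : X n) := ⟨S + 1, S + 2, by positivity, by linarith⟩
  have hφF : ∀ p, (φ p : ℂ) * F p = F p := fun p => by
    by_cases hp : F p = 0
    · simp [hp]
    · have : φ p = 1 := φ.one_of_mem_closedBall
        (mem_closedBall_zero_iff.2 ((hR' p hp).trans (by change S ≤ S + 1; linarith)))
      rw [this, Complex.ofReal_one, one_mul]
  have hφ0 : ∀ p : X n, S + 2 < |p.2.2| → φ p = 0 := fun p hp => by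
    refine φ.zero_of_le_dist ?_
    rw [dist_zero_right]
    exact hp.le.trans ((le_max_right _ _).trans (le_max_right _ _))
  have hcs : HasCompactSupport fun p => (φ p : ℂ) * g p :=
    (φ.hasCompactSupport.comp_left (g := Complex.ofReal) rfl).mul_right
  let f : FunAlg n := ⟨hcs.toSchwartzMap ((Complex.ofRealCLM.contDiff.comp φ.contDiff).mul hg),
    Metric.closedBall 0 (S + 2), isCompact_closedBall _ _, fun p hp => by
      change (φ p : ℂ) * g p = 0
      rw [hφ0 p (by simpa using hp), Complex.ofReal_zero, zero_mul]⟩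
  have hf : ∀ p, f.1 p = (φ p : ℂ) * g p := fun p => rfl
  refine ⟨_, ⟨f, rfl⟩, ?_⟩
  rw [dist_eq_norm]
  refine (hA.norm_sub_le (isRho_rho f) hF.bm (FunAlg.bm f) (by positivity) hε'.le (fun p => ?_)
    (fun p hp => ?_) fun p hp => ?_).trans_lt hεε
  · rw [hf, ← hφF p, ← mul_sub, norm_mul, Complex.norm_real, Real.norm_of_nonneg φ.nonneg,
      ← dist_eq_norm, dist_comm]
    exact (mul_le_of_le_one_left dist_nonneg φ.le_one).trans (hgF p).le
  · rw [← hφF, hφ0 p hp, Complex.ofReal_zero, zero_mul]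
  · rw [hf, hφ0 p hp, Complex.ofReal_zero, zero_mul]

theorem rho_mem_AHat (f : FunAlg n) : rho lam f ∈ AHat n lam := by
  obtain ⟨R, hR0, hR⟩ := FunAlg.exists_radius f
  obtain ⟨C, hC0, hC⟩ : ∃ C, 0 < C ∧ ∀ p, ‖p‖ * ‖f.1 p‖ ≤ C := by
    obtain ⟨C, hC, h⟩ := f.1.decay 1 0
    exact ⟨C, hC, fun p => by simpa using h p⟩
  rw [← SetLike.mem_coe, ← isClosed_AHat.closure_eq, Metric.mem_closure_iff]
  intro ε hε
  obtain ⟨ε', hε', hεε⟩ := exists_scaled hR0 hε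
  -- Beyond this radius the decay `‖p‖ ‖f p‖ ≤ C` forces `‖f p‖ ≤ ε'/2`, and cutting off changes `f`
  -- by at most twice that.
  obtain ⟨χ, hχ, hχ1, hχb⟩ := exists_cc_one (E := V n × V n) (R := 2 * C / ε') (by positivity)
  have hχc := hχ.cont
  have hcc : CC fun p : X n => χ (p.1, p.2.1) * f.1 p := by
    have := f.1.continuous
    obtain ⟨S, hS⟩ := hχ.supp
    refine ⟨by fun_prop, max S R, fun p hp => ?_⟩
    have h1 := hS _ (left_ne_zero_of_mul hp)
    have h2 : |p.2.2| ≤ R := by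
      by_contra hn
      exact right_ne_zero_of_mul hp (hR p (not_le.1 hn))
    simp only [Prod.norm_def, max_le_iff, Real.norm_eq_abs] at h1 ⊢
    exact ⟨h1.1.trans (le_max_left _ _), h1.2.trans (le_max_left _ _), h2.trans (le_max_right _ _)⟩
  have hr := (isRho_rho (lam := lam) f).mulOp_mul (FunAlg.bm f) hχ.bm
  refine ⟨_, hr.mem_AHat hcc, ?_⟩
  rw [dist_eq_norm]
  refine ((isRho_rho f).norm_sub_le hr (FunAlg.bm f) hcc.bm hR0 hε'.le (fun p => ?_) hR
    fun p hp => by rw [hR p hp, mul_zero]).trans_lt hεε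
  by_cases hp : ‖(p.1, p.2.1)‖ ≤ 2 * C / ε'
  · rw [hχ1 _ hp, one_mul, sub_self, norm_zero]
    exact hε'.le
  · have h1 : ‖(p.1, p.2.1)‖ ≤ ‖p‖ := by
      simp only [Prod.norm_def]
      exact max_le_max le_rfl (le_max_left _ _)
    have h2 : 2 * C / ε' < ‖p‖ := (not_le.1 hp).trans_le h1
    have h3 : ‖f.1 p‖ ≤ ε' / 2 := by
      have h4 := hC p
      rw [div_lt_iff₀ hε'] at h2
      by_contra! hn
      nlinarith [norm_nonneg p, norm_nonneg (f.1 p)]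
    calc ‖f.1 p - χ (p.1, p.2.1) * f.1 p‖ ≤ ‖f.1 p‖ + ‖χ (p.1, p.2.1) * f.1 p‖ := norm_sub_le _ _
      _ ≤ ‖f.1 p‖ + ‖f.1 p‖ := by
        rw [norm_mul]
        gcongr
        exact mul_le_of_le_one_left (norm_nonneg _) (hχb _)
      _ ≤ ε' := by linarith

theorem AHat_subset_closure_rho {A : L2 (X n) →L[ℂ] L2 (X n)} (hA : A ∈ AHat n lam) :
    A ∈ closure (Set.range fun f : FunAlg n => rho lam f) :=
  closure_minimal (fun _ h => rhoSub_subset_closure_rho h) isClosed_closure (mem_AHat_iff.1 hA)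

end AHatStructure

open scoped ContDiff

/-! ### The antipode formula preserves the function algebra. -/

section Antipode

variable {n : ℕ} (lam : ℝ)

theorem hasTemperateGrowth_eBar : eBar.HasTemperateGrowth := by
  have e : ∀ k : ℕ, iteratedDeriv k eBar = fun t => (-(2 * Real.pi * Complex.I)) ^ k * eBar t := by
    intro k
    induction k with
    | zero => simp
    | succ k ih =>
      rw [iteratedDeriv_succ, ih]
      funext t
      have h1 : HasDerivAt (fun t : ℝ => -(2 * Real.pi * t * Complex.I))
          (-(2 * Real.pi * Complex.I)) t := by
        have := (((Complex.ofRealCLM.hasDerivAt (x := t)).const_mul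
          (2 * Real.pi : ℂ)).mul_const Complex.I).neg
        simp only [Complex.ofRealCLM_apply, Complex.ofReal_one, mul_one] at this
        exact this
      have h2 := (h1.cexp.const_mul ((-(2 * Real.pi * Complex.I)) ^ k)).deriv
      change deriv (fun t => (-(2 * Real.pi * Complex.I)) ^ k * Complex.exp _) t = _
      rw [h2, eBar]
      ring
  refine ⟨?_, fun k => ⟨0, ‖(-(2 * Real.pi * Complex.I)) ^ k‖, fun t => ?_⟩⟩
  · have h := Complex.ofRealCLM.contDiff (n := ∞)
    exact ((((contDiff_const (c := (2 * Real.pi : ℂ))).mul h).mul contDiff_const).neg).cexp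
  · rw [norm_iteratedFDeriv_eq_norm_iteratedDeriv, e, norm_mul, norm_eBar]
    simp

theorem contDiff_eta : ContDiff ℝ ∞ (eta lam) := by
  unfold eta
  split_ifs <;> fun_prop

/-- The functions `e^{λr}` and `η(r)` need not grow temperately, but they only matter for `r` in the
support of `f`, where they can be replaced by cut off versions. -/
theorem exists_temperate_cutoff {φ : ℝ → ℝ} (hφ : ContDiff ℝ ∞ φ) {R : ℝ} (hR : 0 ≤ R) :
    ∃ ψ : ℝ → ℝ, ψ.HasTemperateGrowth ∧ (∀ r, |r| ≤ R → ψ r = φ r) ∧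
      ∀ r, ∃ c ∈ Set.Icc (0 : ℝ) 1, ψ r = c * φ r ∧ (R + 1 < |r| → c = 0) := by
  let χ : ContDiffBump (0 : ℝ) := ⟨R + 1 / 2, R + 1, by positivity, by linarith⟩
  refine ⟨fun r => χ r * φ r, ?_, fun r hr => ?_, fun r => ⟨χ r, ⟨χ.nonneg, χ.le_one⟩, rfl, ?_⟩⟩
  · exact HasCompactSupport.hasTemperateGrowth χ.hasCompactSupport.mul_right
      (χ.contDiff.mul hφ)
  · change χ r * φ r = φ r
    rw [χ.one_of_mem_closedBall, one_mul]
    rw [mem_closedBall_zero_iff, Real.norm_eq_abs]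
    change |r| ≤ R + 1 / 2
    linarith
  · intro hr
    refine χ.zero_of_le_dist ?_
    rw [dist_zero_right, Real.norm_eq_abs]
    exact hr.le

theorem exists_temperate_exp {R : ℝ} (hR : 0 ≤ R) : ∃ a : ℝ → ℝ, a.HasTemperateGrowth ∧
    (∀ r, |r| ≤ R → a r = Real.exp (lam * r)) ∧ ∃ δ > 0, ∀ r, δ ≤ a r := by
  -- Cutting off `e^{λr} - 1` instead of `e^{λr}` makes `1 + ψ` a convex combination of `1` and
  -- `e^{λr}`, which stays bounded away from zero.
  obtain ⟨ψ, hψ, hψ1, hψ2⟩ := exists_temperate_cutoff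
    (φ := fun r => Real.exp (lam * r) - 1) (by fun_prop) hR
  refine ⟨fun r => 1 + ψ r, by fun_prop, fun r hr => by simp only [hψ1 r hr]; ring,
    Real.exp (-(|lam| * (R + 1))), Real.exp_pos _, fun r => ?_⟩
  have h1 : Real.exp (-(|lam| * (R + 1))) ≤ 1 := by
    rw [Real.exp_le_one_iff]; have := abs_nonneg lam; nlinarith
  obtain ⟨c, ⟨hc0, hc1⟩, hc, hc2⟩ := hψ2 r
  simp only [hc]
  rcases lt_or_ge (R + 1) |r| with hr | hr
  · rw [hc2 hr]; simpa using h1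
  · have h2 : Real.exp (-(|lam| * (R + 1))) ≤ Real.exp (lam * r) := by
      rw [Real.exp_le_exp]
      have h3 := neg_abs_le (lam * r)
      rw [abs_mul] at h3
      have h4 := mul_le_mul_of_nonneg_left hr (abs_nonneg lam)
      linarith
    nlinarith

theorem hasTemperateGrowth_dilation {a : ℝ → ℝ} (ha : a.HasTemperateGrowth) :
    (fun p : X n => ((-(a p.2.2 • p.1), -(a p.2.2 • p.2.1), -p.2.2) : X n)).HasTemperateGrowth := by
  let P₁ : X n →L[ℝ] V n := ContinuousLinearMap.fst ℝ _ _
  let P₂ : X n →L[ℝ] V n := (ContinuousLinearMap.fst ℝ _ _).comp (ContinuousLinearMap.snd ℝ _ _)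
  let P₃ : X n →L[ℝ] ℝ := (ContinuousLinearMap.snd ℝ _ _).comp (ContinuousLinearMap.snd ℝ _ _)
  let I₁ : V n →L[ℝ] X n := ContinuousLinearMap.inl ℝ _ _
  let I₂ : V n →L[ℝ] X n := (ContinuousLinearMap.inr ℝ _ _).comp (ContinuousLinearMap.inl ℝ _ _)
  let I₃ : ℝ →L[ℝ] X n := (ContinuousLinearMap.inr ℝ _ _).comp (ContinuousLinearMap.inr ℝ _ _)
  have h3 := P₃.hasTemperateGrowth
  have h := ha.comp h3
  have h' := ((h.smul (I₁.comp P₁).hasTemperateGrowth).add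
    ((h.smul (I₂.comp P₂).hasTemperateGrowth).add (I₃.comp P₃).hasTemperateGrowth)).neg
  convert h' using 1
  funext p
  simp [P₁, P₂, P₃, I₁, I₂, I₃]

/-- The properness condition under which composition with the dilation preserves Schwartz functions;
it is what the lower bound `δ` is for. -/
theorem norm_le_dilation {a : ℝ → ℝ} {δ : ℝ} (hδ : 0 < δ) (ha : ∀ r, δ ≤ a r) (p : X n) :
    ‖p‖ ≤ (1 + δ⁻¹) * (1 + ‖((-(a p.2.2 • p.1), -(a p.2.2 • p.2.1), -p.2.2) : X n)‖) ^ 1 := by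
  set q : X n := (-(a p.2.2 • p.1), -(a p.2.2 • p.2.1), -p.2.2) with hq
  have h1 : ∀ x : V n, ‖x‖ ≤ δ⁻¹ * ‖-(a p.2.2 • x)‖ := fun x => by
    rw [norm_neg, norm_smul, Real.norm_eq_abs, ← mul_assoc]
    refine le_mul_of_one_le_left (norm_nonneg _) ?_
    rw [inv_mul_eq_div, one_le_div hδ]
    exact (ha _).trans (le_abs_self _)
  have hq1 : ‖q.1‖ ≤ ‖q‖ := norm_fst_le _
  have hq2 : ‖q.2.1‖ ≤ ‖q‖ := (norm_fst_le _).trans (norm_snd_le _)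
  have hq3 : ‖q.2.2‖ ≤ ‖q‖ := (norm_snd_le _).trans (norm_snd_le _)
  have hi : 0 < δ⁻¹ := inv_pos.2 hδ
  have h0 := norm_nonneg q
  have e : δ⁻¹ * ‖q‖ ≤ (1 + δ⁻¹) * (1 + ‖q‖) := by nlinarith
  rw [pow_one]
  refine norm_prod_le_iff.2 ⟨?_, norm_prod_le_iff.2 ⟨?_, ?_⟩⟩
  · exact ((h1 _).trans (mul_le_mul_of_nonneg_left hq1 hi.le)).trans e
  · exact ((h1 _).trans (mul_le_mul_of_nonneg_left hq2 hi.le)).trans e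
  · have : ‖p.2.2‖ = ‖q.2.2‖ := (norm_neg _).symm
    rw [this]
    nlinarith

theorem exists_antipodeFun (f : FunAlg n) :
    ∃ g : FunAlg n, ∀ p, g.1 p = antipodeFun lam f.1 p := by
  obtain ⟨R, hR0, hR⟩ := FunAlg.exists_radius f
  obtain ⟨a, ha, ha1, δ, hδ, haδ⟩ := exists_temperate_exp lam hR0
  obtain ⟨θ, hθ, hθ1, -⟩ := exists_temperate_cutoff (contDiff_eta lam) hR0
  have hD := hasTemperateGrowth_dilation (n := n) ha
  have hm : (fun p : X n => eBar (θ p.2.2 * ⟪p.1, p.2.1⟫_ℝ)).HasTemperateGrowth := by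
    have h3 := ((ContinuousLinearMap.snd ℝ (V n) ℝ).comp
      (ContinuousLinearMap.snd ℝ (V n) (V n × ℝ))).hasTemperateGrowth
    have h2 := ((ContinuousLinearMap.fst ℝ (V n) ℝ).comp
      (ContinuousLinearMap.snd ℝ (V n) (V n × ℝ))).hasTemperateGrowth
    have h1 := (ContinuousLinearMap.fst ℝ (V n) (V n × ℝ)).hasTemperateGrowth
    exact hasTemperateGrowth_eBar.comp ((hθ.comp h3).mul
      ((innerSL ℝ).bilinear_hasTemperateGrowth h1 h2))
  set g : 𝓢(X n, ℂ) := SchwartzMap.smulLeftCLM ℂ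
    (fun p : X n => eBar (θ p.2.2 * ⟪p.1, p.2.1⟫_ℝ))
    (SchwartzMap.compCLM ℂ hD ⟨1, _, norm_le_dilation hδ haδ⟩ f.1) with hg
  have h1 : ∀ p, g p = eBar (θ p.2.2 * ⟪p.1, p.2.1⟫_ℝ) *
      f.1 (-(a p.2.2 • p.1), -(a p.2.2 • p.2.1), -p.2.2) := fun p => by
    rw [hg, SchwartzMap.smulLeftCLM_apply_apply hm]
    rfl
  have h2 : ∀ p, g p = antipodeFun lam f.1 p := fun p => by
    rw [h1, antipodeFun]
    rcases lt_or_ge R |p.2.2| with hr | hr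
    · rw [hR _ (by simpa using hr), hR _ (by simpa using hr), mul_zero, mul_zero]
    · rw [ha1 _ hr, hθ1 _ hr]
  refine ⟨⟨g, Set.Icc (-R) R, isCompact_Icc, fun p hp => ?_⟩, h2⟩
  have hr : R < |p.2.2| := by
    by_contra hn
    exact hp (abs_le.1 (not_lt.1 hn))
  rw [h1, hR _ (by simpa using hr), mul_zero]

end Antipode

/-! ### Conjugation by `J`. -/

section Modular

variable {α : Type*} [MeasureSpace α]

/-- The antiunitary operator `K` is the weighted composition `ξ ↦ m · conj (ξ ∘ N)`. -/
def IsCWC (K : L2 α ≃ₗᵢ⋆[ℂ] L2 α) (N : α → α) (m : α → ℂ) : Prop :=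
  Measure.QuasiMeasurePreserving N (volume : Measure α) volume ∧
    ∀ ξ : L2 α, ∀ᵐ p, K ξ p = m p * conj (ξ (N p))

theorem IsCWC.conjBy {K : L2 α ≃ₗᵢ⋆[ℂ] L2 α} {N Φ : α → α} {m w : α → ℂ} (hK : IsCWC K N m)
    {A : L2 α →L[ℂ] L2 α} (hA : IsWC A Φ w) : IsWC (QHeis.conjBy K A) (fun p => N (Φ (N p)))
      (fun p => m p * (conj (w (N p)) * conj (m (Φ (N p))))) := by
  refine ⟨hK.1.comp (hA.1.comp hK.1), fun ξ => ?_⟩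
  filter_upwards [hK.2 (A (K ξ)), hK.1.ae (hA.2 (K ξ)), hK.1.ae (hA.1.ae (hK.2 ξ))] with p h1 h2 h3
  rw [conjBy_apply, h1, h2, h3]
  simp only [map_mul, Complex.conj_conj]
  ring

theorem IsCWC.apply_apply {K : L2 α ≃ₗᵢ⋆[ℂ] L2 α} {N : α → α} {m : α → ℂ} (hK : IsCWC K N m)
    (hN : ∀ p, N (N p) = p) (hm : ∀ p, m p * conj (m (N p)) = 1) (ξ : L2 α) : K (K ξ) = ξ := by
  ext1
  filter_upwards [hK.2 (K ξ), hK.1.ae (hK.2 ξ)] with p h1 h2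
  rw [h1, h2, map_mul, Complex.conj_conj, hN, ← mul_assoc, hm, one_mul]

theorem eBar_mul_conj (t : ℝ) : eBar t * conj (eBar t) = 1 := by
  rw [Complex.mul_conj, Complex.normSq_eq_norm_sq, norm_eBar]
  simp

theorem eBar_add (s t : ℝ) : eBar (s + t) = eBar s * eBar t := by
  rw [eBar, eBar, eBar, ← Complex.exp_add]
  congr 1
  push_cast
  ring

theorem conj_eBar (t : ℝ) : conj (eBar t) = eBar (-t) := by
  rw [eBar, eBar, ← Complex.exp_conj]
  congr 1
  simp only [map_neg, map_mul, map_ofNat, Complex.conj_ofReal, Complex.conj_I, Complex.ofReal_neg]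
  ring

theorem ee_eq_eBar (t : ℝ) : ee t = eBar (-t) := by
  rw [eBar, ee]
  congr 1
  push_cast
  ring

/-- The cocycle identity behind both `J` and `U_A`: the factor `e^{2λt}` is what `β` picks up when
both arguments are dilated by `e^{λt}`. -/
theorem eta_sub (lam r t : ℝ) :
    eta lam r - Real.exp (lam * t) ^ 2 * eta lam (r - t) = eta lam t := by
  unfold eta
  split_ifs with h
  · simp [h]
  · have e : Real.exp (2 * lam * r) = Real.exp (lam * t) ^ 2 * Real.exp (2 * lam * (r - t)) := by
      rw [← Real.exp_nat_mul, ← Real.exp_add]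
      congr 1
      push_cast
      ring
    have e' : Real.exp (2 * lam * t) = Real.exp (lam * t) ^ 2 := by
      rw [← Real.exp_nat_mul]
      congr 1
      push_cast
      ring
    rw [e, e']
    field_simp
    ring

variable {n : ℕ} {lam : ℝ}

/-- The point transformation occurring in `J`. -/
def JMap (p : X n) : X n := (-p.1, -p.2.1, p.2.2)

/-- The multiplier occurring in `J`. -/
def JWeight (lam : ℝ) (p : X n) : ℂ := eBar (eta lam p.2.2 * ⟪p.1, p.2.1⟫_ℝ)

theorem measurePreserving_JMap : MeasurePreserving (JMap (n := n)) volume volume :=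
  (Measure.measurePreserving_neg (volume : Measure (V n))).prod
    ((Measure.measurePreserving_neg (volume : Measure (V n))).prod
      (MeasurePreserving.id (volume : Measure ℝ)))

theorem isCWC_J : IsCWC (J n lam) JMap (JWeight lam) :=
  ⟨measurePreserving_JMap.quasiMeasurePreserving, J_apply n lam⟩

theorem JMap_JMap (p : X n) : JMap (JMap p) = p := by simp [JMap]

theorem JWeight_JMap (p : X n) : JWeight lam (JMap p) = JWeight lam p := by simp [JWeight, JMap]

theorem JWeight_mul_conj (p : X n) : JWeight lam p * conj (JWeight lam p) = 1 := eBar_mul_conj _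

theorem J_J (ξ : L2 (X n)) : J n lam (J n lam ξ) = ξ :=
  isCWC_J.apply_apply JMap_JMap (fun p => by rw [JWeight_JMap, JWeight_mul_conj]) ξ

/-- By `eta_sub` the variable `r` drops out. Hence conjugation by `J` maps `M_φ λ_t`, with `φ` a
function of `(x,y)`, to an operator of the same kind. -/
theorem JWeight_mul_conj_shift (p : X n) (t : ℝ) :
    JWeight lam p * conj (JWeight lam (shift lam p t)) =
      eBar (eta lam t * ⟪p.1, p.2.1⟫_ℝ) := by
  simp only [JWeight, shift, real_inner_smul_left, real_inner_smul_right]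
  rw [conj_eBar, ← eBar_add, ← eta_sub lam p.2.2 t]
  congr 1
  ring

/-- The kernel of `J A J`, where `A` has the kernel `F`. -/
def conjKernel (lam : ℝ) (F : X n → ℂ) (p : X n) : ℂ :=
  JWeight lam p * conj (F (JMap p))

theorem shift_JMap (p : X n) (t : ℝ) : shift lam (JMap p) t = JMap (shift lam p t) := by
  simp [shift, JMap]

theorem conjBy_J_mulOp_mul_lamOp {φ : V n × V n → ℂ} (hφ : BM φ) (t : ℝ) :
    QHeis.conjBy (J n lam) (mulOp (fun p : X n => φ (p.1, p.2.1)) * lamOp n lam t) =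
      mulOp (fun p : X n => eBar (eta lam t * ⟪p.1, p.2.1⟫_ℝ) * conj (φ (-p.1, -p.2.1))) *
        lamOp n lam t := by
  have h1 : BM fun p : X n => φ (p.1, p.2.1) := hφ.comp (by fun_prop)
  have h2 : BM fun p : X n => eBar (eta lam t * ⟪p.1, p.2.1⟫_ℝ) * conj (φ (-p.1, -p.2.1)) :=
    BM.mul ⟨by fun_prop, 1, fun p => (norm_eBar _).le⟩ (hφ.comp (by fun_prop)).conj
  refine (isCWC_J.conjBy ((isWC_mulOp h1).mul (isWC_lamOp lam t))).eq
    ((isWC_mulOp h2).mul (isWC_lamOp lam t)) (fun p => ?_) fun p => ?_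
  · simp only [id_eq, shift_JMap, JMap_JMap]
  · simp only [id_eq, shift_JMap, JWeight_JMap, map_mul, map_pow, Complex.conj_ofReal]
    rw [← JWeight_mul_conj_shift]
    simp only [JMap]
    ring

theorem IsRho.conjBy_J {F : X n → ℂ} {A : L2 (X n) →L[ℂ] L2 (X n)} (hA : IsRho lam F A)
    (hF : BM F) : IsRho lam (conjKernel lam F) (QHeis.conjBy (J n lam) A) :=
  WInt.congr (WInt.conjBy J_J hA) fun t =>
    conjBy_J_mulOp_mul_lamOp (φ := fun q => F (q.1, q.2, t)) (hF.comp (by fun_prop)) t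

theorem CC.conjKernel {F : X n → ℂ} (hF : CC F) : CC (QHeis.conjKernel lam F) := by
  obtain ⟨R, hR⟩ := hF.supp
  have hc := hF.cont
  refine ⟨by unfold QHeis.conjKernel JWeight JMap; fun_prop, R, fun p hp => ?_⟩
  have h1 := hR (JMap p) (by
    have := right_ne_zero_of_mul hp
    simpa using this)
  simpa [JMap, Prod.norm_def] using h1

theorem conjBy_J_mem_AHat {A : L2 (X n) →L[ℂ] L2 (X n)} (hA : A ∈ AHat n lam) :
    conjBy (J n lam) A ∈ AHat n lam := by
  rw [mem_AHat_iff] at hA ⊢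
  refine map_mem_closure (continuous_conjBy _) hA ?_
  rintro A ⟨F, hF, hA⟩
  exact ⟨_, hF.conjKernel, hA.conjBy_J hF.bm⟩

/-- The adjoint contributes the dilation, the reflection of `r` and one complex conjugation; `J`
contributes the phase, the reflection of `(x,y)` and a second conjugation, which cancels the first.
-/
theorem conjBy_J_star_rho {f g : FunAlg n} (h : ∀ p, g.1 p = antipodeFun lam f.1 p) :
    conjBy (J n lam) (star (rho lam f)) = rho lam g := by
  have h1 : BM (fun p : X n => conj (f.1 (Real.exp (lam * p.2.2) • p.1,
      Real.exp (lam * p.2.2) • p.2.1, -p.2.2))) :=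
    (FunAlg.bm f).conj.comp (π := fun p : X n => ((Real.exp (lam * p.2.2) • p.1,
      Real.exp (lam * p.2.2) • p.2.1, -p.2.2) : X n)) (by fun_prop)
  refine WInt.unique (((isRho_rho f).star (FunAlg.bm f)).conjBy_J h1) ((isRho_rho g).congr ?_)
  intro p
  rw [h]
  simp [QHeis.conjKernel, antipodeFun, JWeight, JMap]

end Modular

/-! ### Uniform approximation by sums of products. -/

section Approximation

theorem CC.section_right {E E' : Type*} [NormedAddCommGroup E] [NormedAddCommGroup E']
    {G : E × E' → ℂ} (hG : CC G) (a : E) : CC fun y => G (a, y) := by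
  obtain ⟨R, hR⟩ := hG.supp
  have hc := hG.cont
  exact ⟨by fun_prop, R, fun y hy => (norm_snd_le (a, y)).trans (hR (a, y) hy)⟩

/-- A partition of unity in the first variable, subordinate to sets on which the sections `G (x, ·)`
vary by at most `ε`; the second factors are sections of `G` at the chosen centres. The cutoff `κ` is
absorbed by `G` and confines the problem to a ball. -/
theorem CC.exists_sum_approx {E E' : Type*} [NormedAddCommGroup E] [NormedSpace ℝ E]
    [FiniteDimensional ℝ E] [NormedAddCommGroup E'] [ProperSpace E'] {G : E × E' → ℂ} (hG : CC G)
    {ε : ℝ} (hε : 0 < ε) : ∃ (m : ℕ) (f : Fin m → E → ℂ) (g : Fin m → E' → ℂ), (∀ i, CC (f i)) ∧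
      (∀ i, CC (g i)) ∧ ∀ x y, ‖G (x, y) - ∑ i, f i x * g i y‖ ≤ ε := by
  have : ProperSpace E := FiniteDimensional.proper_real E
  obtain ⟨R, hR⟩ := hG.supp
  obtain ⟨κ, hκ, hκ1, hκn⟩ := exists_cc_one (E := E) (le_max_right R 0)
  obtain ⟨S, hS⟩ := hκ.supp
  set U : E → Set E := fun a => {x | ∀ y, ‖G (x, y) - G (a, y)‖ ≤ ε} with hU
  obtain ⟨t, -, ht⟩ := (isCompact_closedBall (0 : E) S).elim_nhds_subcover
    (fun a => interior (U a)) fun a _ => interior_mem_nhds.2 (hG.eventually a hε)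
  obtain ⟨f, hfs, hf1, hf0, hfc⟩ := exists_continuous_sum_one_of_isOpen_isCompact
    (s := fun i => interior (U (t.equivFin.symm i))) (fun i => isOpen_interior)
    (isCompact_closedBall (0 : E) S) (ht.trans (by
      refine Set.iUnion₂_subset fun a ha => ?_
      refine Set.subset_iUnion_of_subset (t.equivFin ⟨a, ha⟩) ?_
      simp))
  refine ⟨t.card, fun i x => κ x * f i x, fun i y => G (t.equivFin.symm i, y), fun i => ?_,
    fun i => hG.section_right _, fun x y => ?_⟩
  · have h := (CC.of_hasCompactSupport (F := fun x => (f i x : ℂ)) (by fun_prop)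
      ((hfc i).comp_left Complex.ofReal_zero)).mul_left hκ.cont
    exact h
  · have h1 : κ x * G (x, y) = G (x, y) := by
      by_cases h0 : G (x, y) = 0
      · rw [h0, mul_zero]
      · rw [hκ1 x (((norm_fst_le (x, y)).trans (hR _ h0)).trans (le_max_left _ _)), one_mul]
    by_cases hx : κ x = 0
    · rw [← h1]
      simp [hx, hε.le]
    · have h2 : ∑ i, f i x = 1 := by
        simpa using hf1 (mem_closedBall_zero_iff.2 (hS x hx))
      have h3 : G (x, y) - ∑ i, κ x * f i x * G (t.equivFin.symm i, y) =
          κ x * ∑ i, f i x * (G (x, y) - G (t.equivFin.symm i, y)) := by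
        simp only [mul_sub, Finset.sum_sub_distrib, ← Finset.sum_mul, ← Complex.ofReal_sum, h2]
        rw [Complex.ofReal_one, one_mul, h1, Finset.mul_sum]
        simp only [mul_assoc]
      rw [h3, norm_mul]
      refine (mul_le_of_le_one_left (norm_nonneg _) (hκn x)).trans ?_
      calc ‖∑ i, (f i x : ℂ) * (G (x, y) - G (t.equivFin.symm i, y))‖
          ≤ ∑ i, f i x * ε := by
            refine (norm_sum_le _ _).trans (Finset.sum_le_sum fun i _ => ?_)
            rw [norm_mul, Complex.norm_real, Real.norm_of_nonneg (hf0 i x).1]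
            by_cases h0 : f i x = 0
            · simp [h0]
            · refine mul_le_mul_of_nonneg_left ?_ (hf0 i x).1
              exact interior_subset (hfs i (subset_tsupport _ h0)) y
        _ = ε := by rw [← Finset.sum_mul, h2, one_mul]

end Approximation

/-! ### The comultiplication on kernels. -/

section Comultiplication

variable {n : ℕ} {lam : ℝ}

theorem mulOp_tensor {α : Type*} [MeasureSpace α] [SigmaFinite (volume : Measure α)] {φ ψ : α → ℂ}
    (hφ : BM φ) (hψ : BM ψ) :
    mulOp (fun P : α × α => φ P.1 * ψ P.2) = tensorOp (mulOp φ) (mulOp ψ) :=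
  (isWC_mulOp ((hφ.comp measurable_fst).mul (hψ.comp measurable_snd))).eq
    ((isWC_mulOp hφ).tensor (isWC_mulOp hψ)) (fun _ => rfl) fun _ => rfl

theorem mulOp_sum_tensor {α ι : Type*} [MeasureSpace α] [SigmaFinite (volume : Measure α)]
    {f g : ι → α → ℂ} (s : Finset ι) (hf : ∀ i ∈ s, BM (f i)) (hg : ∀ i ∈ s, BM (g i)) :
    BM (fun P : α × α => ∑ i ∈ s, f i P.1 * g i P.2) ∧
      mulOp (fun P : α × α => ∑ i ∈ s, f i P.1 * g i P.2) =
        ∑ i ∈ s, tensorOp (mulOp (f i)) (mulOp (g i)) := by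
  classical
  induction s using Finset.induction_on with
  | empty =>
    simp only [Finset.sum_empty]
    exact ⟨bm_const 0, mulOp_zero⟩
  | insert i s hi ih =>
    obtain ⟨h1, h2⟩ := ih (fun j hj => hf j (Finset.mem_insert_of_mem hj))
      fun j hj => hg j (Finset.mem_insert_of_mem hj)
    have hfi := hf i (Finset.mem_insert_self _ _)
    have hgi := hg i (Finset.mem_insert_self _ _)
    have h3 : BM (fun P : α × α => f i P.1 * g i P.2) :=
      (hfi.comp measurable_fst).mul (hgi.comp measurable_snd)
    simp only [Finset.sum_insert hi]
    exact ⟨h3.add h1, by rw [← mulOp_add h3 h1, h2, mulOp_tensor hfi hgi]⟩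

theorem isClosed_spatialSquare (B : NonUnitalStarSubalgebra ℂ (L2 (X n) →L[ℂ] L2 (X n))) :
    IsClosed (spatialSquare B : Set (L2 (X n × X n) →L[ℂ] L2 (X n × X n))) :=
  NonUnitalStarSubalgebra.isClosed_topologicalClosure _

theorem tensorOp_mem_spatialSquare {B : NonUnitalStarSubalgebra ℂ (L2 (X n) →L[ℂ] L2 (X n))}
    {b c : L2 (X n) →L[ℂ] L2 (X n)} (hb : b ∈ B) (hc : c ∈ B) : tensorOp b c ∈ spatialSquare B :=
  NonUnitalStarSubalgebra.le_topologicalClosure _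
    (NonUnitalStarAlgebra.subset_adjoin ℂ _ ⟨b, hb, c, hc, rfl⟩)

/-- The coordinates `(x, y, x', y')` of a point of `X × X`. -/
def baseCoord (P : X n × X n) : (V n × V n) × (V n × V n) :=
  ((P.1.1, P.1.2.1), (P.2.1, P.2.2.1))

@[fun_prop]
theorem measurable_baseCoord : Measurable (baseCoord (n := n)) := by
  unfold baseCoord; fun_prop

theorem tensorOp_mulOp_mul_mem {f g : V n × V n → ℂ} (hf : CC f) (hg : CC g)
    {b c : L2 (X n) →L[ℂ] L2 (X n)} (hb : b ∈ rhoSub n lam) (hc : c ∈ rhoSub n lam) :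
    tensorOp (mulOp fun p : X n => f (p.1, p.2.1)) (mulOp fun p : X n => g (p.1, p.2.1)) *
      tensorOp b c ∈ spatialSquare (AHat n lam) := by
  rw [tensorOp_mul]
  exact tensorOp_mem_spatialSquare (rhoSub_le_AHat (mulOp_mul_mem_rhoSub hb hf))
    (rhoSub_le_AHat (mulOp_mul_mem_rhoSub hc hg))

theorem sum_mul_mem_spatialSquare {m : ℕ} {T : Fin m → L2 (X n × X n) →L[ℂ] L2 (X n × X n)}
    {S : L2 (X n × X n) →L[ℂ] L2 (X n × X n)}
    (h : ∀ i, T i * S ∈ spatialSquare (AHat n lam)) :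
    (∑ i, T i) * S ∈ spatialSquare (AHat n lam) := by
  rw [Finset.sum_mul]
  exact sum_mem fun i _ => h i

theorem mulOp_sum_mul_tensorOp_mem {m : ℕ} {f g : Fin m → V n × V n → ℂ} (hf : ∀ i, CC (f i))
    (hg : ∀ i, CC (g i)) {b c : L2 (X n) →L[ℂ] L2 (X n)} (hb : b ∈ rhoSub n lam)
    (hc : c ∈ rhoSub n lam) :
    mulOp (fun P : X n × X n => ∑ i, f i (P.1.1, P.1.2.1) * g i (P.2.1, P.2.2.1)) *
      tensorOp b c ∈ spatialSquare (AHat n lam) := by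
  rw [(mulOp_sum_tensor (f := fun i (p : X n) => f i (p.1, p.2.1))
    (g := fun i (p : X n) => g i (p.1, p.2.1)) Finset.univ
    (fun i _ => (hf i).bm.comp (by fun_prop)) (fun i _ => (hg i).bm.comp (by fun_prop))).2]
  exact sum_mul_mem_spatialSquare fun i => tensorOp_mulOp_mul_mem (hf i) (hg i) hb hc

theorem exists_pos_mul_lt {C ε : ℝ} (hC : 0 ≤ C) (hε : 0 < ε) : ∃ δ > 0, δ * C < ε := by
  refine ⟨ε / (C + 1), by positivity, ?_⟩
  rw [div_mul_eq_mul_div, div_lt_iff₀ (by positivity)]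
  exact mul_lt_mul_of_pos_left (lt_add_one _) hε

theorem norm_mulOp_mul_sub_lt {α : Type*} [MeasureSpace α] {φ ψ : α → ℂ} (hφ : BM φ) (hψ : BM ψ)
    {T : L2 α →L[ℂ] L2 α} {δ ε : ℝ} (hδ : 0 ≤ δ) (hδε : δ * ‖T‖ < ε)
    (h : ∀ p, ‖φ p - ψ p‖ ≤ δ) : dist (mulOp φ * T) (mulOp ψ * T) < ε := by
  rw [dist_eq_norm, ← sub_mul, mulOp_sub hφ hψ]
  exact (norm_mul_le _ _).trans_lt (lt_of_le_of_lt
    (mul_le_mul_of_nonneg_right (norm_mulOp_le h hδ) (norm_nonneg _)) hδε)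

/-- For `G = f ⊗ g` the operator is `(M_f b) ⊗ (M_g c)`; general `G` is a uniform limit of sums of
such products. -/
theorem mulOp_mul_tensorOp_mem {G : (V n × V n) × (V n × V n) → ℂ} (hG : CC G)
    {b c : L2 (X n) →L[ℂ] L2 (X n)} (hb : b ∈ rhoSub n lam) (hc : c ∈ rhoSub n lam) :
    mulOp (fun P : X n × X n => G (baseCoord P)) * tensorOp b c ∈ spatialSquare (AHat n lam) := by
  refine (isClosed_spatialSquare (AHat n lam)).closure_subset (Metric.mem_closure_iff.2 ?_)
  intro ε hε
  obtain ⟨δ, hδ, hδε⟩ := exists_pos_mul_lt (norm_nonneg (tensorOp b c)) hε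
  obtain ⟨m, f, g, hf, hg, hfg⟩ := hG.exists_sum_approx hδ
  have h1 := (mulOp_sum_tensor (f := fun i (p : X n) => f i (p.1, p.2.1))
    (g := fun i (p : X n) => g i (p.1, p.2.1)) Finset.univ
    (fun i _ => (hf i).bm.comp (by fun_prop)) (fun i _ => (hg i).bm.comp (by fun_prop))).1
  exact ⟨_, mulOp_sum_mul_tensorOp_mem hf hg hb hc, norm_mulOp_mul_sub_lt (hG.bm.comp
      measurable_baseCoord) h1 hδ.le hδε
    fun P => hfg _ _⟩

/-- A local unit. It is needed because the kernel of `Δ̂(A)` depends on `x + x'` and `y + y'`, so is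
not compactly supported before multiplication by `b ⊗ c`. -/
theorem exists_mulOp_mul_eq {b : L2 (X n) →L[ℂ] L2 (X n)} (hb : b ∈ rhoSub n lam) :
    ∃ φ : V n × V n → ℂ, CC φ ∧ mulOp (fun p : X n => φ (p.1, p.2.1)) * b = b := by
  obtain ⟨F, hF, hb⟩ := hb
  obtain ⟨R, hR⟩ := hF.supp
  obtain ⟨φ, hφ, hφ1, -⟩ := exists_cc_one (E := V n × V n) (le_max_right R 0)
  refine ⟨φ, hφ, WInt.unique ((hb.mulOp_mul hF.bm hφ.bm).congr fun p => ?_) hb⟩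
  by_cases hp : F p = 0
  · rw [hp, mul_zero]
  · rw [hφ1, one_mul]
    refine le_trans ?_ ((hR p hp).trans (le_max_left _ _))
    exact norm_prod_le_iff.2 ⟨norm_fst_le p, (norm_fst_le p.2).trans (norm_snd_le p)⟩

/-- The kernel of `Δ̂(A)`, where `A` has the kernel `F`. -/
def comultKernel (lam : ℝ) (F : X n → ℂ) (t : ℝ) (q : (V n × V n) × (V n × V n)) : ℂ :=
  F (q.1.1 + q.2.1, q.1.2 + q.2.2, t) * ee (eta lam t * ⟪q.1.1, q.2.2⟫_ℝ)

theorem BM.comultKernel {F : X n → ℂ} (hF : BM F) (t : ℝ) :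
    BM fun P : X n × X n => QHeis.comultKernel lam F t (baseCoord P) :=
  BM.comp (F := QHeis.comultKernel lam F t) (BM.mul
    (hF.comp (π := fun q : (V n × V n) × (V n × V n) => (q.1.1 + q.2.1, q.1.2 + q.2.2, t))
      (by fun_prop)) ⟨by fun_prop, 1, fun q => (norm_ee _).le⟩) measurable_baseCoord

/-- Conjugation by `U_A` replaces `(x',y')` in `F` by `(x+x', y+y')`. The phases of `U_A*` and `U_A`
combine to `(η(r') - e^{2λt} η(r'-t)) β(x,y')`, in which `r'` cancels by `eta_sub`. -/
theorem comult_mulOp_mul_lamOp {F : X n → ℂ} (hF : BM F) (t : ℝ) :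
    comult n lam (mulOp (fun p : X n => F (p.1, p.2.1, t)) * lamOp n lam t) =
      mulOp (fun P : X n × X n => comultKernel lam F t (baseCoord P)) *
        tensorOp (lamOp n lam t) (lamOp n lam t) := by
  refine ((isWC_star_UOp.mul (isWC_one.tensor ((isWC_mulOp (hF.section t)).mul
    (isWC_lamOp lam t)))).mul isWC_UOp).eq ((isWC_mulOp (hF.comultKernel t)).mul
      ((isWC_lamOp lam t).tensor (isWC_lamOp lam t))) (fun P => ?_) fun P => ?_
  · obtain ⟨⟨x, y, r⟩, x', y', r'⟩ := P
    have e : Real.exp (-(lam * (r' - t))) * Real.exp (lam * r') = Real.exp (lam * t) := by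
      rw [← Real.exp_add]; congr 1; ring
    simp [UMap, UMapInv, shift, smul_smul, e]
  · obtain ⟨⟨x, y, r⟩, x', y', r'⟩ := P
    have e : Real.exp (-(lam * (r' - t))) * Real.exp (lam * r') = Real.exp (lam * t) := by
      rw [← Real.exp_add]; congr 1; ring
    have e' : (Real.exp (-(lam * (r' - t))) : ℂ) * Real.exp (lam * r') = Real.exp (lam * t) := by
      rw [← Complex.ofReal_mul, e]
    simp only [UWeightInv, UWeight, UMapInv, shift, comultKernel, baseCoord, smul_smul, e, id_eq,
      Pi.one_apply, one_mul, smul_add, add_sub_cancel_left, real_inner_smul_left,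
      real_inner_smul_right]
    rw [ee_eq_eBar, ee_eq_eBar, ← eta_sub lam r' t, ← e', mul_pow]
    have e2 : eBar (-((eta lam r' - Real.exp (lam * t) ^ 2 * eta lam (r' - t)) * ⟪x, y'⟫_ℝ)) =
        eBar (-(eta lam r' * ⟪x, y'⟫_ℝ)) *
          eBar (eta lam (r' - t) * (Real.exp (lam * t) * (Real.exp (lam * t) * ⟪x, y'⟫_ℝ))) := by
      rw [← eBar_add]
      congr 1
      ring
    rw [e2]
    ring

end Comultiplication

/-! ### Continuity and a criterion for multipliers. -/

section General

theorem continuous_mul_tensorOp_one_mul {α : Type*} [MeasureSpace α] [SigmaFinite (volume : Measure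
    α)]
    (S U : L2 (α × α) →L[ℂ] L2 (α × α)) :
    Continuous fun b : L2 α →L[ℂ] L2 α => S * tensorOp 1 b * U := by
  simp only [← tensorOpL_apply]
  fun_prop

theorem mulOp_mul_eq_zero {α : Type*} [MeasureSpace α] {φ : α → ℂ} (h : ∀ p, φ p = 0)
    {T : L2 α →L[ℂ] L2 α} : mulOp φ * T = 0 := by
  rw [show φ = fun _ => 0 from funext h, mulOp_zero, zero_mul]

theorem continuous_mul_const_of_continuous {α T : Type*} [MeasureSpace α] [TopologicalSpace T]
    {f : T → L2 α →L[ℂ] L2 α} (hf : Continuous f) (S : L2 α →L[ℂ] L2 α) :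
    Continuous fun t => f t * S := by
  fun_prop

theorem continuous_mul_tensorOp {α : Type*} [MeasureSpace α] [SigmaFinite (volume : Measure α)]
    (S : L2 (α × α) →L[ℂ] L2 (α × α)) :
    Continuous (Function.uncurry fun b c : L2 α →L[ℂ] L2 α => S * tensorOp b c) := by
  simp only [← tensorOpL_apply]
  fun_prop

theorem continuous_tensorOp_mul {α : Type*} [MeasureSpace α] [SigmaFinite (volume : Measure α)]
    {W V : ℝ → L2 α →L[ℂ] L2 α} {G : ℝ → L2 (α × α) →L[ℂ] L2 (α × α)} (hG : Continuous G)
    (hW : Continuous W) (hV : Continuous V) : Continuous fun t => G t * tensorOp (W t) (V t) := by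
  simp only [← tensorOpL_apply]
  fun_prop

theorem mulOp_mul_tensorOp_cutoff {α : Type*} [MeasureSpace α] [SigmaFinite (volume : Measure α)]
    {Ψ : α × α → ℂ} {φ ψ : α → ℂ} (hΨ : BM Ψ) (hφ : BM φ) (hψ : BM ψ) {b c : L2 α →L[ℂ] L2 α}
    (hb : mulOp φ * b = b) (hc : mulOp ψ * c = c) :
    mulOp Ψ * tensorOp b c = mulOp (fun P => Ψ P * (φ P.1 * ψ P.2)) * tensorOp b c := by
  nth_rw 1 [← hb, ← hc]
  rw [← tensorOp_mul, ← mulOp_tensor hφ hψ, ← mul_assoc,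
    mulOp_mul hΨ ((hφ.comp measurable_fst).mul (hψ.comp measurable_snd))]

theorem WInt.mem_of_continuous_starSubalgebra {α : Type*} [MeasureSpace α]
    {W : ℝ → L2 α →L[ℂ] L2 α} {A : L2 α →L[ℂ] L2 α} (hA : WInt W A) (hc : Continuous W) {R : ℝ}
    (h0 : ∀ t, R < |t| → W t = 0) {S : NonUnitalStarSubalgebra ℂ (L2 α →L[ℂ] L2 α)}
    (hS : IsClosed (S : Set (L2 α →L[ℂ] L2 α))) (h : ∀ t, W t ∈ S) : A ∈ S :=
  WInt.mem_of_continuous hA hc h0 (S := S.toNonUnitalSubalgebra.toSubmodule) hS h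

/-- Right products are adjoints of left products by the adjoint operator, so left products of `T`
and `T*` with a self-adjoint generating set are enough. The induction has to carry all four products
because of the star step. -/
theorem mem_multiplierAlg_of_generators {α : Type*} [MeasureSpace α]
    {s : Set (L2 α →L[ℂ] L2 α)} (hs : ∀ x ∈ s, star x ∈ s) {T : L2 α →L[ℂ] L2 α}
    (h : ∀ x ∈ s, T * x ∈ (NonUnitalStarAlgebra.adjoin ℂ s).topologicalClosure)
    (h' : ∀ x ∈ s, star T * x ∈ (NonUnitalStarAlgebra.adjoin ℂ s).topologicalClosure) :
    T ∈ multiplierAlg (NonUnitalStarAlgebra.adjoin ℂ s).topologicalClosure := by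
  set D := (NonUnitalStarAlgebra.adjoin ℂ s).topologicalClosure with hD
  have hcl : IsClosed (D : Set (L2 α →L[ℂ] L2 α)) :=
      NonUnitalStarSubalgebra.isClosed_topologicalClosure _
  have key : ∀ x ∈ NonUnitalStarAlgebra.adjoin ℂ s,
      (T * x ∈ D ∧ x * T ∈ D) ∧ (star T * x ∈ D ∧ x * star T ∈ D) := by
    intro x hx
    induction hx using NonUnitalStarAlgebra.adjoin_induction with
    | mem x hx =>
      refine ⟨⟨h x hx, ?_⟩, h' x hx, ?_⟩
      · simpa using star_mem (h' _ (hs x hx))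
      · simpa using star_mem (h _ (hs x hx))
    | add x y _ _ hx hy =>
      simp only [mul_add, add_mul]
      exact ⟨⟨add_mem hx.1.1 hy.1.1, add_mem hx.1.2 hy.1.2⟩, add_mem hx.2.1 hy.2.1,
        add_mem hx.2.2 hy.2.2⟩
    | zero => simp [zero_mem]
    | mul x y hx' hy' hx hy =>
      have hxD : x ∈ D := NonUnitalStarSubalgebra.le_topologicalClosure _ hx'
      have hyD : y ∈ D := NonUnitalStarSubalgebra.le_topologicalClosure _ hy'
      simp only [← mul_assoc T, ← mul_assoc (star T), mul_assoc x]
      exact ⟨⟨mul_mem hx.1.1 hyD, mul_mem hxD hy.1.2⟩, mul_mem hx.2.1 hyD, mul_mem hxD hy.2.2⟩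
    | smul r x _ hx =>
      simp only [mul_smul_comm, smul_mul_assoc]
      exact ⟨⟨SMulMemClass.smul_mem r hx.1.1, SMulMemClass.smul_mem r hx.1.2⟩,
        SMulMemClass.smul_mem r hx.2.1, SMulMemClass.smul_mem r hx.2.2⟩
    | star x _ hx =>
      refine ⟨⟨?_, ?_⟩, ?_, ?_⟩
      · simpa using star_mem hx.2.2
      · simpa using star_mem hx.2.1
      · simpa using star_mem hx.1.2
      · simpa using star_mem hx.1.1
  exact fun a ha => ⟨closure_minimal (t := {x | T * x ∈ D}) (fun x hx => (key x hx).1.1)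
      (hcl.preimage (continuous_const.mul continuous_id)) ha,
    closure_minimal (t := {x | x * T ∈ D}) (fun x hx => (key x hx).1.2)
      (hcl.preimage (continuous_id.mul continuous_const)) ha⟩

end General

/-! ### The comultiplication takes values in multipliers. -/

section Multiplier

variable {n : ℕ} {lam : ℝ}

theorem star_comult (b : L2 (X n) →L[ℂ] L2 (X n)) :
    star (comult n lam b) = comult n lam (star b) := by
  rw [comult, comult, star_mul, star_mul, star_star, star_tensorOp, star_one, mul_assoc]

theorem continuous_comult : Continuous (comult n lam) :=
  continuous_mul_tensorOp_one_mul _ _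

theorem continuous_comult_mul (T : L2 (X n × X n) →L[ℂ] L2 (X n × X n)) :
    Continuous fun b => comult n lam b * T :=
  continuous_mul_const_of_continuous continuous_comult T

theorem wInt_comult {F : X n → ℂ} (hF : CC F) {A : L2 (X n) →L[ℂ] L2 (X n)}
    (hA : IsRho lam F A) : WInt (fun t => mulOp (fun P : X n × X n =>
      comultKernel lam F t (baseCoord P)) * tensorOp (lamOp n lam t) (lamOp n lam t))
      (comult n lam A) := by
  obtain ⟨R, hR0, hR⟩ := hF.exists_radius
  obtain ⟨C, hC⟩ := hF.bound
  have hC0 : 0 ≤ C := (norm_nonneg (F 0)).trans (hC 0)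
  have hg : Integrable ((Set.Icc (-R) R).indicator fun _ => C) :=
    (integrable_indicator_iff measurableSet_Icc).2 (integrableOn_const (by simp))
  have h1 := WInt.tensor_one hA hg fun t => by
    by_cases ht : t ∈ Set.Icc (-R) R
    · rw [Set.indicator_of_mem ht]
      refine (norm_mul_le _ _).trans ((mul_le_mul (norm_mulOp_le (fun p => hC _) hC0)
        (norm_lamOp_le lam t) (norm_nonneg _) hC0).trans_eq (mul_one C))
    · have h0 : ∀ p : X n, F (p.1, p.2.1, t) = 0 := fun p => hR (p.1, p.2.1, t) (by
        by_contra hn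
        exact ht (abs_le.1 (not_lt.1 hn)))
      simp only [h0, mulOp_zero, zero_mul, norm_zero]
      exact Set.indicator_nonneg (fun _ _ => hC0) t
  exact WInt.congr ((h1.mul_left (star (UOp n lam))).mul_right (UOp n lam))
    fun t => comult_mulOp_mul_lamOp hF.bm t

/-- The kernel of the product of `Δ̂(A)` with an elementary tensor, cut off by `φ` and `ψ`. -/
def cutKernel (lam : ℝ) (F : X n → ℂ) (φ ψ : V n × V n → ℂ)
    (z : ℝ × ((V n × V n) × (V n × V n))) : ℂ :=
  comultKernel lam F z.1 z.2 * (φ (Real.exp (lam * z.1) • z.2.1) *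
    ψ (Real.exp (lam * z.1) • z.2.2))

theorem cc_cutKernel {F : X n → ℂ} (hF : CC F) {φ ψ : V n × V n → ℂ} (hφ : CC φ) (hψ : CC ψ) :
    CC (cutKernel lam F φ ψ) := by
  obtain ⟨R, hR⟩ := hF.supp
  obtain ⟨S, hS⟩ := hφ.supp
  obtain ⟨T, hT⟩ := hψ.supp
  have h1 := hF.cont
  have h2 := hφ.cont
  have h3 := hψ.cont
  refine ⟨by unfold cutKernel comultKernel; fun_prop,
    max R (Real.exp (|lam| * R) * max S T), fun z hz => ?_⟩
  have hz1 := hR _ (left_ne_zero_of_mul (left_ne_zero_of_mul hz))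
  have hz2 := (hS _ (left_ne_zero_of_mul (right_ne_zero_of_mul hz))).trans (le_max_left S T)
  have hz3 := (hT _ (right_ne_zero_of_mul (right_ne_zero_of_mul hz))).trans (le_max_right S T)
  have ht : |z.1| ≤ R := ((norm_snd_le _).trans (norm_snd_le _)).trans hz1
  simp only [Prod.norm_def, Prod.smul_fst, Prod.smul_snd, max_le_iff] at hz2 hz3 ⊢
  exact ⟨ht.trans (le_max_left _ _),
    ⟨(norm_le_of_norm_exp_smul_le ht hz2.1).trans (le_max_right _ _),
      (norm_le_of_norm_exp_smul_le ht hz2.2).trans (le_max_right _ _)⟩,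
    (norm_le_of_norm_exp_smul_le ht hz3.1).trans (le_max_right _ _),
    (norm_le_of_norm_exp_smul_le ht hz3.2).trans (le_max_right _ _)⟩

theorem lamOp_mul_cutoff {φ : V n × V n → ℂ} (hφ : CC φ) {b : L2 (X n) →L[ℂ] L2 (X n)}
    (hb : mulOp (fun p : X n => φ (p.1, p.2.1)) * b = b) (t : ℝ) :
    lamOp n lam t * b = mulOp (fun p : X n => φ (Real.exp (lam * t) • (p.1, p.2.1))) *
      (lamOp n lam t * b) := by
  nth_rw 1 [← hb]
  rw [← mul_assoc, lamOp_mul_mulOp lam t (hφ.bm.comp (by fun_prop)), mul_assoc]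
  rfl

/-- Moving the local units of `b` and `c` through `λ_t` dilates them, and they then cut the kernel
of `Δ̂(A)` down to compact support. -/
theorem mulOp_comultKernel_mul {F : X n → ℂ} (hF : CC F) {φ ψ : V n × V n → ℂ} (hφ : CC φ)
    (hψ : CC ψ) {b c : L2 (X n) →L[ℂ] L2 (X n)}
    (hb : mulOp (fun p : X n => φ (p.1, p.2.1)) * b = b)
    (hc : mulOp (fun p : X n => ψ (p.1, p.2.1)) * c = c) (t : ℝ) :
    mulOp (fun P : X n × X n => comultKernel lam F t (baseCoord P)) *
      tensorOp (lamOp n lam t) (lamOp n lam t) * tensorOp b c =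
    mulOp (fun P : X n × X n => cutKernel lam F φ ψ (t, baseCoord P)) *
      tensorOp (lamOp n lam t * b) (lamOp n lam t * c) := by
  have h1 : BM fun p : X n => φ (Real.exp (lam * t) • (p.1, p.2.1)) :=
    hφ.bm.comp (by fun_prop)
  have h2 : BM fun p : X n => ψ (Real.exp (lam * t) • (p.1, p.2.1)) :=
    hψ.bm.comp (by fun_prop)
  rw [mul_assoc, tensorOp_mul]
  exact mulOp_mul_tensorOp_cutoff (hF.bm.comultKernel t) h1 h2 (lamOp_mul_cutoff hφ hb t).symm
    (lamOp_mul_cutoff hψ hc t).symm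

theorem cutKernel_eq_zero {F : X n → ℂ} {R : ℝ} (hR : ∀ p : X n, R < |p.2.2| → F p = 0)
    (φ ψ : V n × V n → ℂ) {t : ℝ} (ht : R < |t|) (q : (V n × V n) × (V n × V n)) :
    cutKernel lam F φ ψ (t, q) = 0 := by
  simp only [cutKernel, comultKernel]
  rw [hR (q.1.1 + q.2.1, q.1.2 + q.2.2, t) ht, zero_mul, zero_mul]

theorem wInt_comult_mul {F : X n → ℂ} (hF : CC F) {A : L2 (X n) →L[ℂ] L2 (X n)}
    (hA : IsRho lam F A) {φ ψ : V n × V n → ℂ} (hφ : CC φ) (hψ : CC ψ)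
    {b c : L2 (X n) →L[ℂ] L2 (X n)} (hb : mulOp (fun p : X n => φ (p.1, p.2.1)) * b = b)
    (hc : mulOp (fun p : X n => ψ (p.1, p.2.1)) * c = c) :
    WInt (fun t => mulOp (fun P : X n × X n => cutKernel lam F φ ψ (t, baseCoord P)) *
      tensorOp (lamOp n lam t * b) (lamOp n lam t * c)) (comult n lam A * tensorOp b c) :=
  WInt.congr ((wInt_comult hF hA).mul_right (tensorOp b c))
    (mulOp_comultKernel_mul hF hφ hψ hb hc)

theorem continuous_cutKernel {F : X n → ℂ} (hF : CC F) {φ ψ : V n × V n → ℂ} (hφ : CC φ)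
    (hψ : CC ψ) {b c : L2 (X n) →L[ℂ] L2 (X n)} (hb : b ∈ rhoSub n lam) (hc : c ∈ rhoSub n lam) :
    Continuous fun t => mulOp (fun P : X n × X n => cutKernel lam F φ ψ (t, baseCoord P)) *
      tensorOp (lamOp n lam t * b) (lamOp n lam t * c) :=
  continuous_tensorOp_mul ((cc_cutKernel hF hφ hψ).continuous_mulOp measurable_baseCoord)
    (continuous_lamOp_mul hb) (continuous_lamOp_mul hc)

theorem cutKernel_mem {F : X n → ℂ} (hF : CC F) {φ ψ : V n × V n → ℂ} (hφ : CC φ)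
    (hψ : CC ψ) {b c : L2 (X n) →L[ℂ] L2 (X n)} (hb : b ∈ rhoSub n lam) (hc : c ∈ rhoSub n lam)
    (t : ℝ) : mulOp (fun P : X n × X n => cutKernel lam F φ ψ (t, baseCoord P)) *
      tensorOp (lamOp n lam t * b) (lamOp n lam t * c) ∈ spatialSquare (AHat n lam) :=
  mulOp_mul_tensorOp_mem ((cc_cutKernel hF hφ hψ).section_right t) (lamOp_mul_mem_rhoSub hb t)
    (lamOp_mul_mem_rhoSub hc t)

theorem mem_spatialSquare_of_wInt {W : ℝ → L2 (X n × X n) →L[ℂ] L2 (X n × X n)}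
    {A : L2 (X n × X n) →L[ℂ] L2 (X n × X n)} (hA : WInt W A) (hc : Continuous W) {R : ℝ}
    (h0 : ∀ t, R < |t| → W t = 0) (h : ∀ t, W t ∈ spatialSquare (AHat n lam)) :
    A ∈ spatialSquare (AHat n lam) :=
  hA.mem_of_continuous_starSubalgebra hc h0 (isClosed_spatialSquare _) h

/-- After the cutoff the integrand is norm continuous, compactly supported in `t` and takes values
in `Â ⊗ Â`, so the integral stays in that closed space. -/
theorem comult_mul_tensorOp_mem_of_cutoff {F : X n → ℂ} (hF : CC F) {A : L2 (X n) →L[ℂ] L2 (X n)}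
    (hA : IsRho lam F A) {φ ψ : V n × V n → ℂ} (hφ : CC φ) (hψ : CC ψ)
    {b c : L2 (X n) →L[ℂ] L2 (X n)} (hb : b ∈ rhoSub n lam) (hc : c ∈ rhoSub n lam)
    (hφb : mulOp (fun p : X n => φ (p.1, p.2.1)) * b = b)
    (hψc : mulOp (fun p : X n => ψ (p.1, p.2.1)) * c = c) :
    comult n lam A * tensorOp b c ∈ spatialSquare (AHat n lam) :=
  hF.exists_radius.elim fun _ hR =>
    mem_spatialSquare_of_wInt (wInt_comult_mul hF hA hφ hψ hφb hψc)
      (continuous_cutKernel hF hφ hψ hb hc)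
      (fun _ ht => mulOp_mul_eq_zero fun _ => cutKernel_eq_zero hR.2 φ ψ ht _)
      (cutKernel_mem hF hφ hψ hb hc)

theorem comult_mul_tensorOp_mem {A b c : L2 (X n) →L[ℂ] L2 (X n)} (hA : A ∈ rhoSub n lam)
    (hb : b ∈ rhoSub n lam) (hc : c ∈ rhoSub n lam) :
    comult n lam A * tensorOp b c ∈ spatialSquare (AHat n lam) :=
  hA.elim fun _ hF => (exists_mulOp_mul_eq hb).elim fun _ hφ =>
    (exists_mulOp_mul_eq hc).elim fun _ hψ =>
      comult_mul_tensorOp_mem_of_cutoff hF.1 hF.2 hφ.1 hψ.1 hb hc hφ.2 hψ.2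

theorem comult_mul_tensorOp_mem_of_mem_AHat {A b c : L2 (X n) →L[ℂ] L2 (X n)}
    (hA : A ∈ AHat n lam) (hb : b ∈ AHat n lam) (hc : c ∈ AHat n lam) :
    comult n lam A * tensorOp b c ∈ spatialSquare (AHat n lam) := by
  have hcl := isClosed_spatialSquare (AHat n lam)
  have hAb : ∀ b ∈ rhoSub n lam, ∀ c ∈ rhoSub n lam,
      comult n lam A * tensorOp b c ∈ spatialSquare (AHat n lam) := fun b hb c hc =>
    closure_minimal (s := (rhoSub n lam : Set (L2 (X n) →L[ℂ] L2 (X n))))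
      (t := {A | comult n lam A * tensorOp b c ∈ spatialSquare (AHat n lam)})
      (fun A hA => comult_mul_tensorOp_mem hA hb hc)
      (hcl.preimage (continuous_comult_mul _)) (mem_AHat_iff.1 hA)
  have h := map_mem_closure₂ (f := fun b c : L2 (X n) →L[ℂ] L2 (X n) =>
    comult n lam A * tensorOp b c) (continuous_mul_tensorOp _) (mem_AHat_iff.1 hb) (mem_AHat_iff.1
        hc)
    (fun b hb c hc => hAb b hb c hc)
  exact hcl.closure_subset h

theorem comult_mem_MSquare {b : L2 (X n) →L[ℂ] L2 (X n)} (hb : b ∈ AHat n lam) :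
    comult n lam b ∈ MSquare n lam :=
  mem_multiplierAlg_of_generators
    (by
      rintro _ ⟨b, hb, c, hc, rfl⟩
      exact ⟨_, star_mem hb, _, star_mem hc, star_tensorOp b c⟩)
    (by
      rintro _ ⟨c, hc, d, hd, rfl⟩
      exact comult_mul_tensorOp_mem_of_mem_AHat hb hc hd)
    (by
      rintro _ ⟨c, hc, d, hd, rfl⟩
      rw [star_comult]
      exact comult_mul_tensorOp_mem_of_mem_AHat (star_mem hb) hc hd)

end Multiplier

/-! ### Nondegeneracy of `Â`. -/

section Nondegenerate

variable {n : ℕ} {lam : ℝ}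

/-- A vector `θ` orthogonal to the range of every slice makes each `θ ⊗ η` orthogonal to the range
of `U_A`. Since `U_A` is surjective, `θ ⊗ θ = 0`, hence `θ = 0`. -/
theorem dense_AHat_apply {E : Type*} [NormedAddCommGroup E] [NormedSpace ℂ E]
    {S : L2 (X n) →L[ℂ] E} (h : ∀ b ∈ AHat n lam, ∀ ζ, S (b ζ) = 0) : S = 0 := by
  have h1 : (Submodule.span ℂ {ξ : L2 (X n) | ∃ b ∈ AHat n lam, ∃ ζ, ξ = b ζ}).topologicalClosure
      = ⊤ := by
    rw [Submodule.topologicalClosure_eq_top_iff, Submodule.eq_bot_iff]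
    intro θ hθ
    have h2 : ∀ ξ η ζ, ⟪tmul θ η, UOp n lam (tmul ζ ξ)⟫_ℂ = 0 := fun ξ η ζ => by
      have h : rightSlice (vecFunctional ξ η) (UOp n lam) ζ ∈
          {ξ : L2 (X n) | ∃ b ∈ AHat n lam, ∃ ζ, ξ = b ζ} := ⟨_, slice_mem_AHat ξ η, ζ, rfl⟩
      rw [← rightSlice_vecFunctional]
      exact Submodule.inner_left_of_mem_orthogonal (Submodule.subset_span h) hθ
    have h3 : (innerSL ℂ (tmul θ θ)).comp (UOp n lam) = 0 :=
      ext_tmul fun ζ ξ => by simpa using h2 ξ θ ζ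
    have h4 : ⟪tmul θ θ, tmul θ θ⟫_ℂ = 0 := by
      have := DFunLike.congr_fun h3 ((UA n lam).symm (tmul θ θ))
      simpa [UOp] using this
    rw [inner_tmul_tmul, mul_self_eq_zero, inner_self_eq_zero] at h4
    exact h4
  refine ContinuousLinearMap.ext fun ξ => ?_
  have h2 : ξ ∈ (Submodule.span ℂ {ξ : L2 (X n) | ∃ b ∈ AHat n lam, ∃ ζ, ξ = b
      ζ}).topologicalClosure :=
    h1 ▸ Submodule.mem_top
  refine closure_minimal (t := {ξ | S ξ = 0}) (fun ξ hξ => ?_)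
    (isClosed_eq S.continuous continuous_const) h2
  have h3 : Submodule.span ℂ {ξ : L2 (X n) | ∃ b ∈ AHat n lam, ∃ ζ, ξ = b ζ} ≤
      LinearMap.ker S.toLinearMap := Submodule.span_le.2 (by
    rintro _ ⟨b, hb, ζ, rfl⟩
    exact h b hb ζ)
  exact h3 hξ

theorem eq_zero_of_mul_tensorOp {T : L2 (X n × X n) →L[ℂ] L2 (X n × X n)}
    (h : ∀ b ∈ AHat n lam, ∀ c ∈ AHat n lam, T * tensorOp b c = 0) : T = 0 := by
  have h1 : ∀ b ∈ AHat n lam, ∀ ξ η, T (tmul (b ξ) η) = 0 := fun b hb ξ η => by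
    have : T.comp (tmul (b ξ)) = 0 := dense_AHat_apply (lam := lam) fun c hc ζ => by
      have := DFunLike.congr_fun (h b hb c hc) (tmul ξ ζ)
      rwa [mul_apply_eq_comp, tensorOp_tmul] at this
    exact DFunLike.congr_fun this η
  refine ext_tmul fun ξ η => ?_
  have : T.comp ((tmul (α := X n)).flip η) = 0 :=
    dense_AHat_apply (lam := lam) fun b hb ζ => h1 b hb ζ η
  exact DFunLike.congr_fun this ξ

end Nondegenerate

/-! ### Anti-automorphisms from antiunitaries, and uniqueness. -/

section AntiAutomorphism

variable {α : Type*} [MeasureSpace α]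

/-- The unitary factor of the antiunitary operator `ξ ↦ m · conj (ξ ∘ N)`. -/
def unitaryFactor (N : α → α) (m : α → ℂ) (hN : MeasurePreserving N volume volume)
    (hNN : ∀ p, N (N p) = p) (hm : Measurable m) (h1 : ∀ p, m p * conj (m p) = 1) :
    L2 α ≃ₗᵢ[ℂ] L2 α :=
  wcompEquiv N N m (fun p => conj (m (N p))) hN.measurable hm hN.measurable
    (Complex.continuous_conj.measurable.comp (hm.comp hN.measurable))
    (fun g hg => by
      have h2 : ∀ p, ‖m p‖ₑ = 1 := fun p => by
        have h3 := congrArg norm (h1 p)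
        rw [norm_mul, RCLike.norm_conj, norm_one] at h3
        rw [← ofReal_norm, ENNReal.ofReal_eq_one]
        nlinarith [norm_nonneg (m p)]
      simp only [h2, one_pow, one_mul]
      exact hN.lintegral_comp hg)
    hNN hNN (fun p => by rw [hNN, h1])

/-- The antiunitary operator `ξ ↦ m · conj (ξ ∘ N)`. -/
def antiunitary (N : α → α) (m : α → ℂ) (hN : MeasurePreserving N volume volume)
    (hNN : ∀ p, N (N p) = p) (hm : Measurable m) (h1 : ∀ p, m p * conj (m p) = 1) :
    L2 α ≃ₗᵢ⋆[ℂ] L2 α :=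
  conjL2.trans (unitaryFactor N m hN hNN hm h1)

theorem isCWC_antiunitary (N : α → α) (m : α → ℂ) (hN : MeasurePreserving N volume volume)
    (hNN : ∀ p, N (N p) = p) (hm : Measurable m) (h1 : ∀ p, m p * conj (m p) = 1) :
    IsCWC (antiunitary N m hN hNN hm h1) N m := by
  refine ⟨hN.quasiMeasurePreserving, fun ξ => ?_⟩
  have h2 : ∀ᵐ p, unitaryFactor N m hN hNN hm h1 (conjL2 ξ) p = m p * conjL2 ξ (N p) := by
    unfold unitaryFactor
    exact wcompEquiv_apply ..
  filter_upwards [h2, hN.quasiMeasurePreserving.ae (Lp.coeFn_star ξ)] with p h2 h3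
  refine h2.trans ?_
  congr 1

theorem IsCWC.map_tmul [SigmaFinite (volume : Measure α)] {K : L2 α ≃ₗᵢ⋆[ℂ] L2 α} {N : α → α}
    {m : α → ℂ} (hK : IsCWC K N m) {L : L2 (α × α) ≃ₗᵢ⋆[ℂ] L2 (α × α)}
    (hL : IsCWC L (fun P => (N P.1, N P.2)) (fun P => m P.1 * m P.2)) (ξ η : L2 α) :
    L (tmul ξ η) = tmul (K ξ) (K η) := by
  ext1
  filter_upwards [hL.2 (tmul ξ η), hL.1.ae (tmul_apply ξ η), tmul_apply (K ξ) (K η),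
    ae_fst (hK.2 ξ), ae_snd (hK.2 η)] with P h1 h2 h3 h4 h5
  rw [h1, h2, h3, h4, h5, map_mul]
  ring

theorem conjBy_tensorOp [SigmaFinite (volume : Measure α)] {K : L2 α ≃ₗᵢ⋆[ℂ] L2 α}
    {L : L2 (α × α) ≃ₗᵢ⋆[ℂ] L2 (α × α)} (h : ∀ ξ η, L (tmul ξ η) = tmul (K ξ) (K η))
    (b c : L2 α →L[ℂ] L2 α) : conjBy L (tensorOp b c) = tensorOp (conjBy K b) (conjBy K c) :=
  ext_tmul fun ξ η => by rw [conjBy_apply, h, tensorOp_tmul, h, tensorOp_tmul]; rfl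

theorem conjBy_star_tensorOp [SigmaFinite (volume : Measure α)] {K : L2 α ≃ₗᵢ⋆[ℂ] L2 α}
    {L : L2 (α × α) ≃ₗᵢ⋆[ℂ] L2 (α × α)} (h : ∀ ξ η, L (tmul ξ η) = tmul (K ξ) (K η))
    (b c : L2 α →L[ℂ] L2 α) :
    conjBy L (star (tensorOp b c)) = tensorOp (conjBy K (star b)) (conjBy K (star c)) := by
  rw [star_tensorOp, conjBy_tensorOp h]

theorem conjBy_mem_closure_adjoin {K : L2 α ≃ₗᵢ⋆[ℂ] L2 α} (hK : ∀ ξ, K (K ξ) = ξ)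
    {s : Set (L2 α →L[ℂ] L2 α)} (hs : ∀ a ∈ s, conjBy K a ∈ s) {a : L2 α →L[ℂ] L2 α}
    (ha : a ∈ (NonUnitalStarAlgebra.adjoin ℂ s).topologicalClosure) :
    conjBy K a ∈ (NonUnitalStarAlgebra.adjoin ℂ s).topologicalClosure := by
  refine map_mem_closure (continuous_conjBy K) ha fun x hx => ?_
  induction hx using NonUnitalStarAlgebra.adjoin_induction with
  | mem x hx => exact NonUnitalStarAlgebra.subset_adjoin ℂ _ (hs x hx)
  | add x y _ _ hx hy => rw [conjBy_add]; exact add_mem hx hy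
  | zero =>
    rw [← sub_self (0 : L2 α →L[ℂ] L2 α), conjBy_sub, sub_self]
    exact zero_mem _
  | mul x y _ _ hx hy => rw [conjBy_mul hK]; exact mul_mem hx hy
  | smul r x _ hx => rw [conjBy_smul]; exact SMulMemClass.smul_mem _ hx
  | star x _ hx => rw [← star_conjBy hK]; exact star_mem hx

theorem conjBy_mem_multiplierAlg {K : L2 α ≃ₗᵢ⋆[ℂ] L2 α} (hK : ∀ ξ, K (K ξ) = ξ)
    {D : NonUnitalStarSubalgebra ℂ (L2 α →L[ℂ] L2 α)} (hD : ∀ a ∈ D, conjBy K a ∈ D)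
    {T : L2 α →L[ℂ] L2 α} (hT : T ∈ multiplierAlg D) : conjBy K T ∈ multiplierAlg D :=
  fun a ha => by
    have h := hT _ (hD a ha)
    have h1 := hD _ h.1
    have h2 := hD _ h.2
    rw [conjBy_mul hK, conjBy_conjBy hK] at h1 h2
    exact ⟨h1, h2⟩

theorem continuous_const_mul_mul_const (S U : L2 α →L[ℂ] L2 α) :
    Continuous fun T : L2 α →L[ℂ] L2 α => S * T * U := by
  fun_prop

/-- Closedness makes the multiplier algebra a `C*`-algebra, whose `*`-automorphisms are
automatically isometric. -/
theorem isClosed_multiplierAlg {D : NonUnitalStarSubalgebra ℂ (L2 α →L[ℂ] L2 α)}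
    (hD : IsClosed (D : Set (L2 α →L[ℂ] L2 α))) :
    IsClosed (multiplierAlg D : Set (L2 α →L[ℂ] L2 α)) := by
  have e : (multiplierAlg D : Set (L2 α →L[ℂ] L2 α)) =
      ⋂ a ∈ D, {T | T * a ∈ D} ∩ {T | a * T ∈ D} := by
    ext T
    simp only [Set.mem_iInter]
    exact Iff.rfl
  rw [e]
  exact isClosed_biInter fun a _ => (hD.preimage (continuous_id.mul continuous_const)).inter
    (hD.preimage (continuous_const.mul continuous_id))

/-- The `*`-anti-automorphism `b ↦ K b* K` of an algebra of operators invariant under `K`. -/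
def antiAut (s : NonUnitalStarSubalgebra ℂ (L2 α →L[ℂ] L2 α))
    (K : L2 α ≃ₗᵢ⋆[ℂ] L2 α) (hK : ∀ ξ, K (K ξ) = ξ) (hs : ∀ a ∈ s, conjBy K a ∈ s) :
    s ≃⋆ₐ[ℂ] sᵐᵒᵖ where
  toFun b := MulOpposite.op ⟨conjBy K (star b.1), hs _ (star_mem b.2)⟩
  invFun b := ⟨conjBy K (star b.unop.1), hs _ (star_mem b.unop.2)⟩
  left_inv b := Subtype.ext (by
    change conjBy K (star (conjBy K (star b.1))) = b.1
    rw [star_conjBy hK, conjBy_conjBy hK, star_star])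
  right_inv b := MulOpposite.unop_injective (Subtype.ext (by
    change conjBy K (star (conjBy K (star b.unop.1))) = b.unop.1
    rw [star_conjBy hK, conjBy_conjBy hK, star_star]))
  map_mul' b c := MulOpposite.unop_injective (Subtype.ext (by
    change conjBy K (star (b.1 * c.1)) = conjBy K (star c.1) * conjBy K (star b.1)
    rw [star_mul, conjBy_mul hK]))
  map_add' b c := MulOpposite.unop_injective (Subtype.ext (by
    change conjBy K (star (b.1 + c.1)) = conjBy K (star b.1) + conjBy K (star c.1)
    rw [star_add, conjBy_add]))
  map_star' b := MulOpposite.unop_injective (Subtype.ext (by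
    change conjBy K (star (star b.1)) = star (conjBy K (star b.1))
    rw [star_conjBy hK]))
  map_smul' z b := MulOpposite.unop_injective (Subtype.ext (by
    change conjBy K (star (z • b.1)) = z • conjBy K (star b.1)
    rw [star_smul, conjBy_smul]
    simp))

/-- The `*`-anti-automorphism `b ↦ K b* K` of a unital algebra of operators invariant under `K`. -/
def unitalAntiAut (s : StarSubalgebra ℂ (L2 α →L[ℂ] L2 α))
    (K : L2 α ≃ₗᵢ⋆[ℂ] L2 α) (hK : ∀ ξ, K (K ξ) = ξ) (hs : ∀ a ∈ s, conjBy K a ∈ s) :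
    s ≃⋆ₐ[ℂ] sᵐᵒᵖ where
  toFun b := MulOpposite.op ⟨conjBy K (star b.1), hs _ (star_mem b.2)⟩
  invFun b := ⟨conjBy K (star b.unop.1), hs _ (star_mem b.unop.2)⟩
  left_inv b := Subtype.ext (by
    change conjBy K (star (conjBy K (star b.1))) = b.1
    rw [star_conjBy hK, conjBy_conjBy hK, star_star])
  right_inv b := MulOpposite.unop_injective (Subtype.ext (by
    change conjBy K (star (conjBy K (star b.unop.1))) = b.unop.1
    rw [star_conjBy hK, conjBy_conjBy hK, star_star]))
  map_mul' b c := MulOpposite.unop_injective (Subtype.ext (by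
    change conjBy K (star (b.1 * c.1)) = conjBy K (star c.1) * conjBy K (star b.1)
    rw [star_mul, conjBy_mul hK]))
  map_add' b c := MulOpposite.unop_injective (Subtype.ext (by
    change conjBy K (star (b.1 + c.1)) = conjBy K (star b.1) + conjBy K (star c.1)
    rw [star_add, conjBy_add]))
  map_star' b := MulOpposite.unop_injective (Subtype.ext (by
    change conjBy K (star (star b.1)) = star (conjBy K (star b.1))
    rw [star_conjBy hK]))
  map_smul' z b := MulOpposite.unop_injective (Subtype.ext (by
    change conjBy K (star (z • b.1)) = z • conjBy K (star b.1)
    rw [star_smul, conjBy_smul]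
    simp))

theorem isClosed_fixed {A : Type*} [TopologicalSpace A] {s : Set A} (hs : IsClosed s) [T2Space A]
    {θ : s → s} (hθ : Continuous θ) : IsClosed {a : A | ∃ h : a ∈ s, θ ⟨a, h⟩ = ⟨a, h⟩} := by
  have h := hs.isClosedEmbedding_subtypeVal.isClosedMap _ (isClosed_eq hθ continuous_id)
  convert h using 1
  ext a
  constructor
  · rintro ⟨h, e⟩
    exact ⟨⟨a, h⟩, e, rfl⟩
  · rintro ⟨b, e, rfl⟩
    exact ⟨b.2, e⟩

theorem continuous_starAlgEquiv {s : NonUnitalStarSubalgebra ℂ (L2 α →L[ℂ] L2 α)}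
    (hs : IsClosed (s : Set (L2 α →L[ℂ] L2 α))) (θ : s ≃⋆ₐ[ℂ] s) : Continuous θ := by
  have := hs
  exact (StarAlgEquiv.isometry θ).continuous

theorem continuous_unital_starAlgEquiv {s : StarSubalgebra ℂ (L2 α →L[ℂ] L2 α)}
    (hs : IsClosed (s : Set (L2 α →L[ℂ] L2 α))) (θ : s ≃⋆ₐ[ℂ] s) : Continuous θ := by
  have := hs
  exact (StarAlgEquiv.isometry θ).continuous

/-- The fixed points of a `*`-automorphism. -/
def fixedAlg {A : Type*} [Ring A] [StarRing A] [Algebra ℂ A] [StarModule ℂ A]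
    (s : StarSubalgebra ℂ A) (θ : s ≃⋆ₐ[ℂ] s) : NonUnitalStarSubalgebra ℂ A where
  carrier := {a | ∃ h : a ∈ s, θ ⟨a, h⟩ = ⟨a, h⟩}
  add_mem' := by
    rintro a b ⟨ha, ha'⟩ ⟨hb, hb'⟩
    exact ⟨add_mem ha hb, (map_add θ ⟨a, ha⟩ ⟨b, hb⟩).trans (by rw [ha', hb']; rfl)⟩
  zero_mem' := ⟨zero_mem s, map_zero θ⟩
  mul_mem' := by
    rintro a b ⟨ha, ha'⟩ ⟨hb, hb'⟩
    exact ⟨mul_mem ha hb, (map_mul θ ⟨a, ha⟩ ⟨b, hb⟩).trans (by rw [ha', hb']; rfl)⟩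
  smul_mem' := by
    rintro z a ⟨ha, ha'⟩
    exact ⟨SMulMemClass.smul_mem z ha, (map_smul θ z ⟨a, ha⟩).trans (by rw [ha']; rfl)⟩
  star_mem' := by
    rintro a ⟨ha, ha'⟩
    exact ⟨star_mem ha, (map_star θ ⟨a, ha⟩).trans (by rw [ha']; rfl)⟩

theorem apply_eq_of_symm_trans {R T : Type*} [Add R] [Mul R] [SMul ℂ R] [Star R] [Add T] [Mul T]
    [SMul ℂ T] [Star T] {S S' : R ≃⋆ₐ[ℂ] T} {b : R} : (S'.trans S.symm) b = b ↔ S b = S' b := by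
  change S.symm (S' b) = b ↔ _
  constructor
  · intro h
    rw [← S.apply_symm_apply (S' b), h]
  · intro h
    rw [← h]
    exact S.symm_apply_apply b

/-- `S⁻¹ S'` is a `*`-automorphism, and its fixed points form a closed set containing `D`. -/
theorem antiAut_unique {A : Type*} [Ring A] [StarRing A] [Algebra ℂ A] [TopologicalSpace A]
    [T2Space A] {s : NonUnitalStarSubalgebra ℂ A} (hs : IsClosed (s : Set A))
    (hc : ∀ θ : s ≃⋆ₐ[ℂ] s, Continuous θ) {S S' : s ≃⋆ₐ[ℂ] sᵐᵒᵖ} {D : Set A}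
    (hD : ∀ b ∈ s, b ∈ closure D)
    (h : ∀ d ∈ D, ∃ hd : d ∈ s, S ⟨d, hd⟩ = S' ⟨d, hd⟩) : S = S' := by
  have hfix := isClosed_fixed (θ := S'.trans S.symm) hs (hc _)
  ext1 b
  obtain ⟨hb1, hb2⟩ := closure_minimal (fun d hd => (h d hd).imp fun _ e =>
    apply_eq_of_symm_trans.2 e) hfix (hD b.1 b.2)
  exact apply_eq_of_symm_trans.1 hb2

/-- Norm density is not available in the multiplier algebra. Instead `θ = S⁻¹ S'` fixes the ideal
generated by `s` pointwise, so `θ(T) x = θ(T x) = T x` for `x` in `s`, and the separation hypothesis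
gives `θ(T) = T`. -/
theorem multiplier_antiAut_unique {A : Type*} [Ring A] [StarRing A] [Algebra ℂ A] [StarModule ℂ A]
    [TopologicalSpace A] [T2Space A] [IsTopologicalRing A] [ContinuousStar A]
    [ContinuousConstSMul ℂ A] {s : Set A}
    (hM : IsClosed (multiplierAlg (NonUnitalStarAlgebra.adjoin ℂ s).topologicalClosure : Set A))
    (hc : ∀ θ : multiplierAlg (NonUnitalStarAlgebra.adjoin ℂ s).topologicalClosure ≃⋆ₐ[ℂ]
      multiplierAlg (NonUnitalStarAlgebra.adjoin ℂ s).topologicalClosure, Continuous θ)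
    {S S' : multiplierAlg (NonUnitalStarAlgebra.adjoin ℂ s).topologicalClosure ≃⋆ₐ[ℂ]
      (multiplierAlg (NonUnitalStarAlgebra.adjoin ℂ s).topologicalClosure)ᵐᵒᵖ}
    (hs : ∀ T, (∀ x ∈ s, T * x = 0) → T = 0)
    (h : ∀ x ∈ s, ∃ hx : x ∈ multiplierAlg (NonUnitalStarAlgebra.adjoin ℂ s).topologicalClosure,
      S ⟨x, hx⟩ = S' ⟨x, hx⟩) : S = S' := by
  have h' : ∀ x ∈ s, x ∈ fixedAlg (multiplierAlg
      (NonUnitalStarAlgebra.adjoin ℂ s).topologicalClosure) (S'.trans S.symm) := fun x hx =>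
    (h x hx).imp fun _ e => apply_eq_of_symm_trans.2 e
  have hle : (NonUnitalStarAlgebra.adjoin ℂ s).topologicalClosure ≤ fixedAlg (multiplierAlg
      (NonUnitalStarAlgebra.adjoin ℂ s).topologicalClosure) (S'.trans S.symm) :=
    NonUnitalStarSubalgebra.topologicalClosure_minimal _ (NonUnitalStarAlgebra.adjoin_le h')
      (isClosed_fixed hM (hc _))
  ext1 T
  refine apply_eq_of_symm_trans.1 (Subtype.ext (sub_eq_zero.1 (hs _ fun x hx => ?_)))
  obtain ⟨h1, h2⟩ := hle (T.2 x (NonUnitalStarSubalgebra.le_topologicalClosure _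
    (NonUnitalStarAlgebra.subset_adjoin ℂ _ hx))).1
  obtain ⟨h3, h4⟩ := h' x hx
  have h5 : (S'.trans S.symm) (T * ⟨x, h3⟩) = T * ⟨x, h3⟩ := h2
  rw [map_mul, h4] at h5
  rw [sub_mul, sub_eq_zero]
  exact congrArg Subtype.val h5

end AntiAutomorphism

/-! ### The operator `J ⊗ J` and the flipped comultiplication. -/

section TensorSquare

variable {n : ℕ} {lam : ℝ}

/-- The antiunitary operator `J ⊗ J`. -/
def J₂ (n : ℕ) (lam : ℝ) : L2 (X n × X n) ≃ₗᵢ⋆[ℂ] L2 (X n × X n) :=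
  antiunitary (fun P => (JMap P.1, JMap P.2)) (fun P => JWeight lam P.1 * JWeight lam P.2)
    (measurePreserving_JMap.prod measurePreserving_JMap)
    (fun P => by rw [JMap_JMap, JMap_JMap])
    (by unfold JWeight; fun_prop)
    (fun P => by rw [map_mul, mul_mul_mul_comm, JWeight_mul_conj, JWeight_mul_conj, one_mul])

theorem isCWC_J₂ : IsCWC (J₂ n lam) (fun P => (JMap P.1, JMap P.2))
    (fun P => JWeight lam P.1 * JWeight lam P.2) := isCWC_antiunitary ..

theorem J₂_J₂ (ξ : L2 (X n × X n)) : J₂ n lam (J₂ n lam ξ) = ξ :=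
  isCWC_J₂.apply_apply (fun P => by simp only [JMap_JMap])
    (fun P => by rw [map_mul, mul_mul_mul_comm, JWeight_JMap, JWeight_JMap, JWeight_mul_conj,
      JWeight_mul_conj, one_mul]) ξ

theorem conjBy_J₂_tensorOp (b c : L2 (X n) →L[ℂ] L2 (X n)) :
    conjBy (J₂ n lam) (tensorOp b c) = tensorOp (conjBy (J n lam) b) (conjBy (J n lam) c) :=
  conjBy_tensorOp (isCWC_J.map_tmul isCWC_J₂) b c

theorem conjBy_J₂_mem_spatialSquare {T : L2 (X n × X n) →L[ℂ] L2 (X n × X n)}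
    (hT : T ∈ spatialSquare (AHat n lam)) :
    conjBy (J₂ n lam) T ∈ spatialSquare (AHat n lam) :=
  conjBy_mem_closure_adjoin J₂_J₂ (by
    rintro _ ⟨b, hb, c, hc, rfl⟩
    exact ⟨_, conjBy_J_mem_AHat hb, _, conjBy_J_mem_AHat hc, conjBy_J₂_tensorOp b c⟩) hT

theorem conjBy_J₂_mem_MSquare (T : L2 (X n × X n) →L[ℂ] L2 (X n × X n))
    (hT : T ∈ MSquare n lam) : conjBy (J₂ n lam) T ∈ MSquare n lam :=
  conjBy_mem_multiplierAlg J₂_J₂ (fun _ h => conjBy_J₂_mem_spatialSquare h) hT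

theorem isWC_flipU : IsWC (flipU (α := X n)).toLinearIsometry.toContinuousLinearMap
    Prod.swap (1 : X n × X n → ℂ) := isWC_wcompEquiv ..

/-- The two phases of `J` give `β(x,y) + β(x',y')`, and the conjugated phase of the kernel adds
`β(x,y')`. The sum is `β(x+x', y+y') - β(x',y)`: the phase of `conjKernel` together with that of the
flipped comultiplication. -/
theorem comultKernel_conj (F : X n → ℂ) (t : ℝ) (P : X n × X n) :
    JWeight lam P.1 * conj (JWeight lam (shift lam P.1 t)) *
      (JWeight lam P.2 * conj (JWeight lam (shift lam P.2 t))) *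
      conj (comultKernel lam F t (baseCoord (JMap P.1, JMap P.2))) =
    comultKernel lam (conjKernel lam F) t (baseCoord P.swap) := by
  obtain ⟨⟨x, y, r⟩, x', y', r'⟩ := P
  rw [JWeight_mul_conj_shift, JWeight_mul_conj_shift]
  simp only [comultKernel, baseCoord, JMap, conjKernel, JWeight, map_mul, Prod.swap, ee_eq_eBar,
    conj_eBar, inner_neg_left, inner_neg_right, neg_neg, inner_add_left, inner_add_right]
  rw [show -x + -x' = -(x' + x) by abel, show -y + -y' = -(y' + y) by abel]
  have e : eBar (eta lam t * ⟪x, y⟫_ℝ) * eBar (eta lam t * ⟪x', y'⟫_ℝ) *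
      eBar (eta lam t * ⟪x, y'⟫_ℝ) =
      eBar (eta lam t * (⟪x', y'⟫_ℝ + ⟪x, y'⟫_ℝ + (⟪x', y⟫_ℝ + ⟪x, y⟫_ℝ))) *
        eBar (-(eta lam t * ⟪x', y⟫_ℝ)) := by
    rw [← eBar_add, ← eBar_add, ← eBar_add]
    congr 1
    ring
  linear_combination (conj (F (-(x' + x), -(y' + y), t))) * e

theorem conjBy_J₂_mulOp_mul_lamOp {F : X n → ℂ} (hF : CC F) (t : ℝ) :
    conjBy (J₂ n lam) (mulOp (fun P : X n × X n => comultKernel lam F t (baseCoord P)) *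
      tensorOp (lamOp n lam t) (lamOp n lam t)) =
    chi n (mulOp (fun P : X n × X n => comultKernel lam (conjKernel lam F) t (baseCoord P)) *
      tensorOp (lamOp n lam t) (lamOp n lam t)) := by
  refine (isCWC_J₂.conjBy ((isWC_mulOp (hF.bm.comultKernel t)).mul
    ((isWC_lamOp lam t).tensor (isWC_lamOp lam t)))).eq ((isWC_flipU.mul
      ((isWC_mulOp (hF.conjKernel.bm.comultKernel t)).mul
        ((isWC_lamOp lam t).tensor (isWC_lamOp lam t)))).mul isWC_flipU)
    (fun P => ?_) fun P => ?_
  · simp only [id_eq, shift_JMap, JMap_JMap, Prod.swap]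
  · simp only [id_eq, shift_JMap, JWeight_JMap, map_mul, map_pow, Complex.conj_ofReal,
      Pi.one_apply, one_mul, mul_one]
    rw [← comultKernel_conj]
    ring

theorem conjBy_J₂_comult_of_isRho {F : X n → ℂ} (hF : CC F) {A : L2 (X n) →L[ℂ] L2 (X n)}
    (hA : IsRho lam F A) :
    conjBy (J₂ n lam) (comult n lam A) = chi n (comult n lam (conjBy (J n lam) A)) :=
  WInt.unique (WInt.congr (WInt.conjBy J₂_J₂ (wInt_comult hF hA))
    (conjBy_J₂_mulOp_mul_lamOp hF))
    (((wInt_comult hF.conjKernel (hA.conjBy_J hF.bm)).mul_left _).mul_right _)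

theorem continuous_chi : Continuous (chi n) :=
  continuous_const_mul_mul_const _ _

theorem conjBy_J₂_comult {A : L2 (X n) →L[ℂ] L2 (X n)} (hA : A ∈ AHat n lam) :
    conjBy (J₂ n lam) (comult n lam A) = chi n (comult n lam (conjBy (J n lam) A)) :=
  closure_minimal (s := (rhoSub n lam : Set (L2 (X n) →L[ℂ] L2 (X n))))
    (t := {A | conjBy (J₂ n lam) (comult n lam A) = chi n (comult n lam (conjBy (J n lam) A))})
    (fun _ hA => hA.elim fun _ hF => conjBy_J₂_comult_of_isRho hF.1 hF.2)
    (isClosed_eq ((continuous_conjBy _).comp continuous_comult)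
      (continuous_chi.comp (continuous_comult.comp (continuous_conjBy _)))) (mem_AHat_iff.1 hA)

end TensorSquare

/-! ### Involutivity, and uniqueness of the tensor square. -/

section AntiAut

variable {α : Type*} [MeasureSpace α]

section

variable {s : NonUnitalStarSubalgebra ℂ (L2 α →L[ℂ] L2 α)} {K : L2 α ≃ₗᵢ⋆[ℂ] L2 α}
  {hK : ∀ ξ, K (K ξ) = ξ} {hs : ∀ a ∈ s, conjBy K a ∈ s}

theorem conjBy_star_conjBy_star (hK : ∀ ξ, K (K ξ) = ξ) (b : L2 α →L[ℂ] L2 α) :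
    conjBy K (star (conjBy K (star b))) = b := by
  rw [star_conjBy hK, conjBy_conjBy hK, star_star]

theorem antiAut_antiAut (b : s) : (antiAut s K hK hs (antiAut s K hK hs b).unop).unop = b :=
  Subtype.ext (conjBy_star_conjBy_star hK b.1)

theorem star_antiAut_star_antiAut (b : s) :
    star (antiAut s K hK hs (star (antiAut s K hK hs b).unop)).unop = b :=
  Subtype.ext (by
    change star (conjBy K (star (star (conjBy K (star b.1))))) = b.1
    rw [star_star, conjBy_conjBy hK, star_star])

theorem eq_antiAut_iff {S : s ≃⋆ₐ[ℂ] sᵐᵒᵖ} : S = antiAut s K hK hs ↔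
    ∀ (b : s) (ξ : L2 α), (S b).unop.1 ξ = K (star b.1 (K ξ)) := by
  constructor
  · rintro rfl b ξ
    rfl
  · intro h
    ext1 b
    exact MulOpposite.unop_injective (Subtype.ext (ContinuousLinearMap.ext (h b)))

end

theorem tensor_antiAut_unique [SigmaFinite (volume : Measure α)]
    {B : NonUnitalStarSubalgebra ℂ (L2 α →L[ℂ] L2 α)}
    {M : StarSubalgebra ℂ (L2 (α × α) →L[ℂ] L2 (α × α))}
    (hM : M = multiplierAlg (NonUnitalStarAlgebra.adjoin ℂ
      {T | ∃ b ∈ B, ∃ c ∈ B, T = tensorOp b c}).topologicalClosure)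
    (h0 : ∀ T : L2 (α × α) →L[ℂ] L2 (α × α),
      (∀ b ∈ B, ∀ c ∈ B, T * tensorOp b c = 0) → T = 0)
    {S S' : M ≃⋆ₐ[ℂ] Mᵐᵒᵖ}
    (h : ∀ b c : B, ∃ hx : tensorOp b.1 c.1 ∈ M,
      S ⟨tensorOp b.1 c.1, hx⟩ = S' ⟨tensorOp b.1 c.1, hx⟩) : S = S' := by
  subst hM
  have hc := isClosed_multiplierAlg (D := (NonUnitalStarAlgebra.adjoin ℂ
    {T | ∃ b ∈ B, ∃ c ∈ B, T = tensorOp b c}).topologicalClosure)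
    (NonUnitalStarSubalgebra.isClosed_topologicalClosure _)
  refine multiplier_antiAut_unique hc (continuous_unital_starAlgEquiv hc)
    (fun T hT => h0 T fun b hb c hc => hT _ ⟨b, hb, c, hc, rfl⟩) ?_
  rintro _ ⟨b, hb, c, hc, rfl⟩
  exact h ⟨b, hb⟩ ⟨c, hc⟩

end AntiAut

/-! ### The antipode and its tensor square. -/

section Antipode

variable {n : ℕ} {lam : ℝ}

theorem conjBy_J₂_star_comult {A : L2 (X n) →L[ℂ] L2 (X n)} (hA : A ∈ AHat n lam) :
    conjBy (J₂ n lam) (star (comult n lam A)) =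
      chi n (comult n lam (conjBy (J n lam) (star A))) :=
  (congrArg (conjBy (J₂ n lam)) (star_comult A)).trans (conjBy_J₂_comult (star_mem hA))

/-- The antipode `b ↦ J b* J` of `Â`. -/
def antipode (n : ℕ) (lam : ℝ) : AHat n lam ≃⋆ₐ[ℂ] (AHat n lam)ᵐᵒᵖ :=
  antiAut (AHat n lam) (J n lam) J_J fun _ h => conjBy_J_mem_AHat h

/-- The `*`-anti-automorphism `T ↦ (J ⊗ J) T* (J ⊗ J)` of `M(Â ⊗ Â)`. -/
def antipodeSquare (n : ℕ) (lam : ℝ) : MSquare n lam ≃⋆ₐ[ℂ] (MSquare n lam)ᵐᵒᵖ :=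
  unitalAntiAut (MSquare n lam) (J₂ n lam) J₂_J₂ conjBy_J₂_mem_MSquare

end Antipode

end

end QHeis

set_option maxHeartbeats 800000 in
theorem mainTheorem5 (n : ℕ) (lam : ℝ) :
    (∀ f : QHeis.FunAlg n, ∃ g : QHeis.FunAlg n, ∀ p, g.1 p = QHeis.antipodeFun lam f.1 p) ∧
    (∀ f : QHeis.FunAlg n, QHeis.rho lam f ∈ QHeis.AHat n lam) ∧
    (∀ b ∈ QHeis.AHat n lam, QHeis.comult n lam b ∈ QHeis.MSquare n lam) ∧
    (∃! S : QHeis.AHat n lam ≃⋆ₐ[ℂ] (QHeis.AHat n lam)ᵐᵒᵖ, QHeis.ExtendsAntipode S) ∧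
    ∀ S : QHeis.AHat n lam ≃⋆ₐ[ℂ] (QHeis.AHat n lam)ᵐᵒᵖ,
      (QHeis.ExtendsAntipode S ↔
        ∀ (b : QHeis.AHat n lam) (ξ : QHeis.L2 (QHeis.X n)),
          (S b).unop.1 ξ = QHeis.J n lam (star b.1 (QHeis.J n lam ξ))) ∧
      (QHeis.ExtendsAntipode S →
        (∀ b, star (S (star (S b).unop)).unop = b) ∧
        (∃! SS : QHeis.MSquare n lam ≃⋆ₐ[ℂ] (QHeis.MSquare n lam)ᵐᵒᵖ,
          QHeis.IsTensorSquare S SS) ∧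
        (∀ SS : QHeis.MSquare n lam ≃⋆ₐ[ℂ] (QHeis.MSquare n lam)ᵐᵒᵖ, QHeis.IsTensorSquare S SS →
          ∀ (b : QHeis.AHat n lam) (hb : QHeis.comult n lam b ∈ QHeis.MSquare n lam),
            (SS ⟨QHeis.comult n lam b, hb⟩).unop.1
              = QHeis.chi n (QHeis.comult n lam (S b).unop)) ∧
        (∀ b, (S (S b).unop).unop = b)) := by
  have hext : QHeis.ExtendsAntipode (QHeis.antipode n lam) := fun f g h b c hb hc =>
    MulOpposite.unop_injective (Subtype.ext
      ((congrArg (fun T => QHeis.conjBy (QHeis.J n lam) (star T)) hb).trans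
        ((QHeis.conjBy_J_star_rho h).trans hc.symm)))
  -- The extension property fixes `S` on the dense set of the `ρ_f`; `exists_antipodeFun` ensures
  -- that it says something about every `f`.
  have heq : ∀ S : QHeis.AHat n lam ≃⋆ₐ[ℂ] (QHeis.AHat n lam)ᵐᵒᵖ, QHeis.ExtendsAntipode S → S =
      QHeis.antipode n lam := fun S hS =>
    QHeis.antiAut_unique QHeis.isClosed_AHat (QHeis.continuous_starAlgEquiv QHeis.isClosed_AHat)
      (fun _ hb => QHeis.AHat_subset_closure_rho hb) fun _ hd => hd.elim fun f hf =>
        hf ▸ ⟨QHeis.rho_mem_AHat f, (QHeis.exists_antipodeFun lam f).elim fun g hg =>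
          (hS f g hg ⟨_, QHeis.rho_mem_AHat f⟩ ⟨_, QHeis.rho_mem_AHat g⟩ rfl rfl).trans
            (hext f g hg ⟨_, QHeis.rho_mem_AHat f⟩ ⟨_, QHeis.rho_mem_AHat g⟩ rfl rfl).symm⟩
  have hsq : QHeis.IsTensorSquare (QHeis.antipode n lam) (QHeis.antipodeSquare n lam) :=
    fun b c => MulOpposite.unop_injective (Subtype.ext
      (QHeis.conjBy_star_tensorOp (QHeis.isCWC_J.map_tmul QHeis.isCWC_J₂) b.1 c.1))
  have hsqeq : ∀ SS : QHeis.MSquare n lam ≃⋆ₐ[ℂ] (QHeis.MSquare n lam)ᵐᵒᵖ, QHeis.IsTensorSquare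
      (QHeis.antipode n lam) SS →
      SS = QHeis.antipodeSquare n lam := fun SS h =>
    QHeis.tensor_antiAut_unique rfl (fun _ hT => QHeis.eq_zero_of_mul_tensorOp hT) fun b c =>
      ⟨(QHeis.elemTensor b c).2, (h b c).trans (hsq b c).symm⟩
  refine ⟨QHeis.exists_antipodeFun lam, QHeis.rho_mem_AHat, fun b hb => QHeis.comult_mem_MSquare hb,
    ⟨_, hext, heq⟩, fun S => ⟨Iff.trans ⟨heq S, fun h => h ▸ hext⟩ QHeis.eq_antiAut_iff,
      fun hS => ?_⟩⟩
  have e := heq S hS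
  subst e
  refine ⟨?_, ?_, ?_, ?_⟩
  · exact fun b => QHeis.star_antiAut_star_antiAut b
  · exact ⟨_, hsq, hsqeq⟩
  · intro SS hSS b hb
    have e := hsqeq SS hSS
    subst e
    exact QHeis.conjBy_J₂_star_comult b.2
  · exact fun b => QHeis.antiAut_antiAut b
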